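/- **Theorem (twisted Wakimoto representation).** Let $\hbar,k\in\mathbb C$, put $q^u=e^{u\hbar}$ for $u\in\mathbb C$ and $[u]=(q^u-q^{-u})/(q-q^{-1})$. Assume that neither $q$ nor $q^k$ is a root of unity and that $[k+2]\neq0$, $[2k+2]\neq 0$. Let ${\rm A}\in\{{\rm NS},{\rm R}\}$, $\mathbb Z^{\rm NS}=\mathbb Z+\frac12$, $\mathbb Z^{\rm R}=\mathbb Z$, and let $\rho,\sigma\in\mathbb C$. *Fock space.* Consider the Heisenberg generators $\widetilde\alpha_n,\overline\alpha_n,\beta_n$ $(n\in\mathbb Z)$ and $Q_{\widetilde\alpha},Q_{\overline\alpha},Q_\beta$ with $$[\widetilde\alpha_n,\widetilde\alpha_m]=\tfrac{[(k+2)n][kn]}{n}\delta_{n+m,0},\quad [\overline\alpha_n,\overline\alpha_m]=-\tfrac{[2n][kn]}{n}\delta_{n+m,0},\quad [\beta_n,\beta_m]=\tfrac{[2n][(k+2)n]}{n}\delta_{n+m,0},$$ $[\widetilde\alpha_n,Q_{\widetilde\alpha}]=\delta_{n,0}$, $[\overline\alpha_n,Q_{\overline\alpha}]=-\delta_{n,0}$,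 $[\beta_n,Q_\beta]=\delta_{n,0}$ and all other commutators zero (for $n=0$ the right-hand sides of the first three relations are read as $0$). Let $|0\rangle$ be annihilated by $\widetilde\alpha_n,\overline\alpha_n,\beta_n$, $n\ge0$, let $\mathcal F(\xi,\rho',\sigma)=\mathbb C[\widetilde\alpha_{-1},\widetilde\alpha_{-2},\dots,\overline\alpha_{-1},\dots,\beta_{-1},\dots]\,e^{\xi Q_{\widetilde\alpha}+\rho' Q_{\overline\alpha}+\sigma Q_\beta}|0\rangle$, and $$\mathcal F_{\rm A}=\bigoplus_{n\in\mathbb Z}\mathcal F(\theta_{\rm A}+\rho+(k+2)n,\ \rho+2n,\ \sigma),\qquad \theta_{\rm NS}=0,\quad \theta_{\rm R}=k/2 .$$ *Vertex operators.* Let $:\bullet:$ be the normal ordering that puts $Q$'s and negative modes to the left of the non-negative modes, and set $$\widetilde V^\pm(z)=e^{\pm(k+2)Q_{\widetilde\alpha}}z^{\pm\frac1k\widetilde\alpha_0}:\exp\Bigl(\mp\sum_{m\ne0}\tfrac{z^{-m}}{[km]}\widetilde\alpha_m\Bigr):,\qquad Y^\pm(z)=e^{\pm2Q_{\overline\alpha}}z^{\pm\frac1k\overline\alpha_0}:\exp\Bigl(\mp\sum_{m\neq0}q^{\mp\frac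 k2|m|}\tfrac{z^{-m}}{[km]}\overline\alpha_m\Bigr):,$$ $$Z_\pm(z)=\exp\Bigl(\mp(q-q^{-1})\sum_{m\ge1}z^{\mp m}\tfrac{[m]}{[2m]}\overline\alpha_{\pm m}\Bigr)q^{\mp\frac12\overline\alpha_0},\qquad W_\pm(z)=\exp\Bigl(\mp(q-q^{-1})\sum_{m\ge1}z^{\mp m}\tfrac{[m]}{[2m]}\beta_{\pm m}\Bigr)q^{\mp\frac12\beta_0},$$ $$e_\pm(z)=\,:Y^+(z)Z_\pm(q^{\mp\frac{k+2}2}z)W_\pm(q^{\mp\frac k2}z):,\qquad f_\pm(z)=\,:Y^-(z)Z_\pm(q^{\pm\frac{k+2}2}z)W_\pm(q^{\pm\frac k2}z)^{-1}: .$$ Here a dilation $z\mapsto q^uz$ acts on $z^{\lambda a_0}$ by $(q^uz)^{\lambda a_0}=q^{u\lambda a_0}z^{\lambda a_0}$ for a zero mode $a_0$ and $\lambda\in\mathbb C$. *Currents.* $$K^\pm(z)=q^{\widetilde\alpha_0}\exp\Bigl((q-q^{-1})\sum_{\pm m>0}\widetilde\alpha_mz^{-m}\Bigr),\qquad K(z)=K^-(z)K^+(z),$$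 $$T(z)=\,:\widetilde V^+(q^{-1}z)\widetilde V^-(qz):\Bigl(q^{-1}:e_+(q^{-\frac{k+2}2}z)f_-(q^{\frac{k+2}2}z):-\tfrac{[k+2]}{[k+1]}:e_+(q^{-\frac{k+2}2}z)f_+(q^{\frac{k+2}2}z):+\,q:e_-(q^{-\frac{k+2}2}z)f_+(q^{\frac{k+2}2}z):\Bigr),$$ $$G^\pm(z)=z^{1/2}\bigl(G^\pm_+(z)-G^\pm_-(z)\bigr),\qquad G^+_\epsilon(z)=\tfrac{1}{q-q^{-1}}\widetilde V^+(q^{-k-2}z)e_\epsilon(q^{-\frac{3k+4}2}z),\qquad G^-_\epsilon(z)=-\tfrac1{q-q^{-1}}\widetilde V^-(q^{k+2}z)f_\epsilon(q^{\frac{3k+4}2}z).$$ *Claim.* The modes of these currents act on $\mathcal F_{\rm A}$, where $K^\pm(z)=\sum_{\pm m\in\mathbb Z_{\ge0}}K^\pm_mz^{-m}$, $T(z)=\sum_{m\in\mathbb Z}T_mz^{-m}$, $G^\pm(z)=\sum_{m\in\mathbb Z^{\rm A}}G^\pm_mz^{-m}$. All infinite sums of operators below have only finitely many nonzero terms on each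 vector, $K^+_0=K^-_0$ is invertible, and the following relations hold on $\mathcal F_{\rm A}$ as identities of formal series (upper or lower signs throughout), where rational functions of $z/w$ are expanded in non-negative powers of $z/w$ and $\delta^{\rm A}(x)=\sum_{m\in\mathbb Z^{\rm A}}x^m$, $\delta=\delta^{\rm R}$: \begin{align*} &K^\pm(z)K^\pm(w)=K^\pm(w)K^\pm(z),\qquad K^-(z)K^+(w)=\tfrac{(1-q^{2k+2}z/w)(1-q^{-2k-2}z/w)}{(1-q^2z/w)(1-q^{-2}z/w)}K^+(w)K^-(z),\\ &K^-(z)T(w)=\tfrac{(1-q^{k+1}z/w)(1-q^{-k-1}z/w)}{(1-q^{k+3}z/w)(1-q^{-k-3}z/w)}T(w)K^-(z),\qquad T(z)K^+(w)=\tfrac{(1-q^{k+1}z/w)(1-q^{-k-1}z/w)}{(1-q^{k+3}z/w)(1-q^{-k-3}z/w)}K^+(w)T(z),\\ &K^-(z)G^\pm(w)=q^{\pm(k+2)}\tfrac{1-z/w}{1-q^{\pm2(k+2)}z/w}G^\pm(w)K^-(z),\qquad G^\pm(z)K^+(w)=q^{\mp(k+2)}\tfrac{1-z/w}{1-q^{\mp2(k+2)}z/w}K^+(w)G^\pm(z),\\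 &G^\pm(z)G^\pm(w)+G^\pm(w)G^\pm(z)=0,\\ &G^+(z)G^-(w)+G^-(w)G^+(z)=\tfrac1{(q-q^{-1})^2}\Bigl(\delta^{\rm A}\bigl(q^{4(k+1)}\tfrac wz\bigr)\tfrac1{[k+1]}K(q^{2(k+1)}w)-\delta^{\rm A}\bigl(q^{2(k+2)}\tfrac wz\bigr)+\delta^{\rm A}\bigl(q^{2(k+1)}\tfrac wz\bigr)T(q^{k+1}w)\Bigr),\\ &G^\pm(z)T(w)-T(w)G^\pm(z)=\pm(q-q^{-1})\tfrac{[k+2]}{[k+1]}\delta^{\rm A}\bigl(q^{\pm3(k+1)}\tfrac wz\bigr)K^-(q^{\pm(k+1)}w)G^\pm(q^{\pm(k+1)}w)K^+(q^{\pm(k+1)}w),\\ &T(z)T(w)-T(w)T(z)=(q-q^{-1})\tfrac{[k+2]^2}{[k+1]}\sum_{\epsilon=\pm1}\epsilon\,\delta\bigl(q^{2\epsilon(k+1)}\tfrac wz\bigr)K^-(q^{\epsilon(k+1)}w)W(q^{\epsilon(k+1)}w)K^+(q^{\epsilon(k+1)}w). \end{align*} Here, with $K(z)=\sum_mK_mz^{-m}$,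 the current $W(z)=\sum_{m\in\mathbb Z}W_mz^{-m}$ is given by $$W_m=\tfrac{c^{\rm A}_m(2k+2)}{[k+1]}K_m-c^{\rm A}_0(k+2)\delta_{m,0}+c^{\rm A}_m(k+1)T_m-(q-q^{-1})^3\sum_{\gamma\in\mathbb Z^{\rm A}}N(-\gamma,m+\gamma),$$ where $N(m,n)$ equals $G^+_mG^-_n$ if $m<n$, $\frac12(G^+_mG^-_m-G^-_mG^+_m)$ if $m=n$, and $-G^-_nG^+_m$ if $m>n$; and $c^{\rm A}_m(u)=\frac1{[u]}$ if (${\rm A}={\rm NS}$, $m$ even) or (${\rm A}={\rm R}$, $m$ odd), and $c^{\rm A}_m(u)=\frac1{[u]}\frac{q^u+q^{-u}}2$ otherwise. In a product $\delta^{\rm A}(q^uw/z)$ the power $(q^u)^m$ means $e^{um\hbar}$. -/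

import Mathlib

namespace SVir

noncomputable section

/-! ### Parameters: `q = exp h`, and `q ^ u = exp (u h)` for every complex `u` -/

/-- `q ^ u`, where `q = exp h`. -/
def qp (h u : ℂ) : ℂ := Complex.exp (u * h)

/-- The number `q - q⁻¹`. -/
def qq (h : ℂ) : ℂ := qp h 1 - qp h (-1)

/-- The `q`-number `[u] = (q ^ u - q ^ (-u)) / (q - q⁻¹)`. -/
def qn (h u : ℂ) : ℂ := (qp h u - qp h (-u)) / qq h

/-- Genericity of `q` and `k`: neither `q` nor `q ^ k` is a root of unity, `[k+2] ≠ 0` and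
`[2k+2] ≠ 0`. These are exactly the conditions under which no denominator vanishes in the
definition of the currents and of the relations. -/
def Generic (h k : ℂ) : Prop :=
  (∀ n : ℕ, 0 < n → qp h n ≠ 1) ∧ (∀ n : ℕ, 0 < n → qp h (k * n) ≠ 1) ∧
    qn h (k + 2) ≠ 0 ∧ qn h (2 * k + 2) ≠ 0

/-- The Neveu-Schwarz and the Ramond sector. -/
inductive Sector
  | NS
  | R

/-- The set of mode labels is `ℤ + 1/2` in the NS sector and `ℤ` in the R sector. -/
def Sector.offset : Sector → ℂ
  | .NS => 1 / 2
  | .R => 0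

/-- `ℤ^A`, as a set of complex numbers. -/
def Sector.modes (A : Sector) : Set ℂ := {m | ∃ n : ℤ, m = n + A.offset}

/-! ### Formal series with operator coefficients

A formal series `A(z) = ∑ A_m z^{-m}` is the family `m ↦ A_m` of its modes, where the exponents
may be arbitrary complex numbers; a series `X(z,w) = ∑ X_{m,n} z^{-m} w^{-n}` is the family
`m n ↦ X_{m,n}`. -/

section Formal

variable {M : Type*} [AddCommGroup M] [Module ℂ M]

/-- Only finitely many members of the family act nontrivially on any given vector. -/
def PointwiseFinite {ι : Type*} (f : ι → Module.End ℂ M) : Prop :=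
  ∀ v : M, {i | f i v ≠ 0}.Finite

/-- The sum of a pointwise finite family of endomorphisms. -/
def sumEnd {ι : Type*} (f : ι → Module.End ℂ M) (hf : PointwiseFinite f) : Module.End ℂ M where
  toFun v := ∑ᶠ i, f i v
  map_add' v w := by
    simp only [map_add]
    exact finsum_add_distrib (hf v) (hf w)
  map_smul' c v := by
    simp only [map_smul, RingHom.id_apply]
    exact (smul_finsum' c (hf v)).symm

open Classical in
/-- The sum of a family of endomorphisms, which is set to `0` unless the family is pointwise
finite. -/
def lfSum {ι : Type*} (f : ι → Module.End ℂ M) : Module.End ℂ M :=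
  if hf : PointwiseFinite f then sumEnd f hf else 0

/-- `A(z) B(w)`. -/
def zw (A B : ℂ → Module.End ℂ M) : ℂ → ℂ → Module.End ℂ M := fun m n => A m * B n

/-- `B(w) A(z)`. -/
def wz (B A : ℂ → Module.End ℂ M) : ℂ → ℂ → Module.End ℂ M := fun m n => B n * A m

/-- The terms of the mode `m` of `A(z) B(z)`. -/
def mulTerm (A B : ℂ → Module.End ℂ M) (m : ℂ) : ℂ → Module.End ℂ M :=
  fun a => A a * B (m - a)

/-- The product `A(z) B(z)` at coinciding points. -/
def mul₂ (A B : ℂ → Module.End ℂ M) : ℂ → Module.End ℂ M := fun m => lfSum (mulTerm A B m)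

/-- The terms of the mode `m` of `A(z) B(z) C(z)`. -/
def mulTerm₃ (A B C : ℂ → Module.End ℂ M) (m : ℂ) : ℂ × ℂ → Module.End ℂ M :=
  fun p => A p.1 * B (m - p.1 - p.2) * C p.2

/-- The product `A(z) B(z) C(z)` at coinciding points. -/
def mul₃ (A B C : ℂ → Module.End ℂ M) : ℂ → Module.End ℂ M :=
  fun m => lfSum (mulTerm₃ A B C m)

/-- The terms of the coefficient `m, n` of `f(z/w) X(z,w)`. -/
def taylorTerm (f : PowerSeries ℂ) (X : ℂ → ℂ → Module.End ℂ M) (m n : ℂ) :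
    ℕ → Module.End ℂ M :=
  fun l => PowerSeries.coeff l f • X (m + l) (n - l)

/-- `f(z/w) X(z,w)` for a power series `f`. -/
def taylorMul (f : PowerSeries ℂ) (X : ℂ → ℂ → Module.End ℂ M) : ℂ → ℂ → Module.End ℂ M :=
  fun m n => lfSum (taylorTerm f X m n)

/-- `B(q ^ u z)`. -/
def rescale (h u : ℂ) (B : ℂ → Module.End ℂ M) : ℂ → Module.End ℂ M :=
  fun m => qp h (-u * m) • B m

open Classical in
/-- `δ^A(q ^ u w / z) B(w)`, where `δ^A(x) = ∑_{m ∈ ℤ^A} x ^ m`. -/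
def deltaMul (h : ℂ) (A : Sector) (u : ℂ) (B : ℂ → Module.End ℂ M) :
    ℂ → ℂ → Module.End ℂ M :=
  fun m n => if m ∈ A.modes then qp h (u * m) • B (m + n) else 0

open Classical in
/-- The constant series `1`. -/
def oneSeries : ℂ → Module.End ℂ M := fun m => if m = 0 then 1 else 0

/-- Equality of two series in `z, w` as operators on the subspace `F`. -/
def EqOnSpace (F : Submodule ℂ M) (X Y : ℂ → ℂ → Module.End ℂ M) : Prop :=
  ∀ m n : ℂ, ∀ v ∈ F, X m n v = Y m n v

end Formal

/-! ### The relations of the algebra in terms of generating functions -/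

/-- A family of currents `K^±(z)`, `T(z)`, `G^±(z)`; the sign is an element of `ℤˣ = {1, -1}`. -/
structure Currents (M : Type*) [AddCommGroup M] [Module ℂ M] where
  K : ℤˣ → ℂ → Module.End ℂ M
  T : ℂ → Module.End ℂ M
  G : ℤˣ → ℂ → Module.End ℂ M

section Relations

variable {M : Type*} [AddCommGroup M] [Module ℂ M]

/-- `K(z) = K^-(z) K^+(z)`. -/
def Currents.KK (C : Currents M) : ℂ → Module.End ℂ M := mul₂ (C.K (-1)) (C.K 1)

open Classical in
/-- The coefficients `c^A_m(u)`. -/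
def cCoeff (h : ℂ) : Sector → ℂ → ℂ → ℂ
  | .NS, u, m =>
      if ∃ j : ℤ, m = 2 * j then 1 / qn h u else 1 / qn h u * ((qp h u + qp h (-u)) / 2)
  | .R, u, m =>
      if ∃ j : ℤ, m = 2 * j then 1 / qn h u * ((qp h u + qp h (-u)) / 2) else 1 / qn h u

open Classical in
/-- The normal ordered product of the modes `G^+_m` and `G^-_n`, where `m - n` is real. -/
def Currents.normalGG (C : Currents M) (m n : ℂ) : Module.End ℂ M :=
  if m = n then (1 / 2 : ℂ) • (C.G 1 m * C.G (-1) m - C.G (-1) m * C.G 1 m)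
  else if m.re < n.re then C.G 1 m * C.G (-1) n
  else -(C.G (-1) n * C.G 1 m)

/-- The terms, labelled by `γ = j + A.offset ∈ ℤ^A`, of the mode `m` of the normal ordered product
of `G^+(z)` and `G^-(z)`. -/
def Currents.normalTerm (C : Currents M) (A : Sector) (m : ℂ) : ℤ → Module.End ℂ M :=
  fun j => C.normalGG (-(j + A.offset)) (m + (j + A.offset))

/-- The current `W(z)`. -/
def Currents.W (C : Currents M) (h k : ℂ) (A : Sector) : ℂ → Module.End ℂ M :=
  fun m =>
    (cCoeff h A (2 * k + 2) m / qn h (k + 1)) • C.KK m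
      - cCoeff h A (k + 2) 0 • oneSeries m
      + cCoeff h A (k + 1) m • C.T m
      - (qq h ^ 3) • lfSum (C.normalTerm A m)

/-- The power series `(1 - a x)(1 - b x) / ((1 - c x)(1 - d x))`. -/
def ratio₂ (a b c d : ℂ) : PowerSeries ℂ :=
  (1 - PowerSeries.C a * PowerSeries.X) * (1 - PowerSeries.C b * PowerSeries.X) *
    ((1 - PowerSeries.C c * PowerSeries.X) * (1 - PowerSeries.C d * PowerSeries.X))⁻¹

/-- The power series `(1 - x) / (1 - c x)`. -/
def ratio₁ (c : ℂ) : PowerSeries ℂ :=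
  (1 - PowerSeries.X) * (1 - PowerSeries.C c * PowerSeries.X)⁻¹

/-- The currents `C` give a representation of the deformed `N = 2` superconformal algebra in the
sector `A` on the space `F`: they preserve `F`, they have the required mode expansions, all the
infinite sums of operators that occur are pointwise finite, `K^+_0 = K^-_0` is invertible on `F`,
and the defining relations hold on `F` in generating function form. -/
structure IsRepresentation (h k : ℂ) (A : Sector) (F : Submodule ℂ M) (C : Currents M) :
    Prop where
  K_mem : ∀ s m, ∀ v ∈ F, C.K s m v ∈ F
  T_mem : ∀ m, ∀ v ∈ F, C.T m v ∈ F
  G_mem : ∀ s m, ∀ v ∈ F, C.G s m v ∈ F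
  K_modes : ∀ s m, ∀ v ∈ F, C.K s m v ≠ 0 → ∃ n : ℕ, m = (s : ℤ) * n
  T_modes : ∀ m, ∀ v ∈ F, C.T m v ≠ 0 → ∃ n : ℤ, m = n
  G_modes : ∀ s m, ∀ v ∈ F, C.G s m v ≠ 0 → m ∈ A.modes
  finite_KK : ∀ m, PointwiseFinite (mulTerm (C.K (-1)) (C.K 1) m)
  finite_GG : ∀ m, PointwiseFinite (C.normalTerm A m)
  finite_KGK : ∀ s m, PointwiseFinite (mulTerm₃ (C.K (-1)) (C.G s) (C.K 1) m)
  finite_KWK : ∀ m, PointwiseFinite (mulTerm₃ (C.K (-1)) (C.W h k A) (C.K 1) m)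
  finite_KpKm : ∀ f m n, PointwiseFinite (taylorTerm f (wz (C.K 1) (C.K (-1))) m n)
  finite_TKm : ∀ f m n, PointwiseFinite (taylorTerm f (wz C.T (C.K (-1))) m n)
  finite_KpT : ∀ f m n, PointwiseFinite (taylorTerm f (wz (C.K 1) C.T) m n)
  finite_GKm : ∀ s f m n, PointwiseFinite (taylorTerm f (wz (C.G s) (C.K (-1))) m n)
  finite_KpG : ∀ s f m n, PointwiseFinite (taylorTerm f (wz (C.K 1) (C.G s)) m n)
  K_zero : ∀ v ∈ F, C.K 1 0 v = C.K (-1) 0 v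
  K_zero_bij : Set.BijOn (C.K 1 0) F F
  rel_KK : ∀ s, EqOnSpace F (zw (C.K s) (C.K s)) (wz (C.K s) (C.K s))
  rel_KmKp : EqOnSpace F (zw (C.K (-1)) (C.K 1))
    (taylorMul (ratio₂ (qp h (2 * k + 2)) (qp h (-(2 * k + 2))) (qp h 2) (qp h (-2)))
      (wz (C.K 1) (C.K (-1))))
  rel_KmT : EqOnSpace F (zw (C.K (-1)) C.T)
    (taylorMul (ratio₂ (qp h (k + 1)) (qp h (-(k + 1))) (qp h (k + 3)) (qp h (-(k + 3))))
      (wz C.T (C.K (-1))))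
  rel_TKp : EqOnSpace F (zw C.T (C.K 1))
    (taylorMul (ratio₂ (qp h (k + 1)) (qp h (-(k + 1))) (qp h (k + 3)) (qp h (-(k + 3))))
      (wz (C.K 1) C.T))
  rel_KmG : ∀ s : ℤˣ, EqOnSpace F (zw (C.K (-1)) (C.G s))
    (qp h ((s : ℤ) * (k + 2)) •
      taylorMul (ratio₁ (qp h ((s : ℤ) * (2 * (k + 2))))) (wz (C.G s) (C.K (-1))))
  rel_GKp : ∀ s : ℤˣ, EqOnSpace F (zw (C.G s) (C.K 1))
    (qp h (-((s : ℤ) * (k + 2))) •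
      taylorMul (ratio₁ (qp h (-((s : ℤ) * (2 * (k + 2)))))) (wz (C.K 1) (C.G s)))
  rel_GG : ∀ s, EqOnSpace F (zw (C.G s) (C.G s) + wz (C.G s) (C.G s)) 0
  rel_GpGm : EqOnSpace F (zw (C.G 1) (C.G (-1)) + wz (C.G (-1)) (C.G 1))
    ((1 / qq h ^ 2) •
      ((1 / qn h (k + 1)) • deltaMul h A (4 * (k + 1)) (rescale h (2 * (k + 1)) C.KK)
        - deltaMul h A (2 * (k + 2)) oneSeries
        + deltaMul h A (2 * (k + 1)) (rescale h (k + 1) C.T)))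
  rel_GT : ∀ s : ℤˣ, EqOnSpace F (zw (C.G s) C.T - wz C.T (C.G s))
    (((s : ℤ) * (qq h * (qn h (k + 2) / qn h (k + 1)))) •
      deltaMul h A ((s : ℤ) * (3 * (k + 1)))
        (rescale h ((s : ℤ) * (k + 1)) (mul₃ (C.K (-1)) (C.G s) (C.K 1))))
  rel_TT : EqOnSpace F (zw C.T C.T - wz C.T C.T)
    ((qq h * (qn h (k + 2) ^ 2 / qn h (k + 1))) •
      (deltaMul h .R (2 * (k + 1))
          (rescale h (k + 1) (mul₃ (C.K (-1)) (C.W h k A) (C.K 1)))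
        - deltaMul h .R (-(2 * (k + 1)))
          (rescale h (-(k + 1)) (mul₃ (C.K (-1)) (C.W h k A) (C.K 1)))))

end Relations

/-! ### Fock spaces

The index `b : Fin 3` of a boson stands for `α̃`, `ᾱ`, `β` in this order. -/

/-- `⁅b_m, b_{-m}⁆` for `m > 0`. -/
def bracket (h k : ℂ) (b : Fin 3) (m : ℕ) : ℂ :=
  ![qn h ((k + 2) * m) * qn h (k * m) / m,
    -(qn h (2 * m) * qn h (k * m) / m),
    qn h (2 * m) * qn h ((k + 2) * m) / m] b

/-- The polynomial ring in the creation operators `b_{-j}`, `j > 0`. -/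
abbrev Osc : Type := MvPolynomial (Fin 3 × ℕ+) ℂ

/-- The action of the Heisenberg generator `b_m`, `m ≠ 0`, on polynomials in the creation
operators; the zero modes are treated separately, and the value at `m = 0` is `0`. -/
def osc (h k : ℂ) (b : Fin 3) : ℤ → Module.End ℂ Osc
  | Int.ofNat 0 => 0
  | Int.ofNat (n + 1) =>
      bracket h k b (n + 1) • (MvPolynomial.pderiv (R := ℂ) (b, n.succPNat)).toLinearMap
  | Int.negSucc n => LinearMap.mulLeft ℂ (MvPolynomial.X (b, n.succPNat))

/-- Momenta `(ξ, ρ, σ)`. -/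
abbrev Momentum : Type := Fin 3 → ℂ

/-- The direct sum of the Fock spaces
`ℂ[α̃_{-1}, …, ᾱ_{-1}, …, β_{-1}, …] e^{ξ Q_α̃ + ρ Q_ᾱ + σ Q_β} |0⟩` over all momenta. -/
abbrev Fock : Type := Momentum →₀ Osc

/-- The eigenvalues of `α̃_0, ᾱ_0, β_0` at a given momentum; they are determined by
`[α̃_0, Q_α̃] = 1`, `[ᾱ_0, Q_ᾱ] = -1`, `[β_0, Q_β] = 1`. -/
def zeroMode (μ : Momentum) : Fin 3 → ℂ := ![μ 0, -μ 1, μ 2]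

/-- The shift of the first momentum in the two sectors. -/
def Sector.shift (k : ℂ) : Sector → ℂ
  | .NS => 0
  | .R => k / 2

/-- The Fock representation space: the direct sum over `n : ℤ` of the Fock spaces of momentum
`(ρ + (k+2) n, ρ + 2 n, σ)` in the NS sector and `(k/2 + ρ + (k+2) n, ρ + 2 n, σ)` in the R
sector. -/
def fockSpace (k : ℂ) (A : Sector) (ρ σ : ℂ) : Submodule ℂ Fock :=
  Finsupp.supported Osc ℂ {μ | ∃ n : ℤ, μ = ![A.shift k + ρ + (k + 2) * n, ρ + 2 * n, σ]}

/-! ### Vertex operators -/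

/-- The data of a normal ordered exponential
`:exp(∑_b shift_b Q_b) z^{∑_b zpow_b b_0} q^{∑_b qpow_b b_0} exp(∑_{b, m ≠ 0} coef_b(m) b_m z^{-m}):`
in which `b` runs through the three bosons. The value of `coef` at `m = 0` is irrelevant. -/
structure Vertex where
  shift : Fin 3 → ℂ
  zpow : Fin 3 → ℂ
  qpow : Fin 3 → ℂ
  coef : Fin 3 → ℤ → ℂ

namespace Vertex

/-- The normal ordered product `:A(z) B(z):`. -/
instance : Mul Vertex where
  mul A B := ⟨A.shift + B.shift, A.zpow + B.zpow, A.qpow + B.qpow, A.coef + B.coef⟩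

/-- The inverse under the normal ordered product. -/
instance : Inv Vertex where
  inv A := ⟨-A.shift, -A.zpow, -A.qpow, -A.coef⟩

/-- `A(q ^ u z)`. -/
def dilate (h u : ℂ) (A : Vertex) : Vertex where
  shift := A.shift
  zpow := A.zpow
  qpow := fun b => A.qpow b + u * A.zpow b
  coef := fun b m => qp h (-u * m) * A.coef b m

end Vertex

/-- The exponential of a power series without constant term. -/
def expSeries {R : Type*} [Ring R] [Algebra ℂ R] (S : PowerSeries R) : PowerSeries R :=
  PowerSeries.mk fun n =>
    ∑ j ∈ Finset.range (n + 1), ((Nat.factorial j : ℂ)⁻¹) • PowerSeries.coeff n (S ^ j)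

namespace Vertex

/-- `exp(∑_{b, m > 0} coef_b(-m) b_{-m} z^m)`, a power series in `z`. -/
def creation (h k : ℂ) (A : Vertex) : PowerSeries (Module.End ℂ Osc) :=
  expSeries (PowerSeries.mk fun m => ∑ b, A.coef b (-(m : ℤ)) • osc h k b (-(m : ℤ)))

/-- `exp(∑_{b, m > 0} coef_b(m) b_m z^{-m})`, a power series in `z⁻¹`. -/
def annihilation (h k : ℂ) (A : Vertex) : PowerSeries (Module.End ℂ Osc) :=
  expSeries (PowerSeries.mk fun m => ∑ b, A.coef b (m : ℤ) • osc h k b (m : ℤ))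

open Classical in
/-- The coefficient of `z ^ x` in the product of the creation and the annihilation part. -/
def oscCoeff (h k : ℂ) (A : Vertex) (x : ℂ) : Module.End ℂ Osc :=
  lfSum fun p : ℕ × ℕ =>
    if (p.1 : ℂ) - p.2 = x then
      PowerSeries.coeff p.1 (A.creation h k) * PowerSeries.coeff p.2 (A.annihilation h k)
    else 0

/-- The mode `m`, that is the coefficient of `z ^ (-m)`, of the vertex operator. The zero modes
act first, and `exp(∑ shift_b Q_b)` shifts the momentum. -/
def field (h k : ℂ) (A : Vertex) (m : ℂ) : Module.End ℂ Fock :=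
  Finsupp.lsum ℂ fun μ : Momentum =>
    (Finsupp.lsingle (μ + A.shift) : Osc →ₗ[ℂ] Fock) ∘ₗ
      (qp h (∑ b, A.qpow b * zeroMode μ b) •
        A.oscCoeff h k (-m - ∑ b, A.zpow b * zeroMode μ b))

end Vertex

/-- `Ṽ^±(z)`. -/
def vtxV (h k : ℂ) (s : ℤˣ) : Vertex where
  shift := ![(s : ℤ) * (k + 2), 0, 0]
  zpow := ![(s : ℤ) / k, 0, 0]
  qpow := 0
  coef := fun b m => ![-(s : ℤ) / qn h (k * m), 0, 0] b

/-- `Y^±(z)`. -/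
def vtxY (h k : ℂ) (s : ℤˣ) : Vertex where
  shift := ![0, (s : ℤ) * 2, 0]
  zpow := ![0, (s : ℤ) / k, 0]
  qpow := 0
  coef := fun b m =>
    ![0, -(s : ℤ) * qp h (-(s : ℤ) * (k / 2 * (|m| : ℤ))) / qn h (k * m), 0] b

/-- `Z_±(z)`. -/
def vtxZ (h : ℂ) (s : ℤˣ) : Vertex where
  shift := 0
  zpow := 0
  qpow := ![0, -(s : ℤ) / 2, 0]
  coef := fun b m =>
    if 0 < (s : ℤ) * m then ![0, -(s : ℤ) * qq h * (qn h m / qn h (2 * m)), 0] b else 0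

/-- `W_±(z)`. -/
def vtxW (h : ℂ) (s : ℤˣ) : Vertex where
  shift := 0
  zpow := 0
  qpow := ![0, 0, -(s : ℤ) / 2]
  coef := fun b m =>
    if 0 < (s : ℤ) * m then ![0, 0, -(s : ℤ) * qq h * (qn h m / qn h (2 * m))] b else 0

/-- `e_±(z) = :Y^+(z) Z_±(q^{∓(k+2)/2} z) W_±(q^{∓k/2} z):`. -/
def vtxE (h k : ℂ) (s : ℤˣ) : Vertex :=
  vtxY h k 1 * (vtxZ h s).dilate h (-(s : ℤ) * ((k + 2) / 2)) *
    (vtxW h s).dilate h (-(s : ℤ) * (k / 2))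

/-- `f_±(z) = :Y^-(z) Z_±(q^{±(k+2)/2} z) W_±(q^{±k/2} z)⁻¹:`. -/
def vtxF (h k : ℂ) (s : ℤˣ) : Vertex :=
  vtxY h k (-1) * (vtxZ h s).dilate h ((s : ℤ) * ((k + 2) / 2)) *
    ((vtxW h s).dilate h ((s : ℤ) * (k / 2)))⁻¹

/-- `K^±(z) = q^{α̃_0} exp((q - q⁻¹) ∑_{±m > 0} α̃_m z^{-m})`. -/
def vtxK (h : ℂ) (s : ℤˣ) : Vertex where
  shift := 0
  zpow := 0
  qpow := ![1, 0, 0]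
  coef := fun b m => if 0 < (s : ℤ) * m then ![qq h, 0, 0] b else 0

/-! ### The twisted Wakimoto currents

A product of a vertex operator in `α̃` and one in `ᾱ, β`, taken at the same point, is its own
normal ordering, because these bosons commute with each other. -/

/-- `:Ṽ^+(q⁻¹ z) Ṽ^-(q z): :e_a(q^{-(k+2)/2} z) f_b(q^{(k+2)/2} z):` for signs `a`, `b`. -/
def vtxT (h k : ℂ) (a b : ℤˣ) : Vertex :=
  ((vtxV h k 1).dilate h (-1) * (vtxV h k (-1)).dilate h 1) *
    ((vtxE h k a).dilate h (-((k + 2) / 2)) * (vtxF h k b).dilate h ((k + 2) / 2))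

/-- `T(z)`. -/
def currentT (h k : ℂ) (m : ℂ) : Module.End ℂ Fock :=
  qp h (-1) • (vtxT h k 1 (-1)).field h k m
    - (qn h (k + 2) / qn h (k + 1)) • (vtxT h k 1 1).field h k m
    + qp h 1 • (vtxT h k (-1) 1).field h k m

/-- `G^+_ε(z) = (q - q⁻¹)⁻¹ Ṽ^+(q^{-k-2} z) e_ε(q^{-(3k+4)/2} z)`. -/
def currentGp (h k : ℂ) (ε : ℤˣ) (m : ℂ) : Module.End ℂ Fock :=
  (1 / qq h) •
    ((vtxV h k 1).dilate h (-(k + 2)) * (vtxE h k ε).dilate h (-((3 * k + 4) / 2))).field h k m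

/-- `G^-_ε(z) = -(q - q⁻¹)⁻¹ Ṽ^-(q^{k+2} z) f_ε(q^{(3k+4)/2} z)`. -/
def currentGm (h k : ℂ) (ε : ℤˣ) (m : ℂ) : Module.End ℂ Fock :=
  (-(1 / qq h)) •
    ((vtxV h k (-1)).dilate h (k + 2) * (vtxF h k ε).dilate h ((3 * k + 4) / 2)).field h k m

/-- `K^±(z)`, `T(z)` and `G^±(z) = z^{1/2} (G^±_+(z) - G^±_-(z))`; the coefficient of `z^{-m}` in
`z^{1/2} A(z)` is the mode `m + 1/2` of `A(z)`. -/
def wakimoto (h k : ℂ) : Currents Fock where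
  K s := (vtxK h s).field h k
  T := currentT h k
  G s := fun m =>
    if s = 1 then currentGp h k 1 (m + 1 / 2) - currentGp h k (-1) (m + 1 / 2)
    else currentGm h k 1 (m + 1 / 2) - currentGm h k (-1) (m + 1 / 2)

end

end SVir

/-! All currents are sums of normal ordered exponentials in Heisenberg generators, so every relation
reduces to the product of two such exponentials. Moving annihilation operators past creation
operators gives A(z)B(w) = q^a z^b C(w/z) :A(z)B(w):, where the contraction function C is the
exponential of a scalar series and the powers q^a, z^b come from the zero modes
(`expSeries_exchange`, `ann_mul_cre`, `field_mul_field`). On a fixed vector each coefficient of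
:A(z)B(w): involves finitely many terms, even after multiplication by an arbitrary bilateral series
in w/z (`lineTerm_finite`). The operators `bilocal` are such products, and commutators are computed
inside the space of bilateral series.

All contraction functions that occur are rational with simple poles. When both orders give
expansions of one rational function in opposite directions, the (anti)commutator is a sum of delta
functions at the poles, weighted by residues. A delta function sets z = q^u w, and the normal
ordered product becomes one vertex operator at w (`bilocal_qp`). The relations therefore amount to a
table of contractions and a few fusion identities.

The building blocks are the vertex operators of G^±, called `vtxG`. Two of equal charge have the
antisymmetric factor q^a z - q^b w, up to a constant, hence anticommute. For opposite charges the
poles are at q^(4k+4), q^(2k+4) and q^(2k+2), and the operators fuse there to K^-K^+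
(`vtxG_one_one_mul`), to 1 (`vtxG_neg_neg_mul`) and to the vertex operators of T (`vtxT_eq`). This
is the G^+G^- relation, and it also expresses every contraction with T through those of G^±. The
relations with K^± are exchange relations: one order has trivial contraction and the other has the
inverse of the stated rational function.

In [G,T] and [T,T] there are unwanted poles, where the fused operators are symmetric in their
labels; the coefficients -[k+2]/[k+1] and q^(±1) in T make these contributions cancel. At the
remaining poles a pair of G^+, G^- again fuses to K^-K^+ and leaves K^-GK^+, respectively K^-
:G^+_a(w)G^-_b(w): K^+.

It remains to identify W with a combination of the :G^+_a(z)G^-_b(z):. Ordering G^+G^- by modes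
instead of by powers of w/z changes each geometric coefficient sequence to a sum satisfying f(l+1) =
q^u f(l) + 1. Its solution is a constant plus a multiple of q^(ul). The constants give the
contraction functions at z = w, which are the coefficients of W; the geometric parts give multiples
of K, 1 and T with the parity dependent factors c^A_m, and the explicit terms in the definition of W
cancel them (`stepSum_qpSeq`, `wakimoto_W_of_int`). -/

namespace SVir

noncomputable section

/-! ### Exponentials of power series over a noncommutative algebra. -/

section ExpSeries

variable {R : Type*} [Ring R]

open PowerSeries in
theorem coeff_pow_eq_zero_of_lt {S : PowerSeries R} (h0 : coeff 0 S = 0) {n j : ℕ} (h : n < j) :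
    coeff n (S ^ j) = 0 := by
  induction j generalizing n with
  | zero => omega
  | succ j ih =>
    rw [pow_succ, coeff_mul]
    refine Finset.sum_eq_zero fun p hp => ?_
    rw [Finset.HasAntidiagonal.mem_antidiagonal] at hp
    rcases Nat.eq_zero_or_pos p.2 with h2 | h2
    · rw [h2, h0, mul_zero]
    · rw [ih (by omega), zero_mul]

open PowerSeries in
theorem commute_of_coeff {S T : PowerSeries R}
    (h : ∀ i j, Commute (coeff i S) (coeff j T)) : Commute S T := by
  change S * T = T * S
  ext n
  rw [coeff_mul, coeff_mul, ← Finset.Nat.sum_antidiagonal_swap]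
  exact Finset.sum_congr rfl fun p _ => (h _ _).eq

variable [Algebra ℂ R]

-- Powers S^j with j > n do not reach degree n, so the cut-off in `expSeries` may be raised freely.
-- One finite sum then represents the exponential in all degrees up to N.
open PowerSeries in
theorem coeff_expSeries_of_le {S : PowerSeries R} (h0 : coeff 0 S = 0) {n N : ℕ} (h : n ≤ N) :
    coeff n (expSeries S) =
      coeff n (∑ j ∈ Finset.range (N + 1), ((Nat.factorial j : ℂ)⁻¹) • S ^ j) := by
  rw [expSeries, coeff_mk, map_sum]
  simp only [coeff_smul]
  refine Finset.sum_subset (Finset.range_mono (by omega)) fun j _ hj => ?_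
  rw [coeff_pow_eq_zero_of_lt h0 (by simpa using hj), smul_zero]

open PowerSeries in
theorem coeff_zero_expSeries (S : PowerSeries R) : coeff 0 (expSeries S) = 1 := by
  simp [expSeries]

open PowerSeries in
/-- A derivation of the ring of power series that does not lower the order maps `exp S` to
`(dS) exp S`, if `S` commutes with `dS`. -/
theorem derivation_expSeries (d : PowerSeries R →ₗ[ℂ] PowerSeries R)
    (hd : ∀ S T, d (S * T) = d S * T + S * d T)
    (hord : ∀ N S, (∀ i ≤ N, coeff i S = 0) → ∀ i ≤ N, coeff i (d S) = 0)
    {S : PowerSeries R} (h0 : coeff 0 S = 0) (hc : Commute S (d S)) :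
    d (expSeries S) = d S * expSeries S := by
  have h1 : d 1 = 0 := by simpa using hd 1 1
  have hpow : ∀ j : ℕ, d (S ^ (j + 1)) = ((j + 1 : ℕ) : ℂ) • (d S * S ^ j) := by
    intro j
    induction j with
    | zero => simp
    | succ j ih =>
      rw [pow_succ, hd, ih, (hc.symm.pow_right (j + 1)).symm.eq, smul_mul_assoc, mul_assoc,
        ← pow_succ]
      push_cast
      module
  ext n
  -- Differentiating the exponential sum loses one term. The truncation with one extra term (`m =
  -- 1`) is used under `d`, where `hord` permits the replacement, and the one with `m = 0` on the
  -- right-hand side.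
  have e1 : ∀ m, (∀ i ≤ n, coeff i (expSeries S -
      ∑ j ∈ Finset.range (n + m + 1), ((Nat.factorial j : ℂ)⁻¹) • S ^ j) = 0) := by
    intro m i hi
    rw [map_sub, coeff_expSeries_of_le h0 (show i ≤ n + m by omega), sub_self]
  have e2 := hord n _ (e1 1) n le_rfl
  rw [map_sub, map_sub, sub_eq_zero] at e2
  rw [e2, Finset.sum_range_succ', map_add]
  simp only [pow_zero, map_smul, h1, smul_zero, add_zero, map_sum, hpow]
  have e3 : coeff n (d S * expSeries S) = coeff n (d S *
      ∑ j ∈ Finset.range (n + 0 + 1), ((Nat.factorial j : ℂ)⁻¹) • S ^ j) := by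
    rw [← sub_eq_zero, ← map_sub, ← mul_sub, coeff_mul]
    refine Finset.sum_eq_zero fun p hp => ?_
    rw [Finset.HasAntidiagonal.mem_antidiagonal] at hp
    rw [e1 0 p.2 (by omega), mul_zero]
  rw [e3, add_zero, Finset.mul_sum, map_sum]
  refine Finset.sum_congr rfl fun j _ => ?_
  rw [mul_smul_comm, coeff_smul, coeff_smul, smul_smul]
  congr 1
  rw [Nat.factorial_succ]
  push_cast
  have : ((j : ℂ) + 1) ≠ 0 := by exact_mod_cast Nat.succ_ne_zero j
  have := Nat.factorial_ne_zero j
  field_simp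

/-- The derivation `x d/dx`. -/
def euler : PowerSeries R →ₗ[ℂ] PowerSeries R where
  toFun S := PowerSeries.mk fun n => (n : ℂ) • PowerSeries.coeff n S
  map_add' S T := by ext n; simp
  map_smul' c S := by ext n; simp [smul_comm c]

open PowerSeries in
theorem coeff_euler (S : PowerSeries R) (n : ℕ) : coeff n (euler S) = (n : ℂ) • coeff n S := by
  simp [euler]

open PowerSeries in
theorem euler_mul (S T : PowerSeries R) : euler (S * T) = euler S * T + S * euler T := by
  ext n
  rw [coeff_euler, map_add, coeff_mul, coeff_mul, coeff_mul, Finset.smul_sum,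
    ← Finset.sum_add_distrib]
  refine Finset.sum_congr rfl fun p hp => ?_
  rw [Finset.HasAntidiagonal.mem_antidiagonal] at hp
  rw [coeff_euler, coeff_euler, smul_mul_assoc, mul_smul_comm, ← add_smul, ← hp]
  push_cast
  rfl

open PowerSeries in
theorem euler_expSeries {S : PowerSeries R} (h0 : coeff 0 S = 0)
    (hc : ∀ i j, Commute (coeff i S) (coeff j S)) :
    euler (expSeries S) = euler S * expSeries S := by
  refine derivation_expSeries euler euler_mul (fun N T hT i hi => ?_) h0 (commute_of_coeff ?_)
  · rw [coeff_euler, hT i hi, smul_zero]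
  · intro i j
    rw [coeff_euler]
    exact (hc i j).smul_right _

-- Since P has no constant term, the equation x E' = P E expresses n E_n through lower coefficients.
-- Additivity of exp, rescaling and the logarithm formula all follow from this uniqueness.
open PowerSeries in
theorem eq_of_euler_eq {E E' P : PowerSeries R} (h0 : coeff 0 E = coeff 0 E')
    (hP : coeff 0 P = 0) (hE : euler E = P * E) (hE' : euler E' = P * E') : E = E' := by
  ext n
  induction n using Nat.strong_induction_on with
  | _ n ih =>
    rcases Nat.eq_zero_or_pos n with rfl | hn
    · exact h0
    have h1 : (n : ℂ) • coeff n E = (n : ℂ) • coeff n E' := by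
      rw [← coeff_euler, ← coeff_euler, hE, hE', coeff_mul, coeff_mul]
      refine Finset.sum_congr rfl fun p hp => ?_
      rw [Finset.HasAntidiagonal.mem_antidiagonal] at hp
      rcases Nat.eq_zero_or_pos p.1 with h | h
      · rw [h, hP, zero_mul, zero_mul]
      · rw [ih p.2 (by omega)]
    have hn' : (n : ℂ) ≠ 0 := by exact_mod_cast hn.ne'
    simpa [smul_smul, inv_mul_cancel₀ hn'] using congrArg (fun x => (n : ℂ)⁻¹ • x) h1

-- The coefficients of exp S are the same polynomials in the coefficients of S as those of exp T in
-- the coefficients of T, so an intertwining relation passes from exponents to exponentials. In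
-- `expSeries_exchange` the element `a` is itself an exponential series.
open PowerSeries in
theorem semiconj_coeff_expSeries {a : R} {S T : PowerSeries R}
    (h : ∀ i, SemiconjBy a (coeff i S) (coeff i T)) (n : ℕ) :
    SemiconjBy a (coeff n (expSeries S)) (coeff n (expSeries T)) := by
  have hp : ∀ j m, SemiconjBy a (coeff m (S ^ j)) (coeff m (T ^ j)) := by
    intro j
    induction j with
    | zero =>
      intro m
      simp only [pow_zero, coeff_one]
      split_ifs
      · exact SemiconjBy.one_right a
      · exact SemiconjBy.zero_right a
    | succ j ih =>
      intro m
      simp only [pow_succ, coeff_mul, SemiconjBy, Finset.mul_sum, Finset.sum_mul]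
      exact Finset.sum_congr rfl fun p _ => ((ih p.1).mul_right (h p.2)).eq
  simp only [expSeries, coeff_mk, SemiconjBy, Finset.mul_sum, Finset.sum_mul]
  refine Finset.sum_congr rfl fun j _ => ?_
  rw [mul_smul_comm, (hp j n).eq, smul_mul_assoc]

open PowerSeries in
theorem commute_coeff_expSeries {a : R} {S : PowerSeries R}
    (h : ∀ i, Commute a (coeff i S)) (n : ℕ) : Commute a (coeff n (expSeries S)) :=
  semiconj_coeff_expSeries h n

open PowerSeries in
theorem expSeries_add {S T : PowerSeries R} (hS : coeff 0 S = 0) (hT : coeff 0 T = 0)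
    (hSS : ∀ i j, Commute (coeff i S) (coeff j S)) (hTT : ∀ i j, Commute (coeff i T) (coeff j T))
    (hST : ∀ i j, Commute (coeff i S) (coeff j T)) :
    expSeries (S + T) = expSeries S * expSeries T := by
  have hc : Commute (expSeries S) (euler T) := by
    refine commute_of_coeff fun i j => ?_
    rw [coeff_euler]
    exact ((commute_coeff_expSeries (fun l => (hST l j).symm) i).symm).smul_right _
  refine eq_of_euler_eq (P := euler (S + T)) ?_ ?_ (euler_expSeries ?_ ?_) ?_
  · rw [coeff_zero_expSeries, coeff_mul]
    simp [coeff_zero_expSeries]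
  · rw [coeff_euler, Nat.cast_zero, zero_smul]
  · rw [map_add, hS, hT, add_zero]
  · intro i j
    rw [map_add, map_add]
    exact ((hSS i j).add_left (hST j i).symm).add_right ((hST i j).add_left (hTT i j))
  · rw [euler_mul, euler_expSeries hS hSS, euler_expSeries hT hTT, map_add, add_mul, mul_assoc,
      ← mul_assoc (expSeries S), hc.eq, mul_assoc]

open PowerSeries in
theorem coeff_expSeries_rescale (a : ℂ) {S T : PowerSeries R} (h0 : coeff 0 S = 0)
    (hT : ∀ n, coeff n T = a ^ n • coeff n S)
    (hSS : ∀ i j, Commute (coeff i S) (coeff j S)) (n : ℕ) :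
    coeff n (expSeries T) = a ^ n • coeff n (expSeries S) := by
  have hT0 : coeff 0 T = 0 := by rw [hT, h0, smul_zero]
  have hTT : ∀ i j, Commute (coeff i T) (coeff j T) := fun i j => by
    rw [hT, hT]
    exact ((hSS i j).smul_left _).smul_right _
  have : expSeries T = mk fun n => a ^ n • coeff n (expSeries S) := by
    refine eq_of_euler_eq (P := euler T) ?_ ?_ (euler_expSeries hT0 hTT) ?_
    · simp [coeff_zero_expSeries]
    · simp [coeff_euler]
    · ext n
      rw [coeff_euler, coeff_mk, smul_comm, ← coeff_euler, euler_expSeries h0 hSS, coeff_mul,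
        coeff_mul, Finset.smul_sum]
      refine Finset.sum_congr rfl fun p hp => ?_
      rw [Finset.HasAntidiagonal.mem_antidiagonal] at hp
      rw [coeff_euler, coeff_euler, coeff_mk, hT, ← hp, pow_add, smul_mul_assoc, smul_mul_assoc,
        smul_mul_assoc, mul_smul_comm, smul_smul, smul_smul, smul_smul]
      congr 1
      ring
  rw [this, coeff_mk]

-- The commutator with the constant series `C a` is a derivation that preserves order and sends T to
-- the central monomial c x^i, so `derivation_expSeries` applies to it.
open PowerSeries in
theorem C_mul_expSeries {T : PowerSeries R} (hT : coeff 0 T = 0) {a c : R} {i : ℕ}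
    (hc : ∀ x, Commute c x)
    (h : ∀ j, a * coeff j T = coeff j T * a + if i = j then c else 0) :
    C a * expSeries T = expSeries T * (C a + monomial i c) := by
  have hcen : ∀ U : PowerSeries R, Commute (monomial i c) U := by
    intro U
    refine commute_of_coeff fun a b => ?_
    rw [coeff_monomial]
    split_ifs
    · exact hc _
    · exact Commute.zero_left _
  let d : PowerSeries R →ₗ[ℂ] PowerSeries R :=
    LinearMap.mulLeft ℂ (C a) - LinearMap.mulRight ℂ (C a)
  have hdT : d T = monomial i c := by
    ext m
    simp only [d, LinearMap.sub_apply, LinearMap.mulLeft_apply, LinearMap.mulRight_apply, map_sub,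
      coeff_C_mul, coeff_mul_C, h, coeff_monomial, add_sub_cancel_left]
    by_cases h : i = m
    · simp [h]
    · simp [h, Ne.symm h]
  have key := derivation_expSeries d (fun U V => by
      simp only [d, LinearMap.sub_apply, LinearMap.mulLeft_apply, LinearMap.mulRight_apply]
      noncomm_ring) (fun N U hU m hm => by
      simp only [d, LinearMap.sub_apply, LinearMap.mulLeft_apply, LinearMap.mulRight_apply,
        map_sub, coeff_C_mul, coeff_mul_C, hU m hm, mul_zero, zero_mul, sub_zero]) hT
      (by rw [hdT]; exact (hcen T).symm)
  rw [hdT, (hcen _).eq] at key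
  simp only [d, LinearMap.sub_apply, LinearMap.mulLeft_apply, LinearMap.mulRight_apply] at key
  rw [mul_add, ← key]
  abel

open PowerSeries in
/-- Exponentials of power series whose coefficients satisfy Heisenberg commutation relations. -/
theorem expSeries_exchange {S T : PowerSeries R} {κ : PowerSeries ℂ}
    (hS : coeff 0 S = 0) (hT : coeff 0 T = 0) (hκ : coeff 0 κ = 0)
    (hSS : ∀ i j, Commute (coeff i S) (coeff j S))
    (hST : ∀ i j, coeff i S * coeff j T =
      coeff j T * coeff i S + if i = j then algebraMap ℂ R (coeff i κ) else 0) (n j : ℕ) :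
    coeff n (expSeries S) * coeff j (expSeries T) =
      ∑ p ∈ Finset.HasAntidiagonal.antidiagonal n, if p.1 ≤ j then
        coeff p.1 (expSeries κ) • (coeff (j - p.1) (expSeries T) * coeff p.2 (expSeries S))
      else 0 := by
  let ι : ℕ → PowerSeries R := fun i => monomial i (algebraMap ℂ R (coeff i κ))
  have hcen : ∀ i (U : PowerSeries R), Commute (ι i) U := by
    intro i U
    refine commute_of_coeff fun a b => ?_
    simp only [ι, coeff_monomial]
    split_ifs
    · exact Algebra.commutes _ _
    · exact Commute.zero_left _
  -- Conjugation by exp T shifts each coefficient of S by a central monomial.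
  have h1 : ∀ i, SemiconjBy (expSeries T) (C (coeff i S) + ι i) (C (coeff i S)) := fun i =>
    (C_mul_expSeries hT (fun x => Algebra.commutes _ x) fun j => by
      rw [hST]).symm
  -- A second variable is adjoined for S. Exponentiating the shift over `PowerSeries R` gives exp(T)
  -- exp(S' + K') = exp(S') exp(T), and K' is κ evaluated at the product of the two variables.
  let S' : PowerSeries (PowerSeries R) := mk fun i => C (coeff i S)
  let K' : PowerSeries (PowerSeries R) := mk fun i => ι i
  have h2 := semiconj_coeff_expSeries (a := expSeries T) (S := S' + K') (T := S')
    (fun i => by simpa [S', K'] using h1 i) n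
  have hS' : ∀ m, coeff m (expSeries S') = C (coeff m (expSeries S)) := by
    have hpow : ∀ j m, coeff m (S' ^ j) = C (coeff m (S ^ j)) := by
      intro j
      induction j with
      | zero => intro m; simp only [pow_zero, coeff_one]; split_ifs <;> simp
      | succ j ih =>
        intro m
        simp only [pow_succ, coeff_mul, map_sum, map_mul, ih]
        simp [S']
    intro m
    ext a
    simp only [expSeries, coeff_mk, hpow, map_sum, coeff_smul, coeff_C]
    by_cases ha : a = 0 <;> simp [ha]
  have hK' : ∀ m, coeff m (expSeries K') =
      monomial m (algebraMap ℂ R (coeff m (expSeries κ))) := by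
    have hpow : ∀ j m, coeff m (K' ^ j) = monomial m (algebraMap ℂ R (coeff m (κ ^ j))) := by
      intro j
      induction j with
      | zero =>
        intro m
        simp only [pow_zero, coeff_one]
        split_ifs with h
        · subst h; simp
        · simp
      | succ j ih =>
        intro m
        rw [pow_succ, pow_succ, coeff_mul, coeff_mul, map_sum, map_sum]
        refine Finset.sum_congr rfl fun p hp => ?_
        rw [Finset.HasAntidiagonal.mem_antidiagonal] at hp
        rw [ih, map_mul]
        simp only [K', coeff_mk, ι]
        rw [monomial_mul_monomial, hp]
    intro m
    ext a
    simp only [expSeries, coeff_mk, hpow, map_sum, coeff_smul, coeff_monomial]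
    by_cases ha : a = m
    · simp [ha, Algebra.smul_def]
    · simp [ha]
  rw [expSeries_add, SemiconjBy, hS', coeff_mul] at h2
  · have h3 := congrArg (coeff j) h2
    rw [coeff_C_mul] at h3
    rw [← h3, Finset.mul_sum, map_sum, ← Finset.Nat.sum_antidiagonal_swap]
    refine Finset.sum_congr rfl fun p _ => ?_
    simp only [Prod.fst_swap, Prod.snd_swap]
    rw [hS', hK', ← mul_assoc, monomial_eq_C_mul_X_pow, ← mul_assoc, coeff_mul_X_pow']
    split_ifs
    rw [coeff_mul_C, coeff_mul_C]
    · rw [← Algebra.commutes, ← Algebra.smul_def]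
    · rfl
  · simp [S', hS]
  · simp [K', ι, hκ]
  · intro a b
    simpa [S'] using commute_of_coeff fun c d => by
      simp only [coeff_C]
      split_ifs
      · exact hSS a b
      · exact Commute.zero_right _
      · exact Commute.zero_left _
      · exact Commute.zero_left _
  · intro a b
    simpa [K'] using hcen a (ι b)
  · intro a b
    simpa [K'] using (hcen b _).symm

end ExpSeries

/-! ### Reindexing of finite-support sums. -/

section Finsum

theorem finsum_mem_eq_finsum {α M : Type*} [AddCommMonoid M] (f : α → M) (s : Set α)
    (hs : ∀ a, f a ≠ 0 → a ∈ s) : ∑ᶠ a ∈ s, f a = ∑ᶠ a, f a := by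
  rw [← finsum_mem_univ f]
  refine finsum_mem_inter_support_eq f _ _ ?_
  ext a
  simpa using hs a

theorem finsum_eq_of_bijOn {α β M : Type*} [AddCommMonoid M] {f : α → M} {g : β → M} (e : α → β)
    {s : Set α} {t : Set β} (he : Set.BijOn e s t) (hf : ∀ a, f a ≠ 0 → a ∈ s)
    (hg : ∀ b, g b ≠ 0 → b ∈ t) (h : ∀ a ∈ s, f a = g (e a)) : ∑ᶠ a, f a = ∑ᶠ b, g b := by
  rw [← finsum_mem_eq_finsum f s hf, ← finsum_mem_eq_finsum g t hg]
  exact finsum_mem_eq_of_bijOn e he h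

theorem finsum_int_eq_sum_antidiagonal {M : Type*} [AddCommMonoid M] (F : ℤ → ℤ → M)
    (hF : ∀ a b, a < 0 ∨ b < 0 → F a b = 0) (N : ℕ) :
    ∑ᶠ r : ℤ, F r (N - r) = ∑ p ∈ Finset.HasAntidiagonal.antidiagonal N, F p.1 p.2 := by
  rw [finsum_eq_sum_of_support_subset (s := (Finset.range (N + 1)).map Nat.castEmbedding),
    Finset.sum_map, Finset.Nat.sum_antidiagonal_eq_sum_range_succ_mk]
  · refine Finset.sum_congr rfl fun i hi => ?_
    rw [Finset.mem_range] at hi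
    simp only [Nat.castEmbedding_apply]
    rw [Nat.cast_sub (by omega)]
  · intro r hr
    rw [Function.mem_support] at hr
    have h1 : ¬ (r < 0 ∨ (N : ℤ) - r < 0) := fun h => hr (hF _ _ h)
    simp only [Finset.coe_map, Set.mem_image, Finset.coe_range, Set.mem_Iio,
      Nat.castEmbedding_apply]
    exact ⟨r.toNat, by omega, by omega⟩

theorem lfSum_apply {ι M : Type*} [AddCommGroup M] [Module ℂ M] {f : ι → Module.End ℂ M}
    (hf : PointwiseFinite f) (v : M) : lfSum f v = ∑ᶠ i, f i v := by
  rw [lfSum, dif_pos hf]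
  rfl

end Finsum

/-! ### Power series coefficients indexed by all integers. -/

section CoeffZ

variable {R : Type*} [Semiring R]

/-- The coefficients of a power series, extended by zero to negative indices. -/
def coeffZ (f : PowerSeries R) (i : ℤ) : R := if 0 ≤ i then PowerSeries.coeff i.toNat f else 0

theorem coeffZ_natCast (f : PowerSeries R) (n : ℕ) : coeffZ f n = PowerSeries.coeff n f := by
  simp [coeffZ]

theorem coeffZ_of_neg (f : PowerSeries R) {i : ℤ} (h : i < 0) : coeffZ f i = 0 :=
  if_neg (by omega)

theorem coeffZ_mul (f g : PowerSeries R) (n : ℤ) :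
    coeffZ (f * g) n = ∑ᶠ r : ℤ, coeffZ f r * coeffZ g (n - r) := by
  rcases lt_or_ge n 0 with h | h
  · rw [coeffZ_of_neg _ h, finsum_eq_zero_of_forall_eq_zero]
    intro r
    rcases lt_or_ge r 0 with hr | hr
    · rw [coeffZ_of_neg _ hr, zero_mul]
    · rw [coeffZ_of_neg g (by omega), mul_zero]
  · lift n to ℕ using h
    rw [finsum_int_eq_sum_antidiagonal (fun a b => coeffZ f a * coeffZ g b), coeffZ_natCast,
      PowerSeries.coeff_mul]
    · simp only [coeffZ_natCast]
    · rintro a b (h | h)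
      · rw [coeffZ_of_neg _ h, zero_mul]
      · rw [coeffZ_of_neg _ h, mul_zero]

end CoeffZ

/-! ### Heisenberg relations on the polynomial Fock space. -/

section Heisenberg

variable (h k : ℂ)

theorem osc_zero (b : Fin 3) : osc h k b 0 = 0 := rfl

theorem osc_natCast_succ (b : Fin 3) (n : ℕ) : osc h k b ((n + 1 : ℕ) : ℤ) =
    bracket h k b (n + 1) • (MvPolynomial.pderiv (R := ℂ) (b, n.succPNat)).toLinearMap := rfl

theorem osc_neg_natCast_succ (b : Fin 3) (n : ℕ) : osc h k b (-((n + 1 : ℕ) : ℤ)) =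
    LinearMap.mulLeft ℂ (MvPolynomial.X (b, n.succPNat)) := rfl

/-- The commutator of two derivations is a derivation, and this one vanishes on the variables. -/
theorem pderiv_comm {σ : Type*} (i j : σ) (p : MvPolynomial σ ℂ) :
    MvPolynomial.pderiv i (MvPolynomial.pderiv j p) =
      MvPolynomial.pderiv j (MvPolynomial.pderiv i p) := by
  classical
  have h0 : ⁅MvPolynomial.pderiv (R := ℂ) i, MvPolynomial.pderiv (R := ℂ) j⁆ = 0 := by
    refine MvPolynomial.derivation_ext fun l => ?_
    rw [Derivation.commutator_apply, MvPolynomial.pderiv_X, MvPolynomial.pderiv_X]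
    simp only [Pi.single_apply]
    split_ifs <;> simp
  have h1 := congrArg (fun D => D p) h0
  simpa [Derivation.commutator_apply, sub_eq_zero] using h1

theorem osc_commute_pos (b b' : Fin 3) (i j : ℕ) :
    Commute (osc h k b (i : ℤ)) (osc h k b' (j : ℤ)) := by
  rcases i with _ | i
  · exact Commute.zero_left _
  rcases j with _ | j
  · exact Commute.zero_right _
  rw [osc_natCast_succ, osc_natCast_succ]
  refine (Commute.smul_left ?_ _).smul_right _
  exact LinearMap.ext fun p => pderiv_comm _ _ p

theorem osc_commute_neg (b b' : Fin 3) (i j : ℕ) :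
    Commute (osc h k b (-(i : ℤ))) (osc h k b' (-(j : ℤ))) := by
  rcases i with _ | i
  · exact Commute.zero_left _
  rcases j with _ | j
  · exact Commute.zero_right _
  rw [osc_neg_natCast_succ, osc_neg_natCast_succ]
  exact LinearMap.ext fun p => mul_left_comm _ _ _

theorem bracket_zero (b : Fin 3) : bracket h k b 0 = 0 := by
  fin_cases b <;> simp [bracket]

/-- This is the Leibniz rule: the extra term is the derivative of the variable by which one
multiplies. For `i = 0` the bracket vanishes, so no case distinction is needed in the statement. -/
theorem osc_pos_mul_neg (b b' : Fin 3) (i j : ℕ) :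
    osc h k b (i : ℤ) * osc h k b' (-(j : ℤ)) = osc h k b' (-(j : ℤ)) * osc h k b (i : ℤ) +
      if i = j ∧ b = b' then algebraMap ℂ _ (bracket h k b i) else 0 := by
  rcases i with _ | i
  · simp [osc_zero, bracket_zero]
  rcases j with _ | j
  · simp [osc_zero]
  rw [osc_natCast_succ, osc_neg_natCast_succ]
  refine LinearMap.ext fun p => ?_
  by_cases hb : i + 1 = j + 1 ∧ b = b'
  · obtain ⟨h1, rfl⟩ := hb
    obtain rfl : i = j := by omega
    simp [Algebra.algebraMap_eq_smul_one, smul_add]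
  · have hne : (b', j.succPNat) ≠ (b, i.succPNat) := by
      intro h1
      rw [Prod.mk.injEq, Nat.succPNat_inj] at h1
      exact hb ⟨by omega, h1.1.symm⟩
    rw [if_neg hb, add_zero]
    simp [MvPolynomial.pderiv_X_of_ne hne]

end Heisenberg

/-! ### Creation and annihilation parts of vertex operators, and their contraction. -/

namespace Vertex

variable (h k : ℂ) (A B : Vertex)

/-- The exponent of the creation part. -/
def creSer : PowerSeries (Module.End ℂ Osc) :=
  PowerSeries.mk fun m => ∑ b, A.coef b (-(m : ℤ)) • osc h k b (-(m : ℤ))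

/-- The exponent of the annihilation part. -/
def annSer : PowerSeries (Module.End ℂ Osc) :=
  PowerSeries.mk fun m => ∑ b, A.coef b (m : ℤ) • osc h k b (m : ℤ)

/-- The exponent of the contraction function of `A(z) B(w)`, a power series in `w / z`. -/
def pairing : PowerSeries ℂ :=
  PowerSeries.mk fun m => ∑ b, A.coef b (m : ℤ) * B.coef b (-(m : ℤ)) * bracket h k b m

/-- The contraction function of `A(z) B(w)`, a power series in `w / z`. -/
def contraction : PowerSeries ℂ := expSeries (pairing h k A B)

open PowerSeries

theorem coeff_zero_creSer : coeff 0 (creSer h k A) = 0 := by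
  simp [creSer, osc_zero]

theorem coeff_zero_annSer : coeff 0 (annSer h k A) = 0 := by
  simp [annSer, osc_zero]

theorem coeff_zero_pairing : coeff 0 (pairing h k A B) = 0 := by
  simp [pairing, bracket_zero]

theorem creSer_commute (i j : ℕ) :
    Commute (coeff i (creSer h k A)) (coeff j (creSer h k B)) := by
  simp only [creSer, coeff_mk]
  exact Commute.sum_left _ _ _ fun b _ => Commute.sum_right _ _ _ fun b' _ =>
    ((osc_commute_neg h k b b' i j).smul_left _).smul_right _

theorem annSer_commute (i j : ℕ) :
    Commute (coeff i (annSer h k A)) (coeff j (annSer h k B)) := by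
  simp only [annSer, coeff_mk]
  exact Commute.sum_left _ _ _ fun b _ => Commute.sum_right _ _ _ fun b' _ =>
    ((osc_commute_pos h k b b' i j).smul_left _).smul_right _

/-- Only opposite labels of the same boson fail to commute, so the double sum over bosons collapses
to its diagonal. This is the hypothesis of `expSeries_exchange` with κ = `pairing`. -/
theorem annSer_mul_creSer (i j : ℕ) :
    coeff i (annSer h k A) * coeff j (creSer h k B) =
      coeff j (creSer h k B) * coeff i (annSer h k A) +
        if i = j then algebraMap ℂ _ (coeff i (pairing h k A B)) else 0 := by
  simp only [annSer, creSer, pairing, coeff_mk, Finset.sum_mul_sum, smul_mul_smul_comm,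
    osc_pos_mul_neg, smul_add, Finset.sum_add_distrib]
  refine congrArg₂ (· + ·) ?_ ?_
  · rw [Finset.sum_comm]
    exact Finset.sum_congr rfl fun b _ => Finset.sum_congr rfl fun b' _ => by rw [mul_comm]
  · by_cases hij : i = j
    · subst hij
      simp only [true_and, smul_ite, smul_zero, Finset.sum_ite_eq, Finset.mem_univ, if_true,
        map_sum]
      refine Finset.sum_congr rfl fun b _ => ?_
      rw [map_mul _ (A.coef b _ * B.coef b _), ← Algebra.smul_def]
    · simp only [hij, false_and, if_false, smul_zero, Finset.sum_const_zero]

/-- The coefficient of `z ^ i` in the creation part. -/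
def cre (i : ℤ) : Module.End ℂ Osc := coeffZ (A.creation h k) i

/-- The coefficient of `z ^ (-i)` in the annihilation part. -/
def ann (i : ℤ) : Module.End ℂ Osc := coeffZ (A.annihilation h k) i

theorem commute_expSeries_coeff {S T : PowerSeries (Module.End ℂ Osc)}
    (hc : ∀ i j, Commute (coeff i S) (coeff j T)) (i j : ℤ) :
    Commute (coeffZ (expSeries S) i) (coeffZ (expSeries T) j) := by
  unfold coeffZ
  split_ifs
  · exact commute_coeff_expSeries (fun l =>
      (commute_coeff_expSeries (fun m => (hc m l).symm) _).symm) _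
  · exact Commute.zero_right _
  · exact Commute.zero_left _
  · exact Commute.zero_left _

theorem cre_commute (i j : ℤ) : Commute (cre h k A i) (cre h k B j) :=
  commute_expSeries_coeff (creSer_commute h k A B) i j

theorem ann_commute (i j : ℤ) : Commute (ann h k A i) (ann h k B j) :=
  commute_expSeries_coeff (annSer_commute h k A B) i j

/-- This is `expSeries_exchange` on integer indices, where the constraints on the summation range
are absorbed in the vanishing of coefficients with negative index. -/
theorem ann_mul_cre (p j : ℤ) : ann h k A p * cre h k B j =
    ∑ᶠ l : ℤ, coeffZ (contraction h k A B) l • (cre h k B (j - l) * ann h k A (p - l)) := by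
  rcases lt_or_ge p 0 with hp | hp
  · rw [ann, coeffZ_of_neg _ hp, zero_mul, finsum_eq_zero_of_forall_eq_zero]
    intro l
    rcases lt_or_ge l 0 with hl | hl
    · rw [coeffZ_of_neg _ hl, zero_smul]
    · rw [ann, coeffZ_of_neg _ (by omega : p - l < 0), mul_zero, smul_zero]
  rcases lt_or_ge j 0 with hj | hj
  · rw [cre, coeffZ_of_neg _ hj, mul_zero, finsum_eq_zero_of_forall_eq_zero]
    intro l
    rcases lt_or_ge l 0 with hl | hl
    · rw [coeffZ_of_neg _ hl, zero_smul]
    · rw [cre, coeffZ_of_neg _ (by omega : j - l < 0), zero_mul, smul_zero]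
  lift p to ℕ using hp
  lift j to ℕ using hj
  rw [finsum_int_eq_sum_antidiagonal
    (fun a b => coeffZ (contraction h k A B) a • (cre h k B (j - a) * ann h k A b))]
  · simp only [cre, ann, coeffZ_natCast]
    refine (expSeries_exchange (coeff_zero_annSer h k A) (coeff_zero_creSer h k B)
      (coeff_zero_pairing h k A B) (annSer_commute h k A A) (annSer_mul_creSer h k A B) p j).trans
      (Finset.sum_congr rfl fun q _ => ?_)
    split_ifs with hq
    · rw [← Nat.cast_sub hq, coeffZ_natCast]
      rfl
    · rw [coeffZ_of_neg _ (by omega), zero_mul, smul_zero]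
  · rintro a b (ha | ha)
    · rw [coeffZ_of_neg _ ha, zero_smul]
    · rw [ann, coeffZ_of_neg _ ha, mul_zero, smul_zero]

theorem mul_coef (b : Fin 3) (m : ℤ) : (A * B).coef b m = A.coef b m + B.coef b m := rfl

theorem creation_mul : (A * B).creation h k = A.creation h k * B.creation h k := by
  have : creSer h k (A * B) = creSer h k A + creSer h k B := by
    ext1 n
    simp only [creSer, coeff_mk, map_add, mul_coef, add_smul, Finset.sum_add_distrib]
  change expSeries (creSer h k (A * B)) = _
  rw [this]
  exact expSeries_add (coeff_zero_creSer h k A) (coeff_zero_creSer h k B) (creSer_commute h k A A)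
    (creSer_commute h k B B) (creSer_commute h k A B)

theorem annihilation_mul : (A * B).annihilation h k = A.annihilation h k * B.annihilation h k := by
  have : annSer h k (A * B) = annSer h k A + annSer h k B := by
    ext1 n
    simp only [annSer, coeff_mk, map_add, mul_coef, add_smul, Finset.sum_add_distrib]
  change expSeries (annSer h k (A * B)) = _
  rw [this]
  exact expSeries_add (coeff_zero_annSer h k A) (coeff_zero_annSer h k B) (annSer_commute h k A A)
    (annSer_commute h k B B) (annSer_commute h k A B)

theorem cre_mul (n : ℤ) :
    cre h k (A * B) n = ∑ᶠ r : ℤ, cre h k A r * cre h k B (n - r) := by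
  rw [cre, creation_mul, coeffZ_mul]
  rfl

theorem ann_mul (n : ℤ) :
    ann h k (A * B) n = ∑ᶠ r : ℤ, ann h k A r * ann h k B (n - r) := by
  rw [ann, annihilation_mul, coeffZ_mul]
  rfl

end Vertex

/-! ### Powers of q, dilations and local nilpotency of the annihilation part. -/

theorem qp_add (h u v : ℂ) : qp h (u + v) = qp h u * qp h v := by
  rw [qp, qp, qp, add_mul, Complex.exp_add]

theorem qp_zero (h : ℂ) : qp h 0 = 1 := by simp [qp]

theorem qp_ne_zero (h u : ℂ) : qp h u ≠ 0 := Complex.exp_ne_zero _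

theorem qp_neg (h u : ℂ) : qp h (-u) = (qp h u)⁻¹ := by
  rw [qp, qp, neg_mul, Complex.exp_neg]

theorem qp_mul_natCast (h u : ℂ) (n : ℕ) : qp h (u * n) = qp h u ^ n := by
  rw [qp, qp, ← Complex.exp_nat_mul]
  ring_nf

namespace Vertex

variable (h k : ℂ) (A B : Vertex)

open PowerSeries

theorem cre_dilate (u : ℂ) (n : ℤ) :
    cre h k (A.dilate h u) n = qp h (u * n) • cre h k A n := by
  rcases lt_or_ge n 0 with hn | hn
  · rw [cre, cre, coeffZ_of_neg _ hn, coeffZ_of_neg _ hn, smul_zero]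
  lift n to ℕ using hn
  rw [cre, cre, coeffZ_natCast, coeffZ_natCast]
  have := coeff_expSeries_rescale (qp h u) (S := creSer h k A) (T := creSer h k (A.dilate h u))
    (coeff_zero_creSer h k A) (fun n => by
      simp only [creSer, coeff_mk, Finset.smul_sum, smul_smul, ← qp_mul_natCast, dilate]
      refine Finset.sum_congr rfl fun b _ => ?_
      congr 3
      push_cast
      ring) (creSer_commute h k A A) n
  rw [← qp_mul_natCast] at this
  exact_mod_cast this

theorem ann_dilate (u : ℂ) (n : ℤ) :
    ann h k (A.dilate h u) n = qp h (-(u * n)) • ann h k A n := by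
  rcases lt_or_ge n 0 with hn | hn
  · rw [ann, ann, coeffZ_of_neg _ hn, coeffZ_of_neg _ hn, smul_zero]
  lift n to ℕ using hn
  rw [ann, ann, coeffZ_natCast, coeffZ_natCast]
  have := coeff_expSeries_rescale (qp h (-u)) (S := annSer h k A) (T := annSer h k (A.dilate h u))
    (coeff_zero_annSer h k A) (fun n => by
      simp only [annSer, coeff_mk, Finset.smul_sum, smul_smul, ← qp_mul_natCast, dilate]
      refine Finset.sum_congr rfl fun b _ => ?_
      congr 3) (annSer_commute h k A A) n
  rw [← qp_mul_natCast, neg_mul] at this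
  exact_mod_cast this

/-- Induction on the polynomial: the exponential is trivial on constants, and multiplication by a
creation variable changes its coefficients by a single commutator term of lower degree. -/
theorem exists_ann_eq_zero (v : Osc) : ∃ N : ℤ, ∀ n ≥ N, ann h k A n v = 0 := by
  induction v using MvPolynomial.induction_on with
  | C a =>
    refine ⟨1, fun n hn => ?_⟩
    have hann : ∀ i, coeff i (annSer h k A) (MvPolynomial.C a) = 0 := by
      intro i
      rw [annSer, coeff_mk, LinearMap.sum_apply]
      refine Finset.sum_eq_zero fun b _ => ?_
      rcases i with _ | i
      · simp [osc_zero]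
      · rw [osc_natCast_succ]
        simp
    obtain ⟨i, rfl⟩ : ∃ i : ℕ, n = (i + 1 : ℕ) := ⟨n.toNat - 1, by omega⟩
    -- By the Euler equation a coefficient of positive degree is a sum of products containing a
    -- coefficient of the exponent. That factor can be moved to the right, where it kills constants.
    have := congrArg (fun F => coeff (i + 1) F) (euler_expSeries (coeff_zero_annSer h k A)
      (annSer_commute h k A A))
    simp only [coeff_euler, coeff_mul] at this
    have h2 := congrArg (fun F : Module.End ℂ Osc => F (MvPolynomial.C a)) this
    simp only [LinearMap.sum_apply] at h2
    rw [Finset.sum_eq_zero] at h2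
    · rw [ann, coeffZ_natCast]
      have h3 : ((i + 1 : ℕ) : ℂ) ≠ 0 := by exact_mod_cast Nat.succ_ne_zero i
      exact (smul_eq_zero.mp h2).resolve_left h3
    · intro p _
      have hcomm : Commute (coeff p.1 (annSer h k A)) (coeff p.2 (expSeries (annSer h k A))) :=
        commute_coeff_expSeries (fun l => annSer_commute h k A A _ _) _
      rw [smul_mul_assoc, hcomm.eq, LinearMap.smul_apply, Module.End.mul_apply, hann,
        map_zero, smul_zero]
  | add v w hv hw =>
    obtain ⟨N, hN⟩ := hv
    obtain ⟨M, hM⟩ := hw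
    exact ⟨max N M, fun n hn => by
      rw [map_add, hN n (le_trans (le_max_left _ _) hn), hM n (le_trans (le_max_right _ _) hn),
        add_zero]⟩
  | mul_X v i hv =>
    obtain ⟨N, hN⟩ := hv
    obtain ⟨b, j⟩ := i
    obtain ⟨j, rfl⟩ : ∃ m : ℕ, j = m.succPNat := ⟨j.natPred, (PNat.succPNat_natPred j).symm⟩
    refine ⟨max N 0 + (j + 1), fun n hn => ?_⟩
    have hn0 : 0 ≤ n := by omega
    lift n to ℕ using hn0
    -- The constant `c` is minus the commutator of the exponent with b_{-(j+1)}, because here the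
    -- creation operator stands on the left.
    have key := C_mul_expSeries (coeff_zero_annSer h k A) (a := osc h k b (-((j + 1 : ℕ) : ℤ)))
      (c := -algebraMap ℂ _ (A.coef b (j + 1 : ℕ) * bracket h k b (j + 1))) (i := j + 1)
      (fun x => (show Commute _ x from Algebra.commutes _ x).neg_left) (fun l => by
        rw [annSer, coeff_mk, Finset.mul_sum, Finset.sum_mul]
        simp only [smul_mul_assoc, mul_smul_comm, osc_pos_mul_neg, smul_add,
          Finset.sum_add_distrib]
        split_ifs with hl
        · subst hl
          simp [Algebra.algebraMap_eq_smul_one, smul_smul]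
        · simp [Ne.symm hl])
    have k2 := congrArg (fun F : PowerSeries (Module.End ℂ Osc) => coeff n F v) key
    simp only [mul_add, map_add, coeff_C_mul, coeff_mul_C, monomial_eq_C_mul_X_pow, ← mul_assoc,
      coeff_mul_X_pow', LinearMap.add_apply, Module.End.mul_apply] at k2
    rw [if_pos (by omega), Module.End.mul_apply] at k2
    have e1 : coeff n (expSeries (annSer h k A)) v = 0 := by
      have := hN n (by omega)
      rwa [ann, coeffZ_natCast] at this
    have e2 : coeff (n - (j + 1)) (expSeries (annSer h k A)) v = 0 := by
      have := hN ((n - (j + 1) : ℕ) : ℤ) (by omega)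
      rwa [ann, coeffZ_natCast] at this
    have e3 : osc h k b (-((j + 1 : ℕ) : ℤ)) v = v * MvPolynomial.X (b, j.succPNat) := by
      rw [osc_neg_natCast_succ, LinearMap.mulLeft_apply, mul_comm]
    rw [e1, map_zero, e3, LinearMap.neg_apply, Module.algebraMap_end_apply, map_neg, map_smul, e2,
      smul_zero, neg_zero, add_zero] at k2
    rw [ann, coeffZ_natCast]
    exact k2.symm

end Vertex

/-! ### Oscillator parts of normal ordered products of two vertex operators. -/

namespace Vertex

variable (h k : ℂ) (A B : Vertex)

theorem cre_of_neg {i : ℤ} (hi : i < 0) : cre h k A i = 0 := coeffZ_of_neg _ hi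

theorem ann_of_neg {i : ℤ} (hi : i < 0) : ann h k A i = 0 := coeffZ_of_neg _ hi

theorem exists_forall_ann (v : Osc) : ∃ N : ℤ, ∀ n, ann h k A n v ≠ 0 → 0 ≤ n ∧ n < N := by
  obtain ⟨N, hN⟩ := exists_ann_eq_zero h k A v
  refine ⟨N, fun n hn => ⟨?_, ?_⟩⟩
  · by_contra h0
    rw [ann_of_neg h k A (by omega)] at hn
    exact hn rfl
  · by_contra h0
    exact hn (hN n (by omega))

/-- The coefficient of `z ^ i` in the oscillator part of a vertex operator. -/
def oscMode (i : ℤ) : Module.End ℂ Osc := lfSum fun p : ℤ => cre h k A (i + p) * ann h k A p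

theorem pointwiseFinite_oscMode (i : ℤ) :
    PointwiseFinite fun p : ℤ => cre h k A (i + p) * ann h k A p := by
  intro v
  obtain ⟨N, hN⟩ := exists_forall_ann h k A v
  refine (Set.finite_Icc 0 N).subset fun p hp => ?_
  have := hN p fun h0 => hp (by rw [Module.End.mul_apply, h0, map_zero])
  exact ⟨this.1, this.2.le⟩

theorem oscMode_apply (i : ℤ) (v : Osc) :
    oscMode h k A i v = ∑ᶠ p : ℤ, cre h k A (i + p) (ann h k A p v) :=
  lfSum_apply (pointwiseFinite_oscMode h k A i) v

theorem exists_oscMode_eq_zero (v : Osc) : ∃ N : ℤ, ∀ i ≤ N, oscMode h k A i v = 0 := by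
  obtain ⟨N, hN⟩ := exists_forall_ann h k A v
  refine ⟨-N - 1, fun i hi => ?_⟩
  rw [oscMode_apply, finsum_eq_zero_of_forall_eq_zero]
  intro p
  by_cases h0 : ann h k A p v = 0
  · rw [h0, map_zero]
  · have := hN p h0
    rw [cre_of_neg h k A (by omega), LinearMap.zero_apply]

open Classical in
theorem pointwiseFinite_oscCoeff (x : ℂ) : PointwiseFinite fun p : ℕ × ℕ =>
    if (p.1 : ℂ) - p.2 = x then
      PowerSeries.coeff p.1 (A.creation h k) * PowerSeries.coeff p.2 (A.annihilation h k)
    else 0 := by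
  intro v
  obtain ⟨N, hN⟩ := exists_forall_ann h k A v
  have hinj : Set.InjOn (Prod.snd : ℕ × ℕ → ℕ) {p | (p.1 : ℂ) - p.2 = x} := by
    rintro ⟨a, b⟩ (ha : (a : ℂ) - b = x) ⟨c, d⟩ (hc : (c : ℂ) - d = x) (rfl : b = d)
    have : (a : ℂ) = c := by linear_combination ha - hc
    simpa using this
  refine Set.Finite.of_finite_image (f := Prod.snd) ((Set.finite_Icc 0 N.toNat).subset ?_)
    (hinj.mono fun p hp => ?_)
  · rintro _ ⟨p, hp, rfl⟩
    have := hN p.2 fun h0 => hp (by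
      rw [ann, coeffZ_natCast] at h0
      dsimp only
      split_ifs
      · rw [Module.End.mul_apply, h0, map_zero]
      · rfl)
    simp only [Set.mem_Icc]
    omega
  · by_contra h0
    exact hp (by simp [show ¬ ((p.1 : ℂ) - p.2 = x) from h0])

/-- With a prescribed difference of exponents, a pair in ℕ × ℕ is determined by its annihilation
exponent. Sums over integers are easier to shift. -/
theorem oscCoeff_intCast (i : ℤ) : A.oscCoeff h k (i : ℂ) = oscMode h k A i := by
  classical
  refine LinearMap.ext fun v => ?_
  rw [oscMode_apply, oscCoeff, lfSum_apply (pointwiseFinite_oscCoeff h k A i)]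
  have hiff : ∀ p : ℕ × ℕ, (p.1 : ℂ) - p.2 = i ↔ (p.1 : ℤ) - p.2 = i := fun p => by
    exact_mod_cast Iff.rfl
  refine finsum_eq_of_bijOn (fun p : ℕ × ℕ => (p.2 : ℤ)) (s := {p | (p.1 : ℤ) - p.2 = i})
    (t := {p | 0 ≤ p ∧ 0 ≤ i + p}) ⟨?_, ?_, ?_⟩ ?_ ?_ ?_
  · intro p (hp : (p.1 : ℤ) - p.2 = i)
    exact ⟨by positivity, by dsimp only; omega⟩
  · rintro ⟨a, b⟩ (ha : (a : ℤ) - b = i) ⟨c, d⟩ (hc : (c : ℤ) - d = i) (hbd : (b : ℤ) = d)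
    rw [Prod.mk.injEq]
    omega
  · rintro p ⟨h0, h1⟩
    exact ⟨((i + p).toNat, p.toNat), by
      simp only [Set.mem_ofPred_eq]; omega, by dsimp only; omega⟩
  · intro p hp
    by_contra h0
    exact hp (by rw [if_neg (fun h1 => h0 ((hiff p).1 h1)), LinearMap.zero_apply])
  · intro p hp
    by_contra h0
    rw [Set.mem_ofPred_eq, not_and_or] at h0
    rcases h0 with h0 | h0
    · exact hp (by rw [ann_of_neg h k A (by omega), LinearMap.zero_apply, map_zero])
    · exact hp (by rw [cre_of_neg h k A (by omega), LinearMap.zero_apply])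
  · intro p (hp : (p.1 : ℤ) - p.2 = i)
    rw [if_pos ((hiff p).2 hp), ← hp, sub_add_cancel, cre, ann, coeffZ_natCast, coeffZ_natCast,
      Module.End.mul_apply]

theorem oscCoeff_of_ne_intCast {x : ℂ} (hx : ∀ i : ℤ, x ≠ i) : A.oscCoeff h k x = 0 := by
  classical
  refine LinearMap.ext fun v => ?_
  rw [oscCoeff, lfSum_apply (pointwiseFinite_oscCoeff h k A x), finsum_eq_zero_of_forall_eq_zero]
  · rfl
  · intro p
    rw [if_neg, LinearMap.zero_apply]
    intro h0
    exact hx (p.1 - p.2) (by rw [← h0]; push_cast; rfl)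

/-- The term labelled by `t` of the coefficient of `z ^ i w ^ j` in the product of a series in
`w / z` and the oscillator part of `:A(z) B(w):`. -/
def lineTerm (i j : ℤ) (t : ℤ × ℤ × ℤ) : Module.End ℂ Osc :=
  cre h k A (i + t.1 + t.2.1) * cre h k B (j - t.1 + t.2.2) * ann h k A t.2.1 * ann h k B t.2.2

/-- On v both annihilation indices are bounded, and nonnegativity of the two creation indices then
bounds l from both sides. For this reason a normal ordered product may be multiplied by any
bilateral series, delta functions included. -/
theorem lineTerm_finite (i j : ℤ) (v : Osc) : {t | lineTerm h k A B i j t v ≠ 0}.Finite := by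
  obtain ⟨N, hN⟩ := exists_forall_ann h k A v
  obtain ⟨M, hM⟩ := exists_forall_ann h k B v
  refine ((Set.finite_Icc (-i - N) (j + M)).prod
    ((Set.finite_Icc 0 N).prod (Set.finite_Icc 0 M))).subset ?_
  rintro ⟨l, p, p'⟩ ht
  simp only [lineTerm, Set.mem_ofPred_eq, Module.End.mul_apply] at ht
  have h1 := hM p' fun h0 => ht (by rw [h0, map_zero, map_zero, map_zero])
  have h2 := hN p fun h0 => ht (by
    rw [← Module.End.mul_apply (ann h k A p), (ann_commute h k A B p p').eq, Module.End.mul_apply,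
      h0, map_zero, map_zero, map_zero])
  have h3 : 0 ≤ i + l + p := by
    by_contra h0
    exact ht (by rw [cre_of_neg h k A (by omega), LinearMap.zero_apply])
  have h4 : 0 ≤ j - l + p' := by
    by_contra h0
    exact ht (by rw [cre_of_neg h k B (by omega), LinearMap.zero_apply, map_zero])
  simp only [Set.mem_prod, Set.mem_Icc]
  omega

/-- The coefficient of `z ^ i w ^ j` in `(∑_l c_l (w / z) ^ l) :A(z) B(w):`, oscillator part. -/
def line (c : ℤ → ℂ) (i j : ℤ) : Module.End ℂ Osc :=
  lfSum fun t : ℤ × ℤ × ℤ => c t.1 • lineTerm h k A B i j t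

theorem line_finite (c : ℤ → ℂ) (i j : ℤ) (v : Osc) :
    {t : ℤ × ℤ × ℤ | c t.1 • lineTerm h k A B i j t v ≠ 0}.Finite :=
  (lineTerm_finite h k A B i j v).subset fun t ht h0 => ht (by simp only [h0, smul_zero])

theorem line_apply (c : ℤ → ℂ) (i j : ℤ) (v : Osc) :
    line h k A B c i j v = ∑ᶠ t : ℤ × ℤ × ℤ, c t.1 • lineTerm h k A B i j t v :=
  lfSum_apply (fun v => line_finite h k A B c i j v) v

theorem line_add (c d : ℤ → ℂ) (i j : ℤ) :
    line h k A B (c + d) i j = line h k A B c i j + line h k A B d i j := by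
  refine LinearMap.ext fun v => ?_
  simp only [LinearMap.add_apply, line_apply, Pi.add_apply, add_smul]
  exact finsum_add_distrib (line_finite h k A B c i j v) (line_finite h k A B d i j v)

theorem line_smul (a : ℂ) (c : ℤ → ℂ) (i j : ℤ) :
    line h k A B (a • c) i j = a • line h k A B c i j := by
  refine LinearMap.ext fun v => ?_
  simp only [LinearMap.smul_apply, line_apply, Pi.smul_apply, smul_finsum, smul_assoc]

/-- The normal ordered product is symmetric in its factors, and interchanging z and w inverts w/z.
-/
theorem line_swap (c : ℤ → ℂ) (i j : ℤ) :
    line h k A B c i j = line h k B A (fun l => c (-l)) j i := by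
  refine LinearMap.ext fun v => ?_
  rw [line_apply, line_apply]
  let e : ℤ × ℤ × ℤ ≃ ℤ × ℤ × ℤ :=
    ⟨fun t => (-t.1, t.2.2, t.2.1), fun t => (-t.1, t.2.2, t.2.1), fun t => by simp,
      fun t => by simp⟩
  rw [← finsum_comp_equiv e]
  refine finsum_congr fun t => ?_
  simp only [e, Equiv.coe_fn_mk, lineTerm, sub_neg_eq_add]
  rw [(cre_commute h k A B _ _).eq, mul_assoc, (ann_commute h k A B _ _).eq, ← mul_assoc,
    ← sub_eq_add_neg]

theorem line_shift (c : ℤ → ℂ) (i j s : ℤ) :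
    line h k A B c (i - s) j = line h k A B (fun l => c (l + s)) i (j - s) := by
  refine LinearMap.ext fun v => ?_
  rw [line_apply, line_apply]
  let e : ℤ × ℤ × ℤ ≃ ℤ × ℤ × ℤ :=
    ⟨fun t => (t.1 + s, t.2), fun t => (t.1 - s, t.2), fun t => by simp, fun t => by simp⟩
  rw [← finsum_comp_equiv e]
  refine finsum_congr fun t => ?_
  simp only [e, Equiv.coe_fn_mk, lineTerm]
  rw [show i - s + (t.1 + s) + t.2.1 = i + t.1 + t.2.1 by ring,
    show j - (t.1 + s) + t.2.2 = j - s - t.1 + t.2.2 by ring]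

/-- Only finitely many l matter on v, so an infinite family may be summed inside the coefficient
sequence when each l meets finitely many members. This serves both for multiplication by Taylor
series and for the normal ordered sum of G^+ and G^-. -/
theorem finsum_line {ι : Type*} (c : ι → ℤ → ℂ) (hc : ∀ l, {γ | c γ l ≠ 0}.Finite) (i j : ℤ)
    (v : Osc) : {γ | line h k A B (c γ) i j v ≠ 0}.Finite ∧
      ∑ᶠ γ, line h k A B (c γ) i j v = line h k A B (fun l => ∑ᶠ γ, c γ l) i j v := by
  have hfin : {x : ι × (ℤ × ℤ × ℤ) | c x.1 x.2.1 • lineTerm h k A B i j x.2 v ≠ 0}.Finite := by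
    refine ((lineTerm_finite h k A B i j v).biUnion (t := fun t => (fun γ => (γ, t)) ''
      {γ | c γ t.1 ≠ 0}) fun t _ => (hc t.1).image _).subset ?_
    rintro ⟨γ, t⟩ hx
    simp only [Set.mem_ofPred_eq, ne_eq, smul_eq_zero, not_or] at hx
    simp only [Set.mem_iUnion]
    exact ⟨t, hx.2, γ, hx.1, rfl⟩
  constructor
  · refine (hfin.image Prod.fst).subset fun γ hγ => ?_
    rw [Set.mem_ofPred_eq, line_apply] at hγ
    by_contra h0
    exact hγ (finsum_eq_zero_of_forall_eq_zero fun t => by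
      by_contra ht
      exact h0 ⟨(γ, t), ht, rfl⟩)
  · simp only [line_apply]
    rw [← finsum_curry (fun x : ι × (ℤ × ℤ × ℤ) => c x.1 x.2.1 • lineTerm h k A B i j x.2 v) hfin,
      ← finsum_comp_equiv (Equiv.prodComm _ _), finsum_curry]
    · refine finsum_congr fun t => ?_
      rw [finsum_smul]
      rfl
    · refine Set.Finite.subset (hfin.image Prod.swap) fun x hx => ⟨x.swap, hx, rfl⟩

/-- The product formula for the oscillator parts of two vertex operators. -/
theorem oscMode_mul_oscMode (i j : ℤ) : oscMode h k A i * oscMode h k B j =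
    line h k A B (coeffZ (contraction h k A B)) i j := by
  refine LinearMap.ext fun v => ?_
  -- From (p, p', l), with p and p' the annihilation indices in the two factors and l the contracted
  -- degree, to (l, p - l, p'): after contraction the annihilation part of A has index p - l.
  let e : ℤ × ℤ × ℤ ≃ ℤ × ℤ × ℤ :=
    ⟨fun t => (t.2.2, t.1 - t.2.2, t.2.1), fun t => (t.2.1 + t.1, t.2.2, t.1), fun t => by simp,
      fun t => by simp⟩
  have hfin := line_finite h k A B (coeffZ (contraction h k A B)) i j v
  rw [line_apply, ← finsum_comp_equiv e, finsum_curry₃, Module.End.mul_apply, oscMode_apply]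
  · refine finsum_congr fun p => ?_
    rw [oscMode_apply, map_finsum, map_finsum]
    · refine finsum_congr fun p' => ?_
      have h1 : ann h k A p (cre h k B (j + p') (ann h k B p' v)) =
          ∑ᶠ l : ℤ, coeffZ (contraction h k A B) l •
            (cre h k B (j + p' - l) * ann h k A (p - l)) (ann h k B p' v) := by
        rw [← Module.End.mul_apply, ann_mul_cre,
          ← LinearMap.applyₗ_apply_apply (R := ℂ) (M₂ := Osc) (ann h k B p' v), map_finsum]
        · rfl
        · refine (Set.finite_Icc 0 p).subset fun l hl => ?_
          rw [Function.mem_support] at hl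
          constructor
          · by_contra h0
            exact hl (by rw [coeffZ_of_neg _ (by omega), zero_smul])
          · by_contra h0
            exact hl (by rw [ann_of_neg h k A (by omega), mul_zero, smul_zero])
      rw [h1, map_finsum]
      · refine finsum_congr fun l => ?_
        simp only [e, Equiv.coe_fn_mk, lineTerm, map_smul, Module.End.mul_apply]
        rw [show i + l + (p - l) = i + p by ring, show j - l + p' = j + p' - l by ring]
      · refine (Set.finite_Icc 0 p).subset fun l hl => ?_
        rw [Function.mem_support] at hl
        constructor
        · by_contra h0
          exact hl (by rw [coeffZ_of_neg _ (by omega), zero_smul])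
        · by_contra h0
          exact hl (by rw [ann_of_neg h k A (by omega), mul_zero, LinearMap.zero_apply, smul_zero])
    · refine (pointwiseFinite_oscMode h k B j v).subset fun p' hp' h0 => hp' ?_
      rw [Module.End.mul_apply] at h0
      dsimp only
      rw [h0, map_zero]
    · exact pointwiseFinite_oscMode h k B j v
  · exact hfin.preimage e.injective.injOn

/-- The specialization of `:A(z) B(w):` at `z = q ^ u w`. -/
theorem line_qp (u : ℂ) (i j : ℤ) : line h k A B (fun l => qp h (u * l)) i j =
    qp h (-(u * i)) • oscMode h k (A.dilate h u * B) (i + j) := by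
  refine LinearMap.ext fun v => ?_
  -- The new variables are the total annihilation index P, its part p in A, and the creation index r
  -- of A. Since l = r - i - p, the factor q^(ul) splits into the dilation factors of A and the
  -- constant q^(-ui).
  let e : ℤ × ℤ × ℤ ≃ ℤ × ℤ × ℤ :=
    ⟨fun t => (t.2.2 - i - t.2.1, t.2.1, t.1 - t.2.1),
      fun t => (t.2.2 + t.2.1, t.2.1, t.1 + i + t.2.1),
      fun t => by ext <;> dsimp only <;> ring, fun t => by ext <;> dsimp only <;> ring⟩
  have hfin := line_finite h k A B (fun l => qp h (u * l)) i j v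
  rw [line_apply, ← finsum_comp_equiv e, finsum_curry₃, LinearMap.smul_apply, oscMode_apply,
    smul_finsum]
  · refine finsum_congr fun P => ?_
    have h1 : ann h k (A.dilate h u * B) P v =
        ∑ᶠ p : ℤ, (ann h k (A.dilate h u) p * ann h k B (P - p)) v := by
      rw [ann_mul, ← LinearMap.applyₗ_apply_apply (R := ℂ) (M₂ := Osc) v, map_finsum]
      · rfl
      · refine (Set.finite_Icc 0 P).subset fun p hp => ?_
        rw [Function.mem_support] at hp
        constructor
        · by_contra h0
          exact hp (by rw [ann_of_neg h k _ (by omega), zero_mul])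
        · by_contra h0
          exact hp (by rw [ann_of_neg h k B (by omega), mul_zero])
    rw [h1, map_finsum, smul_finsum]
    · refine finsum_congr fun p => ?_
      rw [cre_mul, ← LinearMap.applyₗ_apply_apply (R := ℂ) (M₂ := Osc), map_finsum, smul_finsum]
      · refine finsum_congr fun r => ?_
        simp only [e, Equiv.coe_fn_mk, lineTerm, Module.End.mul_apply, cre_dilate, ann_dilate,
          LinearMap.applyₗ_apply_apply, LinearMap.smul_apply, map_smul, smul_smul, ← qp_add]
        rw [show i + (r - i - p) + p = r by ring,
          show j - (r - i - p) + (P - p) = i + j + P - r by ring]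
        congr 2
        push_cast
        ring
      · refine (Set.finite_Icc 0 (i + j + P)).subset fun r hr => ?_
        rw [Function.mem_support] at hr
        constructor
        · by_contra h0
          exact hr (by rw [cre_of_neg h k _ (by omega), zero_mul])
        · by_contra h0
          exact hr (by rw [cre_of_neg h k B (by omega), mul_zero])
    · refine (Set.finite_Icc 0 P).subset fun p hp => ?_
      rw [Function.mem_support] at hp
      constructor
      · by_contra h0
        exact hp (by rw [ann_of_neg h k _ (by omega), zero_mul, LinearMap.zero_apply])
      · by_contra h0
        exact hp (by rw [ann_of_neg h k B (by omega), mul_zero, LinearMap.zero_apply])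
  · exact hfin.preimage e.injective.injOn

end Vertex

/-! ### Zero modes, bilocal operators and the product formula on the full Fock space. -/

/-- The pairing of the exponents of zero modes with a momentum. -/
def dot (x : Fin 3 → ℂ) (μ : Momentum) : ℂ := ∑ b, x b * zeroMode μ b

theorem dot_eq (x : Fin 3 → ℂ) (μ : Momentum) : dot x μ = x 0 * μ 0 - x 1 * μ 1 + x 2 * μ 2 := by
  simp only [dot, zeroMode, Fin.sum_univ_three, Matrix.cons_val]
  ring

theorem dot_add_left (x y : Fin 3 → ℂ) (μ : Momentum) : dot (x + y) μ = dot x μ + dot y μ := by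
  simp only [dot_eq, Pi.add_apply]
  ring

theorem dot_add_right (x : Fin 3 → ℂ) (μ ν : Momentum) : dot x (μ + ν) = dot x μ + dot x ν := by
  simp only [dot_eq, Pi.add_apply]
  ring

theorem dot_zero_right (x : Fin 3 → ℂ) : dot x 0 = 0 := by simp [dot_eq]

theorem dot_zero_left (μ : Momentum) : dot 0 μ = 0 := by simp [dot_eq]

theorem end_ext {f g : Module.End ℂ Fock}
    (hfg : ∀ μ P, f (Finsupp.single μ P) = g (Finsupp.single μ P)) : f = g :=
  Finsupp.lhom_ext hfg

namespace Vertex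

variable (h k : ℂ) (A B : Vertex)

theorem field_single (m : ℂ) (μ : Momentum) (P : Osc) : A.field h k m (Finsupp.single μ P) =
    Finsupp.single (μ + A.shift)
      (qp h (dot A.qpow μ) • A.oscCoeff h k (-m - dot A.zpow μ) P) := by
  rw [field, Finsupp.lsum_single]
  rfl

theorem field_single_of_eq {m : ℂ} {μ : Momentum} {i : ℤ} (hi : -m - dot A.zpow μ = i) (P : Osc) :
    A.field h k m (Finsupp.single μ P) =
      Finsupp.single (μ + A.shift) (qp h (dot A.qpow μ) • oscMode h k A i P) := by
  rw [field_single, hi, oscCoeff_intCast]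

theorem field_single_of_ne {m : ℂ} {μ : Momentum} (hi : ∀ i : ℤ, -m - dot A.zpow μ ≠ i)
    (P : Osc) : A.field h k m (Finsupp.single μ P) = 0 := by
  rw [field_single, oscCoeff_of_ne_intCast h k A hi, LinearMap.zero_apply, smul_zero,
    Finsupp.single_zero]

theorem oscMode_dilate (u : ℂ) (i : ℤ) :
    oscMode h k (A.dilate h u) i = qp h (u * i) • oscMode h k A i := by
  refine LinearMap.ext fun v => ?_
  rw [LinearMap.smul_apply, oscMode_apply, oscMode_apply, smul_finsum]
  refine finsum_congr fun p => ?_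
  rw [cre_dilate, ann_dilate, LinearMap.smul_apply, LinearMap.smul_apply, map_smul, smul_smul,
    ← qp_add]
  congr 2
  push_cast
  ring

theorem dot_qpow_dilate (u : ℂ) (μ : Momentum) :
    dot (A.dilate h u).qpow μ = dot A.qpow μ + u * dot A.zpow μ := by
  simp only [dot_eq, dilate]
  ring

/-- The oscillator degree is -m minus the zero mode exponent of z, so its dilation factor depends on
the momentum. The correction of `qpow` in `dilate` compensates exactly this. -/
theorem field_dilate (u m : ℂ) :
    (A.dilate h u).field h k m = qp h (-u * m) • A.field h k m := by
  refine end_ext fun μ P => ?_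
  rw [LinearMap.smul_apply]
  by_cases hi : ∃ i : ℤ, -m - dot A.zpow μ = i
  · obtain ⟨i, hi⟩ := hi
    rw [field_single_of_eq h k A hi, field_single_of_eq h k (A.dilate h u) hi, oscMode_dilate,
      LinearMap.smul_apply, smul_smul, Finsupp.smul_single, smul_smul, dot_qpow_dilate, ← qp_add,
      ← qp_add, ← hi, show (A.dilate h u).shift = A.shift from rfl]
    congr 3
    ring
  · push Not at hi
    rw [field_single_of_ne h k A hi, field_single_of_ne h k (A.dilate h u) hi, smul_zero]

/-- The coefficient of `z ^ x w ^ y` in `(∑_l c_l (w / z) ^ l) :A(z) B(w):`, oscillator part. -/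
def oscLine (c : ℤ → ℂ) (x y : ℂ) : Module.End ℂ Osc :=
  open Classical in
  if x = (⌊x.re⌋ : ℤ) ∧ y = (⌊y.re⌋ : ℤ) then line h k A B c ⌊x.re⌋ ⌊y.re⌋ else 0

theorem oscLine_intCast (c : ℤ → ℂ) (i j : ℤ) : oscLine h k A B c i j = line h k A B c i j := by
  simp [oscLine]

theorem oscLine_of_ne_left (c : ℤ → ℂ) {x : ℂ} (hx : ∀ i : ℤ, x ≠ i) (y : ℂ) :
    oscLine h k A B c x y = 0 := if_neg fun h0 => hx _ h0.1

theorem oscLine_of_ne_right (c : ℤ → ℂ) (x : ℂ) {y : ℂ} (hy : ∀ i : ℤ, y ≠ i) :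
    oscLine h k A B c x y = 0 := if_neg fun h0 => hy _ h0.2

/-- The coefficient of `z ^ (-m) w ^ (-n)` in `(∑_l c_l (w / z) ^ l) :A(z) B(w):`. -/
def bilocal (c : ℤ → ℂ) (m n : ℂ) : Module.End ℂ Fock :=
  Finsupp.lsum ℂ fun μ : Momentum =>
    (Finsupp.lsingle (μ + (A.shift + B.shift)) : Osc →ₗ[ℂ] Fock) ∘ₗ
      (qp h (dot A.qpow μ + dot B.qpow μ) •
        oscLine h k A B c (-m - dot A.zpow μ) (-n - dot B.zpow μ))

theorem bilocal_single (c : ℤ → ℂ) (m n : ℂ) (μ : Momentum) (P : Osc) :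
    bilocal h k A B c m n (Finsupp.single μ P) = Finsupp.single (μ + (A.shift + B.shift))
      (qp h (dot A.qpow μ + dot B.qpow μ) •
        oscLine h k A B c (-m - dot A.zpow μ) (-n - dot B.zpow μ) P) := by
  rw [bilocal, Finsupp.lsum_single]
  rfl

theorem bilocal_single_of_eq (c : ℤ → ℂ) {m n : ℂ} {μ : Momentum} {i j : ℤ}
    (hi : -m - dot A.zpow μ = i) (hj : -n - dot B.zpow μ = j) (P : Osc) :
    bilocal h k A B c m n (Finsupp.single μ P) = Finsupp.single (μ + (A.shift + B.shift))
      (qp h (dot A.qpow μ + dot B.qpow μ) • line h k A B c i j P) := by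
  rw [bilocal_single, hi, hj, oscLine_intCast]

theorem bilocal_single_of_ne_left (c : ℤ → ℂ) {m : ℂ} (n : ℂ) {μ : Momentum}
    (hi : ∀ i : ℤ, -m - dot A.zpow μ ≠ i) (P : Osc) :
    bilocal h k A B c m n (Finsupp.single μ P) = 0 := by
  rw [bilocal_single, oscLine_of_ne_left h k A B c hi, LinearMap.zero_apply, smul_zero,
    Finsupp.single_zero]

theorem bilocal_single_of_ne_right (c : ℤ → ℂ) (m : ℂ) {n : ℂ} {μ : Momentum}
    (hj : ∀ j : ℤ, -n - dot B.zpow μ ≠ j) (P : Osc) :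
    bilocal h k A B c m n (Finsupp.single μ P) = 0 := by
  rw [bilocal_single, oscLine_of_ne_right h k A B c _ hj, LinearMap.zero_apply, smul_zero,
    Finsupp.single_zero]

/-- A case distinction which reduces statements on bilocal operators to oscillator parts. -/
theorem bilocal_cases (m n : ℂ) (μ : Momentum) :
    (∃ i j : ℤ, -m - dot A.zpow μ = i ∧ -n - dot B.zpow μ = j) ∨
      (∀ i : ℤ, -m - dot A.zpow μ ≠ i) ∨ (∀ j : ℤ, -n - dot B.zpow μ ≠ j) := by
  by_cases hi : ∃ i : ℤ, -m - dot A.zpow μ = i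
  · by_cases hj : ∃ j : ℤ, -n - dot B.zpow μ = j
    · exact .inl ⟨_, _, hi.choose_spec, hj.choose_spec⟩
    · exact .inr (.inr (by simpa using hj))
  · exact .inr (.inl (by simpa using hi))

theorem bilocal_add (c d : ℤ → ℂ) (m n : ℂ) :
    bilocal h k A B (c + d) m n = bilocal h k A B c m n + bilocal h k A B d m n := by
  refine end_ext fun μ P => ?_
  rw [LinearMap.add_apply]
  rcases bilocal_cases A B m n μ with ⟨i, j, hi, hj⟩ | hi | hj
  · rw [bilocal_single_of_eq h k A B _ hi hj, bilocal_single_of_eq h k A B _ hi hj,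
      bilocal_single_of_eq h k A B _ hi hj, line_add, LinearMap.add_apply, smul_add,
      Finsupp.single_add]
  · simp only [bilocal_single_of_ne_left h k A B _ n hi, add_zero]
  · simp only [bilocal_single_of_ne_right h k A B _ m hj, add_zero]

theorem bilocal_smul (a : ℂ) (c : ℤ → ℂ) (m n : ℂ) :
    bilocal h k A B (a • c) m n = a • bilocal h k A B c m n := by
  refine end_ext fun μ P => ?_
  rw [LinearMap.smul_apply]
  rcases bilocal_cases A B m n μ with ⟨i, j, hi, hj⟩ | hi | hj
  · rw [bilocal_single_of_eq h k A B _ hi hj, bilocal_single_of_eq h k A B _ hi hj, line_smul,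
      LinearMap.smul_apply, smul_comm, Finsupp.smul_single]
  · simp only [bilocal_single_of_ne_left h k A B _ n hi, smul_zero]
  · simp only [bilocal_single_of_ne_right h k A B _ m hj, smul_zero]

theorem bilocal_zero (m n : ℂ) : bilocal h k A B 0 m n = 0 := by
  simpa using bilocal_smul h k A B 0 0 m n

theorem bilocal_swap (c : ℤ → ℂ) (m n : ℂ) :
    bilocal h k A B c m n = bilocal h k B A (fun l => c (-l)) n m := by
  refine end_ext fun μ P => ?_
  rcases bilocal_cases A B m n μ with ⟨i, j, hi, hj⟩ | hi | hj
  · rw [bilocal_single_of_eq h k A B _ hi hj, bilocal_single_of_eq h k B A _ hj hi, line_swap,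
      add_comm A.shift, add_comm (dot A.qpow μ)]
  · rw [bilocal_single_of_ne_left h k A B _ n hi, bilocal_single_of_ne_right h k B A _ n hi]
  · rw [bilocal_single_of_ne_right h k A B _ m hj, bilocal_single_of_ne_left h k B A _ m hj]

theorem bilocal_shift (c : ℤ → ℂ) (m n : ℂ) (s : ℤ) :
    bilocal h k A B c (m + s) n = bilocal h k A B (fun l => c (l + s)) m (n + s) := by
  refine end_ext fun μ P => ?_
  rcases bilocal_cases A B m n μ with ⟨i, j, hi, hj⟩ | hi | hj
  · rw [bilocal_single_of_eq h k A B (i := i - s) _ (by push_cast; rw [← hi]; ring) hj,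
      bilocal_single_of_eq h k A B (j := j - s) _ hi (by push_cast; rw [← hj]; ring), line_shift]
  · rw [bilocal_single_of_ne_left h k A B _ _ hi, bilocal_single_of_ne_left h k A B]
    intro i h0
    exact hi (i + s) (by push_cast; rw [← h0]; ring)
  · rw [bilocal_single_of_ne_right h k A B _ _ hj, bilocal_single_of_ne_right h k A B]
    intro i h0
    exact hj (i + s) (by push_cast; rw [← h0]; ring)

/-- The product formula for vertex operators. -/
theorem field_mul_field (m n : ℂ) : A.field h k m * B.field h k n =
    qp h (dot A.qpow B.shift) •
      bilocal h k A B (coeffZ (contraction h k A B)) (m + dot A.zpow B.shift) n := by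
  refine end_ext fun μ P => ?_
  rw [Module.End.mul_apply, LinearMap.smul_apply]
  -- When the zero modes of A act, B has already shifted the momentum, whereas `bilocal` reads all
  -- zero modes at the initial momentum.
  have hsub : ∀ ν, -(m + dot A.zpow B.shift) - dot A.zpow ν =
      -m - dot A.zpow (ν + B.shift) := fun ν => by rw [dot_add_right]; ring
  rcases bilocal_cases A B (m + dot A.zpow B.shift) n μ with ⟨i, j, hi, hj⟩ | hi | hj
  · rw [bilocal_single_of_eq h k A B _ hi hj, field_single_of_eq h k B hj, field_single_of_eq h k A
      (by rw [← hsub]; exact hi), map_smul, smul_smul, Finsupp.smul_single, smul_smul,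
      ← oscMode_mul_oscMode, Module.End.mul_apply, ← qp_add, ← qp_add, dot_add_right, add_assoc μ,
      add_comm A.shift]
    congr 3
    ring
  · rw [bilocal_single_of_ne_left h k A B _ _ hi, field_single, field_single_of_ne h k A, smul_zero]
    intro i
    rw [← hsub]
    exact hi i
  · rw [bilocal_single_of_ne_right h k A B _ _ hj, field_single_of_ne h k B hj, map_zero, smul_zero]

/-- The specialization of `:A(z) B(w):` at `z = q ^ u w`. -/
theorem bilocal_qp (u : ℂ) {m : ℂ} (n : ℂ) {μ : Momentum} {i : ℤ} (hi : -m - dot A.zpow μ = i)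
    (P : Osc) : bilocal h k A B (fun l => qp h (u * l)) m n (Finsupp.single μ P) =
      qp h (u * m) • (A.dilate h u * B).field h k (m + n) (Finsupp.single μ P) := by
  have hz : dot (A.dilate h u * B).zpow μ = dot A.zpow μ + dot B.zpow μ := dot_add_left _ _ _
  have hq : dot (A.dilate h u * B).qpow μ = dot A.qpow μ + u * dot A.zpow μ + dot B.qpow μ := by
    rw [← dot_qpow_dilate h A]
    exact dot_add_left _ _ _
  by_cases hj : ∃ j : ℤ, -n - dot B.zpow μ = j
  · obtain ⟨j, hj⟩ := hj
    rw [bilocal_single_of_eq h k A B _ hi hj, line_qp, LinearMap.smul_apply, smul_smul, ← qp_add,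
      field_single_of_eq h k (A.dilate h u * B) (i := i + j)
        (by rw [hz]; push_cast; rw [← hi, ← hj]; ring), Finsupp.smul_single, smul_smul, ← qp_add,
      hq, ← hi]
    congr 3
    ring
  · push Not at hj
    rw [bilocal_single_of_ne_right h k A B _ _ hj, field_single_of_ne, smul_zero]
    intro j h0
    refine hj (j - i) ?_
    push_cast
    rw [← h0, ← hi, hz]
    ring

theorem finsum_bilocal {ι : Type*} (c : ι → ℤ → ℂ) (hc : ∀ l, {γ | c γ l ≠ 0}.Finite) (m n : ℂ)
    (v : Fock) : {γ | bilocal h k A B (c γ) m n v ≠ 0}.Finite ∧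
      ∑ᶠ γ, bilocal h k A B (c γ) m n v = bilocal h k A B (fun l => ∑ᶠ γ, c γ l) m n v := by
  induction v using Finsupp.induction_linear with
  | zero => simp
  | add v w hv hw =>
    simp only [map_add]
    refine ⟨(hv.1.union hw.1).subset fun γ hγ => ?_, ?_⟩
    · by_contra h0
      simp only [Set.mem_union, Set.mem_ofPred_eq, not_or, not_not] at h0
      exact hγ (by rw [h0.1, h0.2, add_zero])
    · rw [finsum_add_distrib hv.1 hw.1, hv.2, hw.2]
  | single μ P =>
    rcases bilocal_cases A B m n μ with ⟨i, j, hi, hj⟩ | hi | hj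
    · simp only [bilocal_single_of_eq h k A B _ hi hj]
      obtain ⟨h1, h2⟩ := finsum_line h k A B c hc i j P
      refine ⟨h1.subset fun γ hγ h0 => hγ (by rw [h0, smul_zero, Finsupp.single_zero]), ?_⟩
      rw [← h2, smul_finsum, ← Finsupp.lsingle_apply (R := ℂ), map_finsum]
      · rfl
      · exact h1.subset fun γ hγ h0 => hγ (by dsimp only; rw [h0, smul_zero])
    · simp [bilocal_single_of_ne_left h k A B _ _ hi]
    · simp [bilocal_single_of_ne_right h k A B _ _ hj]

/-- The product `f(z / w) B(w) A(z)` as a bilocal operator. -/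
theorem taylorMul_field (f : PowerSeries ℂ) (m n : ℂ) :
    PointwiseFinite (taylorTerm f (wz (B.field h k) (A.field h k)) m n) ∧
    taylorMul f (wz (B.field h k) (A.field h k)) m n = qp h (dot B.qpow A.shift) •
      bilocal h k B A (coeffZ (f * contraction h k B A)) (n + dot B.zpow A.shift) m := by
  have hterm : ∀ l : ℕ, taylorTerm f (wz (B.field h k) (A.field h k)) m n l =
      qp h (dot B.qpow A.shift) • bilocal h k B A (fun r => PowerSeries.coeff l f *
        coeffZ (contraction h k B A) (r - l)) (n + dot B.zpow A.shift) m := by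
    intro l
    rw [taylorTerm, wz, field_mul_field, smul_comm, ← bilocal_smul]
    -- The factor (z/w)^l shifts the two labels in opposite directions, and this equals a shift of
    -- the coefficient sequence. Summed over l it produces the product series f times the
    -- contraction.
    have := bilocal_shift h k B A (fun r => PowerSeries.coeff l f *
        coeffZ (contraction h k B A) (r - l)) (n + dot B.zpow A.shift - l) m l
    push_cast at this
    rw [sub_add_cancel] at this
    rw [this, show n + dot B.zpow A.shift - (l : ℂ) = n - l + dot B.zpow A.shift by ring]
    congr 2
    funext r
    rw [add_sub_cancel_right]
    rfl
  have hc : ∀ r : ℤ, {l : ℕ | PowerSeries.coeff l f *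
      coeffZ (contraction h k B A) (r - l) ≠ 0}.Finite := by
    intro r
    refine (Set.finite_Iic r.toNat).subset fun l hl => ?_
    by_contra h0
    rw [Set.mem_Iic] at h0
    exact hl (by rw [coeffZ_of_neg _ (by omega), mul_zero])
  have key := fun v => finsum_bilocal h k B A (fun (l : ℕ) r => PowerSeries.coeff l f *
        coeffZ (contraction h k B A) (r - l)) hc (n + dot B.zpow A.shift) m v
  have hfin : PointwiseFinite (taylorTerm f (wz (B.field h k) (A.field h k)) m n) := fun v =>
    (key v).1.subset fun l hl h0 => hl (by rw [hterm, LinearMap.smul_apply, h0, smul_zero])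
  refine ⟨hfin, LinearMap.ext fun v => ?_⟩
  rw [taylorMul, lfSum_apply hfin]
  simp only [hterm, LinearMap.smul_apply]
  rw [← smul_finsum, (key v).2]
  congr 3
  funext r
  rw [coeffZ_mul]
  refine finsum_eq_of_bijOn (fun l : ℕ => (l : ℤ)) (s := Set.univ) (t := {l | 0 ≤ l})
    ⟨fun l _ => ?_, fun a _ b _ => ?_, fun l (hl : 0 ≤ l) => ?_⟩ (fun _ _ => Set.mem_univ _)
    (fun l hl => ?_) (fun l _ => ?_)
  · exact Int.natCast_nonneg l
  · simp
  · exact ⟨l.toNat, Set.mem_univ _, by simpa using hl⟩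
  · by_contra h0
    exact hl (by rw [coeffZ_of_neg _ (by simpa using h0), zero_mul])
  · rw [coeffZ_natCast]

end Vertex

/-! ### Finiteness of sums of operators. -/

section Truncated

variable {M : Type*} [AddCommGroup M] [Module ℂ M]

/-- Every vector is annihilated by all modes of sufficiently large real part. -/
def Truncated (B : ℂ → Module.End ℂ M) : Prop :=
  ∀ v, ∃ N : ℝ, ∀ m : ℂ, N ≤ m.re → B m v = 0

theorem Truncated.add {B C : ℂ → Module.End ℂ M} (hB : Truncated B) (hC : Truncated C) :
    Truncated fun m => B m + C m := by
  intro v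
  obtain ⟨N, hN⟩ := hB v
  obtain ⟨N', hN'⟩ := hC v
  refine ⟨max N N', fun m hm => ?_⟩
  rw [LinearMap.add_apply, hN m (le_trans (le_max_left _ _) hm),
    hN' m (le_trans (le_max_right _ _) hm), add_zero]

theorem Truncated.smul {B : ℂ → Module.End ℂ M} (hB : Truncated B) (a : ℂ → ℂ) :
    Truncated fun m => a m • B m := by
  intro v
  obtain ⟨N, hN⟩ := hB v
  exact ⟨N, fun m hm => by rw [LinearMap.smul_apply, hN m hm, smul_zero]⟩

theorem Truncated.sub {B C : ℂ → Module.End ℂ M} (hB : Truncated B) (hC : Truncated C) :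
    Truncated fun m => B m - C m := by
  simpa [sub_eq_add_neg] using hB.add (hC.smul fun _ => -1)

theorem Truncated.comp_add {B : ℂ → Module.End ℂ M} (hB : Truncated B) (a : ℂ) :
    Truncated fun m => B (m + a) := by
  intro v
  obtain ⟨N, hN⟩ := hB v
  exact ⟨N - a.re, fun m hm => hN _ (by rw [Complex.add_re]; linarith)⟩

theorem truncated_oneSeries : Truncated (oneSeries (M := M)) := by
  refine fun v => ⟨1, fun m hm => ?_⟩
  rw [oneSeries, if_neg, LinearMap.zero_apply]
  rintro rfl
  norm_num at hm

/-- Only modes with labels in `-ℕ` are nonzero. -/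
def SuppNeg (B : ℂ → Module.End ℂ M) : Prop := ∀ a : ℂ, (∀ n : ℕ, a ≠ -n) → B a = 0

/-- Only modes with labels in `ℕ` are nonzero. -/
def SuppPos (B : ℂ → Module.End ℂ M) : Prop := ∀ a : ℂ, (∀ n : ℕ, a ≠ n) → B a = 0

theorem SuppPos.finite {B : ℂ → Module.End ℂ M} (hB : SuppPos B) (ht : Truncated B) (v : M) :
    {c | B c v ≠ 0}.Finite := by
  obtain ⟨N, hN⟩ := ht v
  refine ((Set.finite_Iic ⌈N⌉₊).image fun n : ℕ => (n : ℂ)).subset fun c hc => ?_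
  by_cases h : ∃ n : ℕ, c = n
  · obtain ⟨n, rfl⟩ := h
    refine ⟨n, ?_, rfl⟩
    by_contra h0
    rw [Set.mem_Iic, not_le] at h0
    exact hc (hN _ (by simpa using (Nat.lt_of_ceil_lt h0).le))
  · push Not at h
    exact absurd (by rw [hB c h, LinearMap.zero_apply]) hc

variable {A B C : ℂ → Module.End ℂ M}

theorem pointwiseFinite_mulTerm (hB : SuppPos B) (ht : Truncated B) (m : ℂ) :
    PointwiseFinite (mulTerm A B m) := by
  refine fun v => ((hB.finite ht v).image fun c => m - c).subset fun a ha => ⟨m - a, ?_, by ring⟩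
  intro h0
  exact ha (by rw [mulTerm, Module.End.mul_apply, h0, map_zero])

/-- On v only finitely many labels c of C survive. The labels of A are -n, so B acts with label m +
n - c, and truncation leaves finitely many n for each c. -/
theorem pointwiseFinite_mulTerm₃ (hA : SuppNeg A) (hB : Truncated B) (hC : SuppPos C)
    (ht : Truncated C) (m : ℂ) : PointwiseFinite (mulTerm₃ A B C m) := by
  intro v
  choose N hN using hB
  refine ((hC.finite ht v).biUnion (t := fun c => (fun n : ℕ => ((-n : ℂ), c)) ''
    Set.Iic ⌈N (C c v) - (m - c).re⌉₊) fun c _ => (Set.finite_Iic _).image _).subset ?_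
  rintro ⟨a, c⟩ hac
  simp only [mulTerm₃, Set.mem_ofPred_eq, Module.End.mul_apply] at hac
  simp only [Set.mem_iUnion]
  refine ⟨c, fun h0 => hac (by rw [h0, map_zero, map_zero]), ?_⟩
  by_cases h : ∃ n : ℕ, a = -n
  · obtain ⟨n, rfl⟩ := h
    refine ⟨n, ?_, rfl⟩
    by_contra h0
    rw [Set.mem_Iic, not_le] at h0
    refine hac ?_
    rw [hN, map_zero]
    have := Nat.lt_of_ceil_lt h0
    simp only [Complex.sub_re, Complex.neg_re, Complex.natCast_re] at this ⊢
    linarith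
  · push Not at h
    exact absurd (by rw [hA a h, LinearMap.zero_apply]) hac

theorem pointwiseFinite_taylorTerm (hA : Truncated A) (f : PowerSeries ℂ) (m n : ℂ) :
    PointwiseFinite (taylorTerm f (wz B A) m n) := by
  intro v
  obtain ⟨N, hN⟩ := hA v
  refine (Set.finite_Iic ⌈N - m.re⌉₊).subset fun l hl => ?_
  by_contra h0
  rw [Set.mem_Iic, not_le] at h0
  have := Nat.lt_of_ceil_lt h0
  refine hl ?_
  rw [taylorTerm, wz, LinearMap.smul_apply, Module.End.mul_apply, hN, map_zero, smul_zero]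
  rw [Complex.add_re, Complex.natCast_re]
  linarith

theorem truncated_mul₂ (hA : SuppNeg A) (hB : SuppPos B) (ht : Truncated B) :
    Truncated (mul₂ A B) := by
  intro v
  obtain ⟨N, hN⟩ := ht v
  refine ⟨N, fun m hm => ?_⟩
  rw [mul₂, lfSum_apply (pointwiseFinite_mulTerm hB ht m), finsum_eq_zero_of_forall_eq_zero]
  intro a
  rw [mulTerm, Module.End.mul_apply]
  by_cases h : ∃ n : ℕ, a = -n
  · obtain ⟨n, rfl⟩ := h
    rw [hN, map_zero]
    simp only [Complex.sub_re, Complex.neg_re, Complex.natCast_re]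
    linarith [(n.cast_nonneg : (0 : ℝ) ≤ n)]
  · push Not at h
    rw [hA a h, LinearMap.zero_apply]

theorem Sector.offset_re_mem (A : Sector) : 0 ≤ A.offset.re ∧ A.offset.re ≤ 1 := by
  cases A <;> norm_num [Sector.offset]

/-- Normal ordering puts the mode with the larger label on the right. That label grows without bound
in both directions of j, so truncation kills all but finitely many terms. -/
theorem pointwiseFinite_normalTerm (C : Currents M) (hC : ∀ s, Truncated (C.G s)) (A : Sector)
    (m : ℂ) : PointwiseFinite (C.normalTerm A m) := by
  intro v
  obtain ⟨N, hN⟩ := hC 1 v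
  obtain ⟨N', hN'⟩ := hC (-1) v
  obtain ⟨h0, h1⟩ := A.offset_re_mem
  obtain ⟨R, hR⟩ := exists_nat_gt (|N| + |N'| + |m.re| + 1)
  refine (Set.finite_Icc (-R : ℤ) R).subset fun j hj => ?_
  by_contra hjR
  rw [Set.mem_Icc, not_and_or, not_le, not_le] at hjR
  refine hj ?_
  rw [Currents.normalTerm, Currents.normalGG]
  have e1 : (-((j : ℂ) + A.offset)).re = -(j + A.offset.re) := by simp
  have e2 : (m + ((j : ℂ) + A.offset)).re = m.re + (j + A.offset.re) := by simp
  have a1 := le_abs_self N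
  have a2 := le_abs_self N'
  have a3 := le_abs_self m.re
  have a4 := neg_abs_le m.re
  have a5 := abs_nonneg N
  have a6 := abs_nonneg N'
  rcases hjR with hjR | hjR
  · have hj' : (j : ℝ) + 1 ≤ -R := by exact_mod_cast hjR
    rw [if_neg (fun h => by have := congrArg Complex.re h; rw [e1, e2] at this; linarith),
      if_neg (by rw [e1, e2]; linarith), LinearMap.neg_apply, Module.End.mul_apply,
      hN _ (by rw [e1]; linarith), map_zero, neg_zero]
  · have hj' : (R : ℝ) + 1 ≤ j := by exact_mod_cast hjR
    rw [if_neg (fun h => by have := congrArg Complex.re h; rw [e1, e2] at this; linarith),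
      if_pos (by rw [e1, e2]; linarith), Module.End.mul_apply,
      hN' _ (by rw [e2]; linarith), map_zero]

/-- The right factor of each term has a label of real part at least half that of m, so for large m
every term vanishes on v. -/
theorem truncated_lfSum_normalTerm (C : Currents M) (hC : ∀ s, Truncated (C.G s)) (A : Sector) :
    Truncated fun m => lfSum (C.normalTerm A m) := by
  intro v
  obtain ⟨N, hN⟩ := hC 1 v
  obtain ⟨N', hN'⟩ := hC (-1) v
  refine ⟨2 * (|N| + |N'|), fun m hm => ?_⟩
  rw [lfSum_apply (pointwiseFinite_normalTerm C hC A m), finsum_eq_zero_of_forall_eq_zero]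
  intro j
  rw [Currents.normalTerm, Currents.normalGG]
  have e1 : (-((j : ℂ) + A.offset)).re = -(j + A.offset.re) := by simp
  have e2 : (m + ((j : ℂ) + A.offset)).re = m.re + (j + A.offset.re) := by simp
  have a1 := le_abs_self N
  have a2 := le_abs_self N'
  have a5 := abs_nonneg N
  have a6 := abs_nonneg N'
  split_ifs with h1 h2
  · have h3 := congrArg Complex.re h1
    rw [e1, e2] at h3
    rw [LinearMap.smul_apply, LinearMap.sub_apply, Module.End.mul_apply,
      Module.End.mul_apply, hN _ (by rw [e1]; linarith), hN' _ (by rw [e1]; linarith), map_zero,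
      map_zero, sub_zero, smul_zero]
  · rw [e1, e2] at h2
    rw [Module.End.mul_apply, hN' _ (by rw [e2]; linarith), map_zero]
  · rw [e1, e2] at h2
    rw [LinearMap.neg_apply, Module.End.mul_apply, hN _ (by rw [e1]; linarith), map_zero,
      neg_zero]

end Truncated

/-! ### Vertex operators with one-sided exponents, and the triple products K^- X K^+. -/

namespace Vertex

theorem ext_iff' {A B : Vertex} : A = B ↔ A.shift = B.shift ∧ A.zpow = B.zpow ∧
    A.qpow = B.qpow ∧ A.coef = B.coef := by
  cases A
  cases B
  simp

instance : CommMonoid Vertex where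
  one := ⟨0, 0, 0, 0⟩
  mul_assoc A B C := ext_iff'.2 ⟨add_assoc _ _ _, add_assoc _ _ _, add_assoc _ _ _,
    add_assoc _ _ _⟩
  mul_comm A B := ext_iff'.2 ⟨add_comm _ _, add_comm _ _, add_comm _ _, add_comm _ _⟩
  one_mul A := ext_iff'.2 ⟨zero_add _, zero_add _, zero_add _, zero_add _⟩
  mul_one A := ext_iff'.2 ⟨add_zero _, add_zero _, add_zero _, add_zero _⟩

variable (h k : ℂ) (A B : Vertex)

theorem truncated_field : Truncated (A.field h k) := by
  intro v
  induction v using Finsupp.induction_linear with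
  | zero => exact ⟨0, fun m _ => map_zero _⟩
  | add v w hv hw =>
    obtain ⟨N, hN⟩ := hv
    obtain ⟨N', hN'⟩ := hw
    refine ⟨max N N', fun m hm => ?_⟩
    rw [map_add, hN m (le_trans (le_max_left _ _) hm), hN' m (le_trans (le_max_right _ _) hm),
      add_zero]
  | single μ P =>
    obtain ⟨N, hN⟩ := exists_oscMode_eq_zero h k A P
    refine ⟨-N - (dot A.zpow μ).re, fun m hm => ?_⟩
    by_cases hi : ∃ i : ℤ, -m - dot A.zpow μ = i
    · obtain ⟨i, hi⟩ := hi
      rw [field_single_of_eq h k A hi, hN, smul_zero, Finsupp.single_zero]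
      have := congrArg Complex.re hi
      simp only [Complex.sub_re, Complex.neg_re, Complex.intCast_re] at this
      exact_mod_cast show (i : ℝ) ≤ N by linarith
    · push Not at hi
      exact field_single_of_ne h k A hi P

open PowerSeries

theorem expSeries_zero {R : Type*} [Ring R] [Algebra ℂ R] :
    expSeries (0 : PowerSeries R) = 1 := by
  refine eq_of_euler_eq (P := 0) ?_ (by simp) ?_ ?_
  · simp [coeff_zero_expSeries]
  · rw [euler_expSeries (by simp) (fun i j => by simp)]
    simp
  · ext n
    rw [coeff_euler, coeff_one]
    rcases n with _ | n <;> simp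

theorem creation_eq_one (hA : ∀ b, ∀ m : ℕ, A.coef b (-(m : ℤ)) = 0) : A.creation h k = 1 := by
  have : creSer h k A = 0 := by
    ext1 n
    simp [creSer, hA]
  change expSeries (creSer h k A) = 1
  rw [this, expSeries_zero]

theorem annihilation_eq_one (hA : ∀ b, ∀ m : ℕ, A.coef b (m : ℤ) = 0) :
    A.annihilation h k = 1 := by
  have : annSer h k A = 0 := by
    ext1 n
    simp [annSer, hA]
  change expSeries (annSer h k A) = 1
  rw [this, expSeries_zero]

theorem contraction_eq_one_left (hA : ∀ b, ∀ m : ℕ, A.coef b (m : ℤ) = 0) :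
    contraction h k A B = 1 := by
  have : pairing h k A B = 0 := by
    ext1 n
    simp [pairing, hA]
  rw [contraction, this, expSeries_zero]

theorem contraction_eq_one_right (hB : ∀ b, ∀ m : ℕ, B.coef b (-(m : ℤ)) = 0) :
    contraction h k A B = 1 := by
  have : pairing h k A B = 0 := by
    ext1 n
    simp [pairing, hB]
  rw [contraction, this, expSeries_zero]

theorem coeffZ_one {R : Type*} [Semiring R] (i : ℤ) :
    coeffZ (1 : PowerSeries R) i = if i = 0 then 1 else 0 := by
  rcases lt_or_ge i 0 with hi | hi
  · rw [coeffZ_of_neg _ hi, if_neg (by omega)]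
  · lift i to ℕ using hi
    rw [coeffZ_natCast, coeff_one]
    simp

theorem oscMode_of_creation_eq_one (hA : A.creation h k = 1) (i : ℤ) :
    oscMode h k A i = ann h k A (-i) := by
  refine LinearMap.ext fun v => ?_
  rw [oscMode_apply, finsum_eq_single _ (-i)]
  · rw [add_neg_cancel, cre, hA, coeffZ_one, if_pos rfl, Module.End.one_apply]
  · intro p hp
    rw [cre, hA, coeffZ_one, if_neg (by omega), LinearMap.zero_apply]

theorem oscMode_of_annihilation_eq_one (hA : A.annihilation h k = 1) (i : ℤ) :
    oscMode h k A i = cre h k A i := by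
  refine LinearMap.ext fun v => ?_
  rw [oscMode_apply, finsum_eq_single _ 0]
  · rw [add_zero, ann, hA, coeffZ_one, if_pos rfl, Module.End.one_apply]
  · intro p hp
    rw [ann, hA, coeffZ_one, if_neg hp, LinearMap.zero_apply, map_zero]

theorem suppPos_field (hA : A.creation h k = 1) (hz : A.zpow = 0) : SuppPos (A.field h k) := by
  intro a ha
  refine end_ext fun μ P => ?_
  rw [LinearMap.zero_apply]
  by_cases hi : ∃ i : ℤ, -a - dot A.zpow μ = i
  · obtain ⟨i, hi⟩ := hi
    rw [field_single_of_eq h k A hi, oscMode_of_creation_eq_one h k A hA, ann_of_neg,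
      LinearMap.zero_apply, smul_zero, Finsupp.single_zero]
    by_contra h0
    refine ha (-i).toNat ?_
    rw [hz, dot_zero_left, sub_zero] at hi
    have : (((-i).toNat : ℤ) : ℂ) = ((-i : ℤ) : ℂ) := by rw [Int.toNat_of_nonneg (by omega)]
    rw [Int.cast_natCast] at this
    rw [this, Int.cast_neg, ← hi, neg_neg]
  · push Not at hi
    exact field_single_of_ne h k A hi P

theorem suppNeg_field (hA : A.annihilation h k = 1) (hz : A.zpow = 0) :
    SuppNeg (A.field h k) := by
  intro a ha
  refine end_ext fun μ P => ?_
  rw [LinearMap.zero_apply]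
  by_cases hi : ∃ i : ℤ, -a - dot A.zpow μ = i
  · obtain ⟨i, hi⟩ := hi
    rw [field_single_of_eq h k A hi, oscMode_of_annihilation_eq_one h k A hA, cre_of_neg,
      LinearMap.zero_apply, smul_zero, Finsupp.single_zero]
    by_contra h0
    refine ha i.toNat ?_
    rw [hz, dot_zero_left, sub_zero] at hi
    have : ((i.toNat : ℤ) : ℂ) = (i : ℂ) := by rw [Int.toNat_of_nonneg (by omega)]
    rw [Int.cast_natCast] at this
    rw [this, ← hi, neg_neg]
  · push Not at hi
    exact field_single_of_ne h k A hi P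

theorem oscMode_mul₃ {N X P : Vertex} (hN : N.annihilation h k = 1) (hP : P.creation h k = 1)
    (i : ℤ) (v : Osc) : oscMode h k (N * X * P) i v = ∑ᶠ t : ℤ × ℤ,
      cre h k N t.1 (oscMode h k X (i - t.1 + t.2) (ann h k P t.2 v)) := by
  have hcre : ∀ n, cre h k (N * X * P) n = ∑ᶠ r : ℤ, cre h k N r * cre h k X (n - r) := by
    intro n
    rw [cre, creation_mul, hP, mul_one, creation_mul, coeffZ_mul]
    rfl
  have hann : ∀ n, ann h k (N * X * P) n = ∑ᶠ p : ℤ, ann h k X (n - p) * ann h k P p := by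
    intro n
    rw [ann, annihilation_mul, annihilation_mul, hN, one_mul,
      (commute_of_coeff (S := X.annihilation h k) (T := P.annihilation h k) fun i j => by
        simpa only [ann, coeffZ_natCast] using ann_commute h k X P i j).eq, coeffZ_mul]
    exact finsum_congr fun p => (ann_commute h k P X _ _).eq
  let F : ℤ × ℤ × ℤ → Osc := fun t =>
    cre h k N t.2.2 (cre h k X (i + t.1 - t.2.2) (ann h k X (t.1 - t.2.1) (ann h k P t.2.1 v)))
  have hfin : (Function.support F).Finite := by
    obtain ⟨a, ha⟩ := exists_forall_ann h k X v
    obtain ⟨b, hb⟩ := exists_forall_ann h k P v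
    refine ((Set.finite_Icc 0 (a + b)).prod
      ((Set.finite_Icc 0 b).prod (Set.finite_Icc 0 (i + a + b)))).subset ?_
    rintro ⟨n, p, r⟩ ht
    simp only [F, Function.mem_support] at ht
    have h1 := hb p fun h0 => ht (by rw [h0, map_zero, map_zero, map_zero])
    have h2 := ha (n - p) fun h0 => ht (by
      rw [← Module.End.mul_apply (ann h k X _), (ann_commute h k X P _ _).eq,
        Module.End.mul_apply, h0, map_zero, map_zero, map_zero])
    have h3 : 0 ≤ r := by
      by_contra h0
      exact ht (by rw [cre_of_neg h k N (by omega), LinearMap.zero_apply])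
    have h4 : 0 ≤ i + n - r := by
      by_contra h0
      exact ht (by rw [cre_of_neg h k X (by omega), LinearMap.zero_apply, map_zero])
    simp only [Set.mem_prod, Set.mem_Icc]
    omega
  have h1 : oscMode h k (N * X * P) i v = ∑ᶠ t, F t := by
    rw [finsum_curry₃ F hfin, oscMode_apply]
    refine finsum_congr fun n => ?_
    rw [hann, ← LinearMap.applyₗ_apply_apply (R := ℂ) (M₂ := Osc) v, map_finsum, map_finsum]
    · refine finsum_congr fun p => ?_
      rw [hcre, ← LinearMap.applyₗ_apply_apply (R := ℂ) (M₂ := Osc), map_finsum]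
      · rfl
      · refine (Set.finite_Icc 0 (i + n)).subset fun r hr => ?_
        rw [Function.mem_support] at hr
        constructor
        · by_contra h0
          exact hr (by rw [cre_of_neg h k N (by omega), zero_mul])
        · by_contra h0
          exact hr (by rw [cre_of_neg h k X (by omega), mul_zero])
    · refine (Set.finite_Icc 0 n).subset fun p hp => ?_
      rw [Function.mem_support] at hp
      constructor
      · by_contra h0
        exact hp (by rw [ann_of_neg h k P (by omega), mul_zero, map_zero])
      · by_contra h0
        exact hp (by rw [ann_of_neg h k X (by omega), zero_mul, map_zero])
    · refine (Set.finite_Icc 0 n).subset fun p hp => ?_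
      rw [Function.mem_support] at hp
      constructor
      · by_contra h0
        exact hp (by rw [ann_of_neg h k P (by omega), mul_zero])
      · by_contra h0
        exact hp (by rw [ann_of_neg h k X (by omega), zero_mul])
  let e : (ℤ × ℤ) × ℤ ≃ ℤ × ℤ × ℤ :=
    ⟨fun t => (t.2 + t.1.2, t.1.2, t.1.1), fun t => ((t.2.2, t.2.1), t.1 - t.2.1),
      fun t => by ext <;> dsimp only; ring, fun t => by ext <;> dsimp only; ring⟩
  rw [h1, ← finsum_comp_equiv e, finsum_curry]
  · refine finsum_congr fun t => ?_
    rw [oscMode_apply, map_finsum]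
    · refine finsum_congr fun n => ?_
      simp only [F, e, Equiv.coe_fn_mk]
      rw [show i + (n + t.2) - t.1 = i - t.1 + t.2 + n by ring,
        show n + t.2 - t.2 = n by ring]
    · exact pointwiseFinite_oscMode h k X _ _
  · exact hfin.preimage e.injective.injOn

/-- N has no annihilation part and P no creation part, so N X P is already normal ordered in the
oscillators. The only reordering is that of the zero modes of N past the momentum shift of X. -/
theorem mul₃_field {N X P : Vertex} (hN : N.annihilation h k = 1) (hP : P.creation h k = 1)
    (hNz : N.zpow = 0) (hPz : P.zpow = 0) (hNs : N.shift = 0) (hPs : P.shift = 0) (m : ℂ) :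
    mul₃ (N.field h k) (X.field h k) (P.field h k) m =
      qp h (dot N.qpow X.shift) • (N * X * P).field h k m := by
  refine end_ext fun μ v => ?_
  rw [mul₃, lfSum_apply (pointwiseFinite_mulTerm₃ (suppNeg_field h k N hN hNz)
    (truncated_field h k X) (suppPos_field h k P hP hPz) (truncated_field h k P) m),
    LinearMap.smul_apply]
  have hz : dot (N * X * P).zpow μ = dot X.zpow μ := by
    change dot (N.zpow + X.zpow + P.zpow) μ = _
    rw [hNz, hPz, zero_add, add_zero]
  have hs : (N * X * P).shift = X.shift := by
    change N.shift + X.shift + P.shift = _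
    rw [hNs, hPs, zero_add, add_zero]
  have hq : dot (N * X * P).qpow μ = dot N.qpow μ + dot X.qpow μ + dot P.qpow μ := by
    change dot (N.qpow + X.qpow + P.qpow) μ = _
    rw [dot_add_left, dot_add_left]
  have hPc : ∀ c : ℂ, (∀ p : ℤ, c ≠ p) → P.field h k c (Finsupp.single μ v) = 0 := fun c hc =>
    field_single_of_ne h k P (fun i h0 => hc (-i) (by
      rw [hPz, dot_zero_left, sub_zero] at h0
      push_cast
      rw [← h0, neg_neg])) v
  have hPp : ∀ p : ℤ, P.field h k p (Finsupp.single μ v) =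
      Finsupp.single μ (qp h (dot P.qpow μ) • ann h k P p v) := fun p => by
    rw [field_single_of_eq h k P (i := -p) (by rw [hPz, dot_zero_left]; push_cast; ring), hPs,
      oscMode_of_creation_eq_one h k P hP, neg_neg, add_zero]
  have hNa : ∀ (a : ℂ) (ν : Momentum) (w : Osc), (∀ r : ℤ, a ≠ -r) →
      N.field h k a (Finsupp.single ν w) = 0 := fun a ν w ha =>
    field_single_of_ne h k N (fun i h0 => ha i (by
      rw [hNz, dot_zero_left, sub_zero] at h0
      rw [← h0, neg_neg])) w
  have hNr : ∀ (r : ℤ) (ν : Momentum) (w : Osc), N.field h k (-r) (Finsupp.single ν w) =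
      Finsupp.single ν (qp h (dot N.qpow ν) • cre h k N r w) := fun r ν w => by
    rw [field_single_of_eq h k N (i := r) (by rw [hNz, dot_zero_left]; ring), hNs,
      oscMode_of_annihilation_eq_one h k N hN, add_zero]
  -- N and P have integral labels, so the sum over complex labels is a sum over ℤ × ℤ.
  have hred : ∑ᶠ t : ℂ × ℂ, mulTerm₃ (N.field h k) (X.field h k) (P.field h k) m t
      (Finsupp.single μ v) = ∑ᶠ t : ℤ × ℤ, mulTerm₃ (N.field h k) (X.field h k) (P.field h k) m
        (-(t.1 : ℂ), (t.2 : ℂ)) (Finsupp.single μ v) := by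
    symm
    refine finsum_eq_of_bijOn (fun t : ℤ × ℤ => (-(t.1 : ℂ), (t.2 : ℂ))) (s := Set.univ)
      (t := Set.range fun t : ℤ × ℤ => (-(t.1 : ℂ), (t.2 : ℂ)))
      ⟨fun t _ => ⟨t, rfl⟩, fun t _ t' _ ht => ?_, fun x ⟨t, ht⟩ => ⟨t, Set.mem_univ _, ht⟩⟩
      (fun _ _ => Set.mem_univ _) (fun x hx => ?_) (fun _ _ => rfl)
    · simp only [Prod.mk.injEq, neg_inj, Int.cast_inj] at ht
      exact Prod.ext ht.1 ht.2
    · obtain ⟨a, c⟩ := x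
      simp only [mulTerm₃, Module.End.mul_apply] at hx
      by_cases hc : ∃ p : ℤ, c = p
      · obtain ⟨p, rfl⟩ := hc
        by_cases ha : ∃ r : ℤ, a = -r
        · obtain ⟨r, rfl⟩ := ha
          exact ⟨(r, p), rfl⟩
        · push Not at ha
          exact absurd (by rw [hPp, field_single, hNa _ _ _ ha]) hx
      · push Not at hc
        exact absurd (by rw [hPc c hc, map_zero, map_zero]) hx
  rw [hred]
  simp only [mulTerm₃, Module.End.mul_apply, hPp]
  by_cases hi : ∃ i : ℤ, -m - dot X.zpow μ = i
  · obtain ⟨i, hi⟩ := hi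
    have hX : ∀ (r p : ℤ) (w : Osc), X.field h k (m - -(r : ℂ) - p) (Finsupp.single μ w) =
        Finsupp.single (μ + X.shift)
          (qp h (dot X.qpow μ) • oscMode h k X (i - r + p) w) := fun r p w =>
      field_single_of_eq h k X (by push_cast; rw [← hi]; ring) w
    simp only [hX, hNr]
    rw [field_single_of_eq h k (N * X * P) (by rw [hz]; exact hi), hs, hq,
      oscMode_mul₃ h k hN hP, Finsupp.smul_single, smul_smul, ← qp_add, smul_finsum,
      ← Finsupp.singleAddHom_apply, AddMonoidHom.map_finsum_of_injective _
        (Finsupp.single_injective _)]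
    refine finsum_congr fun t => ?_
    simp only [map_smul, smul_smul, Finsupp.singleAddHom_apply, ← qp_add, dot_add_right]
    congr 3
    ring
  · push Not at hi
    rw [field_single_of_ne h k (N * X * P) (by rw [hz]; exact hi), smul_zero,
      finsum_eq_zero_of_forall_eq_zero]
    intro t
    rw [field_single_of_ne h k X, map_zero]
    intro i h0
    refine hi (i + t.1 - t.2) ?_
    push_cast at h0 ⊢
    rw [← h0]
    ring

end Vertex

/-! ### The series 1 - ax, its inverse and its logarithm. -/

section Series

open PowerSeries

/-- The power series `1 - a x`. -/
def lin (a : ℂ) : PowerSeries ℂ := 1 - C a * X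

/-- The power series `1 / (1 - a x)`. -/
def geom (a : ℂ) : PowerSeries ℂ := mk fun n => a ^ n

theorem lin_mul_geom (a : ℂ) : lin a * geom a = 1 := by
  ext n
  rw [lin, sub_mul, one_mul, mul_assoc, map_sub, coeff_C_mul, coeff_one]
  rcases n with _ | n
  · simp [geom]
  · simp [coeff_succ_X_mul, geom, pow_succ']

theorem inv_lin (a : ℂ) : (1 - C a * X : PowerSeries ℂ)⁻¹ = geom a := by
  rw [PowerSeries.inv_eq_iff_mul_eq_one]
  · rw [mul_comm]
    exact lin_mul_geom a
  · simp

/-- The power series `- log (1 - a x)`. -/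
def logSeries (a : ℂ) : PowerSeries ℂ := mk fun n => a ^ n / n

theorem coeff_zero_logSeries (a : ℂ) : coeff 0 (logSeries a) = 0 := by simp [logSeries]

theorem expSeries_add_comm {S T : PowerSeries ℂ} (hS : coeff 0 S = 0) (hT : coeff 0 T = 0) :
    expSeries (S + T) = expSeries S * expSeries T :=
  expSeries_add hS hT (fun _ _ => Commute.all _ _) (fun _ _ => Commute.all _ _)
    (fun _ _ => Commute.all _ _)

/-- Both sides have constant term 1 and satisfy x E' = (1 - 1/(1 - ax)) E. -/
theorem expSeries_neg_logSeries (a : ℂ) : expSeries (-logSeries a) = lin a := by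
  have h0 : coeff 0 (-logSeries a) = 0 := by rw [map_neg, coeff_zero_logSeries, neg_zero]
  have h1 : euler (-logSeries a) = 1 - geom a := by
    ext n
    rw [coeff_euler, map_neg, map_sub, coeff_one, logSeries, geom, coeff_mk, coeff_mk]
    rcases n with _ | n
    · simp
    · have : ((n + 1 : ℕ) : ℂ) ≠ 0 := by exact_mod_cast Nat.succ_ne_zero n
      simp only [smul_eq_mul, Nat.add_eq_zero_iff, one_ne_zero, and_false, if_false]
      field_simp
      ring
  refine eq_of_euler_eq (P := 1 - geom a) ?_ ?_ ?_ ?_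
  · rw [coeff_zero_expSeries]
    simp [lin]
  · rw [map_sub]
    simp [geom]
  · rw [euler_expSeries h0 (fun _ _ => Commute.all _ _), h1]
  · rw [sub_mul, one_mul, mul_comm (geom a), lin_mul_geom]
    ext n
    rw [coeff_euler, lin]
    rcases n with _ | _ | n <;> simp [coeff_one]

theorem expSeries_logSeries (a : ℂ) : expSeries (logSeries a) = geom a := by
  have h0 : coeff 0 (-logSeries a) = 0 := by rw [map_neg, coeff_zero_logSeries, neg_zero]
  have h1 := expSeries_add_comm (coeff_zero_logSeries a) h0
  rw [add_neg_cancel, Vertex.expSeries_zero, expSeries_neg_logSeries] at h1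
  have h2 : expSeries (logSeries a) * lin a * geom a = geom a := by rw [← h1, one_mul]
  rwa [mul_assoc, lin_mul_geom, mul_one] at h2

theorem rescale_lin (a b : ℂ) : PowerSeries.rescale a (lin b) = lin (a * b) := by
  ext n
  rw [coeff_rescale, lin, lin, map_sub, map_sub, coeff_C_mul, coeff_C_mul, coeff_one, coeff_X]
  rcases n with _ | _ | n <;> simp

theorem rescale_geom (a b : ℂ) : PowerSeries.rescale a (geom b) = geom (a * b) := by
  ext n
  rw [coeff_rescale, geom, geom, coeff_mk, coeff_mk, mul_pow]

end Series

/-! ### Behaviour of contraction functions under products and dilations. -/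

namespace Vertex

variable (h k : ℂ) (A B D : Vertex)

open PowerSeries

theorem contraction_mul_left :
    contraction h k (A * B) D = contraction h k A D * contraction h k B D := by
  have : pairing h k (A * B) D = pairing h k A D + pairing h k B D := by
    ext1 n
    simp only [pairing, map_add, coeff_mk, mul_coef, add_mul, Finset.sum_add_distrib]
  rw [contraction, this, expSeries_add_comm (coeff_zero_pairing h k A D)
    (coeff_zero_pairing h k B D)]
  rfl

theorem contraction_mul_right :
    contraction h k D (A * B) = contraction h k D A * contraction h k D B := by
  have : pairing h k D (A * B) = pairing h k D A + pairing h k D B := by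
    ext1 n
    simp only [pairing, map_add, coeff_mk, mul_coef, mul_add, add_mul, Finset.sum_add_distrib]
  rw [contraction, this, expSeries_add_comm (coeff_zero_pairing h k D A)
    (coeff_zero_pairing h k D B)]
  rfl

theorem contraction_dilate_left (u : ℂ) :
    contraction h k (A.dilate h u) B = PowerSeries.rescale (qp h (-u)) (contraction h k A B) := by
  have hT : ∀ n, coeff n (pairing h k (A.dilate h u) B) =
      qp h (-u) ^ n • coeff n (pairing h k A B) := fun n => by
    simp only [pairing, coeff_mk, smul_eq_mul, Finset.mul_sum, dilate, ← qp_mul_natCast]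
    refine Finset.sum_congr rfl fun b _ => ?_
    push_cast
    ring
  ext n
  rw [coeff_rescale, contraction, coeff_expSeries_rescale (qp h (-u))
    (coeff_zero_pairing h k A B) hT (fun _ _ => Commute.all _ _)]
  rfl

theorem contraction_dilate_right (u : ℂ) :
    contraction h k A (B.dilate h u) = PowerSeries.rescale (qp h u) (contraction h k A B) := by
  have hT : ∀ n, coeff n (pairing h k A (B.dilate h u)) =
      qp h u ^ n • coeff n (pairing h k A B) := fun n => by
    simp only [pairing, coeff_mk, smul_eq_mul, Finset.mul_sum, dilate, ← qp_mul_natCast]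
    refine Finset.sum_congr rfl fun b _ => ?_
    push_cast
    rw [neg_mul_neg]
    ring
  ext n
  rw [coeff_rescale, contraction, coeff_expSeries_rescale (qp h u)
    (coeff_zero_pairing h k A B) hT (fun _ _ => Commute.all _ _)]
  rfl

theorem dilate_mul (u : ℂ) : (A * B).dilate h u = A.dilate h u * B.dilate h u := by
  refine ext_iff'.2 ⟨rfl, rfl, ?_, ?_⟩
  · funext b
    change A.qpow b + B.qpow b + u * (A.zpow b + B.zpow b) =
      A.qpow b + u * A.zpow b + (B.qpow b + u * B.zpow b)
    ring
  · funext b m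
    exact mul_add _ _ _

theorem dilate_dilate (u v : ℂ) : (A.dilate h u).dilate h v = A.dilate h (u + v) := by
  refine ext_iff'.2 ⟨rfl, rfl, ?_, ?_⟩
  · funext b
    simp only [dilate]
    ring
  · funext b m
    simp only [dilate]
    rw [← mul_assoc, ← qp_add]
    congr 2
    ring

theorem dilate_zero : A.dilate h 0 = A := by
  refine ext_iff'.2 ⟨rfl, rfl, ?_, ?_⟩
  · funext b
    simp [dilate]
  · funext b m
    simp [dilate, qp_zero]

end Vertex

/-! ### The building blocks of G^±: exponents, contraction functions and fusion. -/

/-- The vertex operators whose sums are `G^+(z)`, `G^-(z)`, for the sign `s` of the current. -/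
def vtxG (h k : ℂ) (s a : ℤˣ) : Vertex :=
  if s = 1 then (vtxV h k 1).dilate h (-(k + 2)) * (vtxE h k a).dilate h (-((3 * k + 4) / 2))
  else (vtxV h k (-1)).dilate h (k + 2) * (vtxF h k a).dilate h ((3 * k + 4) / 2)

theorem qn_neg (h u : ℂ) : qn h (-u) = -qn h u := by
  rw [qn, qn, neg_neg]
  ring

theorem units_cases (s : ℤˣ) : s = 1 ∨ s = -1 := Int.units_eq_one_or s

theorem neg_one_ne_one_units : (-1 : ℤˣ) ≠ 1 := by decide

theorem vtxG_shift (h k : ℂ) (s a : ℤˣ) :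
    (vtxG h k s a).shift = ![(s : ℤ) * (k + 2), (s : ℤ) * 2, 0] := by
  rcases units_cases s with rfl | rfl
  · rw [vtxG, if_pos rfl]
    change (![_, _, _] : Fin 3 → ℂ) + ((![_, _, _] + 0) + 0) = _
    funext b
    fin_cases b <;> simp
  · rw [vtxG, if_neg neg_one_ne_one_units]
    change (![_, _, _] : Fin 3 → ℂ) + ((![_, _, _] + 0) + -0) = _
    funext b
    fin_cases b <;> simp

theorem vtxG_zpow (h k : ℂ) (s a : ℤˣ) :
    (vtxG h k s a).zpow = ![(s : ℤ) / k, (s : ℤ) / k, 0] := by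
  rcases units_cases s with rfl | rfl
  · rw [vtxG, if_pos rfl]
    change (![_, _, _] : Fin 3 → ℂ) + ((![_, _, _] + 0) + 0) = _
    funext b
    fin_cases b <;> simp
  · rw [vtxG, if_neg neg_one_ne_one_units]
    change (![_, _, _] : Fin 3 → ℂ) + ((![_, _, _] + 0) + -0) = _
    funext b
    fin_cases b <;> simp

theorem mul_qpow (A B : Vertex) (b : Fin 3) : (A * B).qpow b = A.qpow b + B.qpow b := rfl

theorem mul_zpow (A B : Vertex) (b : Fin 3) : (A * B).zpow b = A.zpow b + B.zpow b := rfl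

theorem inv_qpow (A : Vertex) (b : Fin 3) : (A⁻¹).qpow b = -A.qpow b := rfl

theorem inv_zpow (A : Vertex) (b : Fin 3) : (A⁻¹).zpow b = -A.zpow b := rfl

theorem inv_coef (A : Vertex) (b : Fin 3) (m : ℤ) : (A⁻¹).coef b m = -A.coef b m := rfl

theorem vtxG_qpow (h k : ℂ) (s a : ℤˣ) : (vtxG h k s a).qpow =
    ![-(k + 2) / k, -(3 * k + 4) / 2 / k - (a : ℤ) / 2, -(s : ℤ) * (a : ℤ) / 2] := by
  rcases units_cases s with rfl | rfl
  · rw [vtxG, if_pos rfl]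
    funext b
    fin_cases b <;>
      simp [mul_qpow, mul_zpow, Vertex.dilate, vtxE, vtxV, vtxY, vtxZ, vtxW] <;> ring
  · rw [vtxG, if_neg neg_one_ne_one_units]
    funext b
    fin_cases b <;>
      simp [mul_qpow, mul_zpow, inv_qpow, inv_zpow, Vertex.dilate, vtxF, vtxV, vtxY, vtxZ,
        vtxW] <;> ring

/-- The exponents which occur in the coefficients of `vtxG`, in terms of `q ^ (k n / 2)` and
`q ^ n`. -/
theorem qp_exponents (h k t : ℂ) :
    qp h ((3 * k + 4) / 2 * t) = qp h (k / 2 * t) ^ 3 * qp h t ^ 2 ∧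
    qp h ((k + 2) / 2 * t) = qp h (k / 2 * t) * qp h t ∧
    qp h ((k + 2) * t) = qp h (k / 2 * t) ^ 2 * qp h t ^ 2 ∧
    qp h ((2 * k + 3) * t) = qp h (k / 2 * t) ^ 4 * qp h t ^ 3 ∧
    qp h ((2 * k + 2) * t) = qp h (k / 2 * t) ^ 4 * qp h t ^ 2 ∧
    qp h ((k + 1) * t) = qp h (k / 2 * t) ^ 2 * qp h t ∧
    qp h ((-2 + -k) * t) = (qp h (k / 2 * t) ^ 2 * qp h t ^ 2)⁻¹ := by
  refine ⟨?_, ?_, ?_, ?_, ?_, ?_, ?_⟩ <;>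
    simp only [← qp_mul_natCast, ← qp_add, ← qp_neg] <;> congr 1 <;> push_cast <;> ring

/-- The coefficients of the vertex operators `vtxG` in the annihilation part. -/
theorem vtxG_coef_pos (h k : ℂ) (s a : ℤˣ) {n : ℕ} (hn : 0 < n) (b : Fin 3) :
    (vtxG h k s a).coef b (n : ℤ) =
      ![-(s : ℤ) * qp h ((s : ℤ) * ((k + 2) * n)) / qn h (k * n),
        -(s : ℤ) * qp h ((s : ℤ) * ((k + 2) * n)) / qn h (k * n) -
          (if a = 1 then qq h * (qn h n / qn h (2 * n)) * qp h ((s : ℤ) * ((2 * k + 3) * n))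
            else 0),
        if a = 1 then -(s : ℤ) * (qq h * (qn h n / qn h (2 * n))) *
          qp h ((s : ℤ) * ((2 * k + 2) * n)) else 0] b := by
  have hn0 : 0 < (n : ℤ) := by exact_mod_cast hn
  have hn1 : ¬ (n : ℤ) < 0 := by omega
  obtain ⟨e1, e2, e3, e4, e5, -, e7⟩ := qp_exponents h k n
  have hw := qp_ne_zero h (k / 2 * n)
  have hx := qp_ne_zero h n
  rcases units_cases s with rfl | rfl <;> rcases units_cases a with rfl | rfl <;>
  simp only [vtxG, if_true, if_neg neg_one_ne_one_units, vtxE, vtxF, vtxV, vtxY, vtxZ, vtxW,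
    Vertex.mul_coef, inv_coef, Vertex.dilate, abs_of_pos hn0, Units.val_one, Units.val_neg,
    one_mul, neg_one_mul, neg_pos, hn0, hn1, if_false] <;>
  fin_cases b <;> simp <;>
  generalize qq h * (qn h n / qn h (2 * n)) = r <;>
  simp only [qp_neg, e1, e2, e3, e4, e5, e7, div_eq_mul_inv _ (qn h (k * n))] <;>
  generalize (qn h (k * n))⁻¹ = c <;> field_simp <;> ring

/-- The coefficients of the vertex operators `vtxG` in the creation part. -/
theorem vtxG_coef_neg (h k : ℂ) (s a : ℤˣ) {n : ℕ} (hn : 0 < n) (b : Fin 3) :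
    (vtxG h k s a).coef b (-(n : ℤ)) =
      ![(s : ℤ) * qp h (-((s : ℤ) * ((k + 2) * n))) / qn h (k * n),
        (s : ℤ) * qp h (-((s : ℤ) * ((2 * k + 2) * n))) / qn h (k * n) +
          (if a = 1 then 0
            else qq h * (qn h n / qn h (2 * n)) * qp h (-((s : ℤ) * ((k + 1) * n)))),
        if a = 1 then 0 else (s : ℤ) * (qq h * (qn h n / qn h (2 * n))) *
          qp h (-((s : ℤ) * ((k + 2) * n)))] b := by
  have hn0 : 0 < (n : ℤ) := by exact_mod_cast hn
  have hn1 : ¬ (n : ℤ) < 0 := by omega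
  obtain ⟨e1, e2, e3, -, e6, e7⟩ := qp_exponents h k n
  have hw := qp_ne_zero h (k / 2 * n)
  have hx := qp_ne_zero h n
  have q1 : qn h (k * -(n : ℂ)) = -qn h (k * n) := by rw [mul_neg, qn_neg]
  have q2 : qn h (2 * -(n : ℂ)) = -qn h (2 * n) := by rw [mul_neg, qn_neg]
  rcases units_cases s with rfl | rfl <;> rcases units_cases a with rfl | rfl <;>
  simp only [vtxG, if_true, if_neg neg_one_ne_one_units, vtxE, vtxF, vtxV, vtxY, vtxZ, vtxW,
    Vertex.mul_coef, inv_coef, Vertex.dilate, abs_neg, abs_of_pos hn0, Units.val_one,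
    Units.val_neg, one_mul, neg_one_mul, neg_neg, neg_pos, hn1, if_false, Int.cast_neg,
    Int.cast_natCast, q1, q2, qn_neg, neg_div_neg_eq] <;>
  fin_cases b <;> simp [hn] <;>
  generalize qq h * (qn h n / qn h (2 * n)) = r <;>
  simp only [qp_neg, e1, e2, e3, e6, e7, div_neg,
    div_eq_mul_inv _ (qn h (k * n))] <;>
  generalize (qn h (k * n))⁻¹ = c <;> field_simp

open PowerSeries Vertex

theorem qq_ne_zero {h k : ℂ} (hg : Generic h k) : qq h ≠ 0 := by
  intro h0
  apply hg.1 2 two_pos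
  rw [qq, sub_eq_zero] at h0
  rw [show ((2 : ℕ) : ℂ) = 1 + 1 by norm_num, qp_add]
  nth_rewrite 2 [h0]
  rw [← qp_add]
  norm_num [qp_zero]

theorem qp_exponents' (h k t : ℂ) :
    qp h ((k + 2) * t) = qp h (k * t) * qp h t ^ 2 ∧
    qp h ((k + 1) * t) = qp h (k * t) * qp h t ∧
    qp h ((2 * k + 2) * t) = qp h (k * t) ^ 2 * qp h t ^ 2 ∧
    qp h ((2 * k + 3) * t) = qp h (k * t) ^ 2 * qp h t ^ 3 ∧
    qp h ((2 * k + 4) * t) = qp h (k * t) ^ 2 * qp h t ^ 4 ∧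
    qp h ((4 * k + 4) * t) = qp h (k * t) ^ 4 * qp h t ^ 4 ∧
    qp h ((4 * k + 6) * t) = qp h (k * t) ^ 4 * qp h t ^ 6 ∧
    qp h (2 * t) = qp h t ^ 2 := by
  refine ⟨?_, ?_, ?_, ?_, ?_, ?_, ?_, ?_⟩ <;>
    simp only [← qp_mul_natCast, ← qp_add] <;> congr 1 <;> push_cast <;> ring

/-- The nonvanishing statements needed for the contractions. -/
theorem generic_natCast {h k : ℂ} (hg : Generic h k) {n : ℕ} (hn : 0 < n) :
    qp h n ^ 2 - 1 ≠ 0 ∧ qp h n ^ 2 + 1 ≠ 0 ∧ qp h (k * n) ^ 2 - 1 ≠ 0 := by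
  have h2 := hg.1 (n * 2) (by omega)
  have h4 := hg.1 (n * 4) (by omega)
  have hk := hg.2.1 (n * 2) (by omega)
  push_cast at h2 h4 hk
  rw [show ((2 : ℂ)) = (2 : ℕ) by norm_num, qp_mul_natCast] at h2
  rw [show ((4 : ℂ)) = (4 : ℕ) by norm_num, qp_mul_natCast] at h4
  rw [← mul_assoc, show ((2 : ℂ)) = (2 : ℕ) by norm_num, qp_mul_natCast] at hk
  exact ⟨fun h0 => h2 (by linear_combination h0),
    fun h0 => h4 (by linear_combination (qp h n ^ 2 - 1) * h0),
    fun h0 => hk (by linear_combination h0)⟩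

theorem coeff_logSeries_qp (h u : ℂ) (n : ℕ) :
    coeff n (logSeries (qp h u)) = qp h (u * n) / n := by
  rw [logSeries, coeff_mk, qp_mul_natCast]

theorem qn_exponents (h k t : ℂ) :
    qn h t = (qp h t ^ 2 - 1) / (qp h t * qq h) ∧
    qn h (2 * t) = (qp h t ^ 2 - 1) * (qp h t ^ 2 + 1) / (qp h t ^ 2 * qq h) ∧
    qn h (k * t) = (qp h (k * t) ^ 2 - 1) / (qp h (k * t) * qq h) ∧
    qn h ((k + 2) * t) =
      (qp h (k * t) ^ 2 * qp h t ^ 4 - 1) / (qp h (k * t) * qp h t ^ 2 * qq h) := by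
  have hx := qp_ne_zero h t
  have hy := qp_ne_zero h (k * t)
  obtain ⟨e1, -, -, -, -, -, -, e2⟩ := qp_exponents' h k t
  simp only [qn, qp_neg, e1, e2]
  by_cases hq : qq h = 0
  · simp [hq]
  · refine ⟨?_, ?_, ?_, ?_⟩ <;> field_simp
    ring

theorem coeff_pairing_vtxG (h k : ℂ) (s t a b : ℤˣ) {n : ℕ} (hn : 0 < n) :
    coeff n (pairing h k (vtxG h k s a) (vtxG h k t b)) =
      (-(s : ℤ) * qp h ((s : ℤ) * ((k + 2) * n)) / qn h (k * n)) *
        ((t : ℤ) * qp h (-((t : ℤ) * ((k + 2) * n))) / qn h (k * n)) *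
        (qn h ((k + 2) * n) * qn h (k * n) / n) +
      (-(s : ℤ) * qp h ((s : ℤ) * ((k + 2) * n)) / qn h (k * n) -
          (if a = 1 then qq h * (qn h n / qn h (2 * n)) * qp h ((s : ℤ) * ((2 * k + 3) * n))
            else 0)) *
        ((t : ℤ) * qp h (-((t : ℤ) * ((2 * k + 2) * n))) / qn h (k * n) +
          (if b = 1 then 0
            else qq h * (qn h n / qn h (2 * n)) * qp h (-((t : ℤ) * ((k + 1) * n))))) *
        (-(qn h (2 * n) * qn h (k * n) / n)) +
      (if a = 1 then -(s : ℤ) * (qq h * (qn h n / qn h (2 * n))) *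
          qp h ((s : ℤ) * ((2 * k + 2) * n)) else 0) *
        (if b = 1 then 0 else (t : ℤ) * (qq h * (qn h n / qn h (2 * n))) *
          qp h (-((t : ℤ) * ((k + 2) * n)))) * (qn h (2 * n) * qn h ((k + 2) * n) / n) := by
  rw [pairing, coeff_mk, Fin.sum_univ_three]
  simp only [vtxG_coef_pos h k s a hn, vtxG_coef_neg h k t b hn, bracket, Matrix.cons_val]

theorem coeff_zero_pairing_eq {h k : ℂ} {A B : Vertex} {S : PowerSeries ℂ}
    (hS : coeff 0 S = 0) (hn : ∀ n : ℕ, 0 < n → coeff n (pairing h k A B) = coeff n S) :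
    pairing h k A B = S := by
  ext n
  rcases Nat.eq_zero_or_pos n with rfl | h0
  · rw [coeff_zero_pairing, hS]
  · exact hn n h0

/-- In each of the eight sign cases this is a rational identity in q^n and q^(kn); genericity keeps
[2n] and [kn] away from zero. -/
theorem pairing_vtxG_same {h k : ℂ} (hg : Generic h k) (s a b : ℤˣ) :
    pairing h k (vtxG h k s a) (vtxG h k s b) =
      -logSeries (qp h ((s : ℤ) * (((b : ℤ) - (a : ℤ) : ℤ) : ℂ))) := by
  refine coeff_zero_pairing_eq (by rw [map_neg, coeff_zero_logSeries, neg_zero]) fun n hn => ?_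
  have hq := qq_ne_zero hg
  obtain ⟨h1, h2, h3⟩ := generic_natCast hg hn
  have hx := qp_ne_zero h n
  have hy := qp_ne_zero h (k * n)
  have hn0 : (n : ℂ) ≠ 0 := by exact_mod_cast hn.ne'
  obtain ⟨q1, q2, q3, q4⟩ := qn_exponents h k n
  obtain ⟨e1, e2, e3, e4, e5, e6, e7, e8⟩ := qp_exponents' h k n
  rw [coeff_pairing_vtxG h k s s a b hn, map_neg, coeff_logSeries_qp]
  simp only [q1, q2, q3, q4]
  rcases units_cases s with rfl | rfl <;> rcases units_cases a with rfl | rfl <;>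
    rcases units_cases b with rfl | rfl <;>
    simp only [if_true, if_neg neg_one_ne_one_units, Units.val_one, Units.val_neg, Int.cast_one,
      Int.cast_neg, one_mul, neg_mul, neg_neg, sub_self, sub_neg_eq_add, Int.cast_zero, zero_mul,
      qp_zero, Int.reduceAdd, Int.reduceSub, Int.reduceNeg, Int.cast_ofNat, qp_neg,
      e1, e2, e3, e4, e8, mul_zero, add_zero, sub_zero] <;>
    field_simp <;> ring

/-- A single zero and no pole: together with the zero mode factor z it becomes an antisymmetric
linear form in z and w, which makes the operators fermionic. -/
theorem contraction_vtxG_same {h k : ℂ} (hg : Generic h k) (s a b : ℤˣ) :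
    contraction h k (vtxG h k s a) (vtxG h k s b) =
      lin (qp h ((s : ℤ) * (((b : ℤ) - (a : ℤ) : ℤ) : ℂ))) := by
  rw [contraction, pairing_vtxG_same hg, expSeries_neg_logSeries]

/-- The contraction functions of `vtxG h k s a` and `vtxG h k (-s) b`. -/
def oppSeries (h k : ℂ) (s a b : ℤˣ) : PowerSeries ℂ :=
  if a = 1 then
    if b = 1 then lin (qp h ((s : ℤ) * (4 * k + 6))) * geom (qp h ((s : ℤ) * (2 * k + 2))) *
      geom (qp h ((s : ℤ) * (4 * k + 4)))
    else geom (qp h ((s : ℤ) * (2 * k + 2)))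
  else
    if b = 1 then geom (qp h ((s : ℤ) * (2 * k + 2)))
    else geom (qp h ((s : ℤ) * (2 * k + 4)))

/-- The poles determine the G^+G^- relation: q^(2k+2), present unless both labels are -1, is where T
arises, q^(4k+4) for labels 1, 1 gives K, and q^(2k+4) for labels -1, -1 gives the constant. -/
theorem contraction_vtxG_opp {h k : ℂ} (hg : Generic h k) (s a b : ℤˣ) :
    contraction h k (vtxG h k s a) (vtxG h k (-s) b) = oppSeries h k s a b := by
  have hpair : pairing h k (vtxG h k s a) (vtxG h k (-s) b) =
      if a = 1 then
        if b = 1 then -logSeries (qp h ((s : ℤ) * (4 * k + 6))) +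
          logSeries (qp h ((s : ℤ) * (2 * k + 2))) + logSeries (qp h ((s : ℤ) * (4 * k + 4)))
        else logSeries (qp h ((s : ℤ) * (2 * k + 2)))
      else
        if b = 1 then logSeries (qp h ((s : ℤ) * (2 * k + 2)))
        else logSeries (qp h ((s : ℤ) * (2 * k + 4))) := by
    refine coeff_zero_pairing_eq ?_ fun n hn => ?_
    · split_ifs <;> simp only [map_add, map_neg, coeff_zero_logSeries, neg_zero, add_zero]
    have hq := qq_ne_zero hg
    obtain ⟨h1, h2, h3⟩ := generic_natCast hg hn
    have hx := qp_ne_zero h n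
    have hy := qp_ne_zero h (k * n)
    have hn0 : (n : ℂ) ≠ 0 := by exact_mod_cast hn.ne'
    obtain ⟨q1, q2, q3, q4⟩ := qn_exponents h k n
    obtain ⟨e1, e2, e3, e4, e5, e6, e7, e8⟩ := qp_exponents' h k n
    rw [coeff_pairing_vtxG h k s (-s) a b hn]
    simp only [q1, q2, q3, q4]
    rcases units_cases s with rfl | rfl <;> rcases units_cases a with rfl | rfl <;>
      rcases units_cases b with rfl | rfl <;>
      simp only [if_true, if_neg neg_one_ne_one_units, Units.val_one, Units.val_neg, Int.cast_one,
        Int.cast_neg, one_mul, neg_mul, neg_neg, map_neg, map_add, coeff_logSeries_qp] <;>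
      simp only [qp_neg, e1, e2, e3, e4, e5, e6, e7, mul_zero, add_zero, sub_zero] <;>
      field_simp <;> ring
  have h0 := coeff_zero_logSeries
  rw [contraction, hpair, oppSeries]
  split_ifs
  · rw [expSeries_add_comm (by rw [map_add, map_neg, h0, h0]; simp) (h0 _),
      expSeries_add_comm (by rw [map_neg, h0, neg_zero]) (h0 _), expSeries_neg_logSeries,
      expSeries_logSeries, expSeries_logSeries]
  all_goals rw [expSeries_logSeries]

theorem vtxK_coef_natCast (h : ℂ) (s : ℤˣ) {n : ℕ} (hn : 0 < n) (b : Fin 3) :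
    (vtxK h s).coef b (n : ℤ) = if s = 1 then ![qq h, 0, 0] b else 0 := by
  rcases units_cases s with rfl | rfl <;> simp [vtxK, hn]

theorem vtxK_coef_neg_natCast (h : ℂ) (s : ℤˣ) {n : ℕ} (hn : 0 < n) (b : Fin 3) :
    (vtxK h s).coef b (-(n : ℤ)) = if s = 1 then 0 else ![qq h, 0, 0] b := by
  rcases units_cases s with rfl | rfl <;> simp [vtxK, hn]

/-- K^- has no annihilation part. Hence K^- on the left contracts trivially with everything, and the
rational function in its relations is the inverse of the contraction in the other order. -/
theorem contraction_vtxK_neg_left (h k : ℂ) (B : Vertex) :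
    contraction h k (vtxK h (-1)) B = 1 := by
  refine contraction_eq_one_left h k _ _ fun b m => ?_
  simp [vtxK]

theorem contraction_vtxK_one_right (h k : ℂ) (A : Vertex) :
    contraction h k A (vtxK h 1) = 1 := by
  refine contraction_eq_one_right h k _ _ fun b m => ?_
  simp [vtxK]

/-- Only α̃ enters K, and the α̃-part of `vtxG` does not depend on the label `a`. Thus the exchange
relation is the same for both summands of G. -/
theorem contraction_vtxK_vtxG {h k : ℂ} (hg : Generic h k) (s a : ℤˣ) :
    contraction h k (vtxK h 1) (vtxG h k s a) =
      geom 1 * lin (qp h (-((s : ℤ) * (2 * (k + 2))))) := by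
  have h0 := coeff_zero_logSeries
  have hpair : pairing h k (vtxK h 1) (vtxG h k s a) =
      logSeries (qp h 0) + -logSeries (qp h (-((s : ℤ) * (2 * (k + 2))))) := by
    refine coeff_zero_pairing_eq (by rw [map_add, map_neg, h0, h0]; simp) fun n hn => ?_
    have hq := qq_ne_zero hg
    obtain ⟨h1, h2, h3⟩ := generic_natCast hg hn
    have hx := qp_ne_zero h n
    have hy := qp_ne_zero h (k * n)
    have hn0 : (n : ℂ) ≠ 0 := by exact_mod_cast hn.ne'
    obtain ⟨q1, q2, q3, q4⟩ := qn_exponents h k n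
    obtain ⟨e1, e2, e3, e4, e5, e6, e7, e8⟩ := qp_exponents' h k n
    rw [pairing, coeff_mk, Fin.sum_univ_three, map_add, map_neg, coeff_logSeries_qp,
      coeff_logSeries_qp]
    simp only [vtxK_coef_natCast h 1 hn, vtxG_coef_neg h k s a hn, bracket, Matrix.cons_val, q1,
      q2, q3, q4, if_true, zero_mul, add_zero, qp_zero, show (2 * (k + 2)) = 2 * k + 4 by ring]
    rcases units_cases s with rfl | rfl <;>
    simp only [Units.val_one, Units.val_neg, Int.cast_one, Int.cast_neg, one_mul, neg_mul,
      neg_neg, qp_neg, e1, e5] <;> field_simp <;> ring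
  rw [contraction, hpair, expSeries_add_comm (h0 _) (by rw [map_neg, h0, neg_zero]),
    expSeries_neg_logSeries, expSeries_logSeries, qp_zero]

theorem contraction_vtxG_vtxK {h k : ℂ} (hg : Generic h k) (s a : ℤˣ) :
    contraction h k (vtxG h k s a) (vtxK h (-1)) =
      geom 1 * lin (qp h ((s : ℤ) * (2 * (k + 2)))) := by
  have h0 := coeff_zero_logSeries
  have hpair : pairing h k (vtxG h k s a) (vtxK h (-1)) =
      logSeries (qp h 0) + -logSeries (qp h ((s : ℤ) * (2 * (k + 2)))) := by
    refine coeff_zero_pairing_eq (by rw [map_add, map_neg, h0, h0]; simp) fun n hn => ?_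
    have hq := qq_ne_zero hg
    obtain ⟨h1, h2, h3⟩ := generic_natCast hg hn
    have hx := qp_ne_zero h n
    have hy := qp_ne_zero h (k * n)
    have hn0 : (n : ℂ) ≠ 0 := by exact_mod_cast hn.ne'
    obtain ⟨q1, q2, q3, q4⟩ := qn_exponents h k n
    obtain ⟨e1, e2, e3, e4, e5, e6, e7, e8⟩ := qp_exponents' h k n
    rw [pairing, coeff_mk, Fin.sum_univ_three, map_add, map_neg, coeff_logSeries_qp,
      coeff_logSeries_qp]
    simp only [vtxK_coef_neg_natCast h (-1) hn, if_neg neg_one_ne_one_units,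
      vtxG_coef_pos h k s a hn, bracket, Matrix.cons_val, q1,
      q2, q3, q4, mul_zero, zero_mul, add_zero, qp_zero,
      show (2 * (k + 2)) = 2 * k + 4 by ring]
    rcases units_cases s with rfl | rfl <;>
    simp only [Units.val_one, Units.val_neg, Int.cast_one, Int.cast_neg, one_mul, neg_mul,
      neg_neg, qp_neg, e1, e5] <;> field_simp <;> ring
  rw [contraction, hpair, expSeries_add_comm (h0 _) (by rw [map_neg, h0, neg_zero]),
    expSeries_neg_logSeries, expSeries_logSeries, qp_zero]

theorem contraction_vtxK_vtxK {h k : ℂ} (hg : Generic h k) :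
    contraction h k (vtxK h 1) (vtxK h (-1)) = geom (qp h (2 * k + 2)) *
      geom (qp h (-(2 * k + 2))) * (lin (qp h 2) * lin (qp h (-2))) := by
  have h0 := coeff_zero_logSeries
  have hpair : pairing h k (vtxK h 1) (vtxK h (-1)) =
      (logSeries (qp h (2 * k + 2)) + logSeries (qp h (-(2 * k + 2)))) +
        (-logSeries (qp h 2) + -logSeries (qp h (-2))) := by
    refine coeff_zero_pairing_eq (by simp only [map_add, map_neg, h0]; simp) fun n hn => ?_
    have hq := qq_ne_zero hg
    have hx := qp_ne_zero h n
    have hy := qp_ne_zero h (k * n)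
    have hn0 : (n : ℂ) ≠ 0 := by exact_mod_cast hn.ne'
    obtain ⟨q1, q2, q3, q4⟩ := qn_exponents h k n
    obtain ⟨e1, e2, e3, e4, e5, e6, e7, e8⟩ := qp_exponents' h k n
    rw [pairing, coeff_mk, Fin.sum_univ_three]
    simp only [map_add, map_neg, coeff_logSeries_qp, vtxK_coef_natCast h 1 hn,
      vtxK_coef_neg_natCast h (-1) hn, if_neg neg_one_ne_one_units, bracket, Matrix.cons_val,
      q3, q4, if_true, mul_zero, zero_mul, add_zero]
    simp only [neg_mul, qp_neg, e3, e8]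
    field_simp
    ring
  have h1 : ∀ a, coeff 0 (-logSeries a) = 0 := fun a => by rw [map_neg, h0, neg_zero]
  rw [contraction, hpair, expSeries_add_comm (by rw [map_add, h0, h0, add_zero])
    (by rw [map_add, h1, h1, add_zero]), expSeries_add_comm (h0 _) (h0 _),
    expSeries_add_comm (h1 _) (h1 _)]
  simp only [expSeries_neg_logSeries, expSeries_logSeries]

/-- T is built from G^+ and G^- at points with ratio q^(2k+2). All data of T, its contractions as
well as its zero modes, are deduced from those of `vtxG` by this factorization. -/
theorem vtxT_eq (h k : ℂ) (a b : ℤˣ) : vtxT h k a b =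
    (vtxG h k 1 a).dilate h (k + 1) * (vtxG h k (-1) b).dilate h (-(k + 1)) := by
  rw [vtxT, vtxG, vtxG, if_pos rfl, if_neg neg_one_ne_one_units, dilate_mul, dilate_mul,
    dilate_dilate, dilate_dilate, dilate_dilate, dilate_dilate,
    show -(k + 2) + (k + 1) = -1 by ring, show -((3 * k + 4) / 2) + (k + 1) = -((k + 2) / 2) by ring,
    show k + 2 + -(k + 1) = 1 by ring, show (3 * k + 4) / 2 + -(k + 1) = (k + 2) / 2 by ring]
  exact mul_mul_mul_comm _ _ _ _

theorem k_ne_zero {h k : ℂ} (hg : Generic h k) : k ≠ 0 := by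
  rintro rfl
  exact hg.2.1 1 one_pos (by rw [zero_mul, qp_zero])

theorem mul_shift (A B : Vertex) : (A * B).shift = A.shift + B.shift := rfl

theorem vtxT_shift (h k : ℂ) (a b : ℤˣ) : (vtxT h k a b).shift = 0 := by
  rw [vtxT_eq]
  change (vtxG h k 1 a).shift + (vtxG h k (-1) b).shift = 0
  rw [vtxG_shift, vtxG_shift]
  funext i
  fin_cases i <;> simp

theorem vtxT_zpow (h k : ℂ) (a b : ℤˣ) : (vtxT h k a b).zpow = 0 := by
  rw [vtxT_eq]
  change (vtxG h k 1 a).zpow + (vtxG h k (-1) b).zpow = 0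
  rw [vtxG_zpow, vtxG_zpow]
  funext i
  fin_cases i <;> simp [neg_div]

/-- α̃ contributes (k+2)/k and ᾱ contributes -2/k, so the relative zero mode factor is z or z⁻¹. Its
integrality allows it to combine with the rational contraction. -/
theorem dot_vtxG_zpow_shift {k : ℂ} (hk : k ≠ 0) (h : ℂ) (s t a b : ℤˣ) :
    dot (vtxG h k s a).zpow (vtxG h k t b).shift = ((s * t : ℤˣ) : ℤ) := by
  rw [dot_eq, vtxG_zpow, vtxG_shift]
  simp only [Matrix.cons_val, Units.val_mul, Int.cast_mul]
  field_simp
  ring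

theorem dot_vtxG_qpow_shift {k : ℂ} (hk : k ≠ 0) (h : ℂ) (s t a b : ℤˣ) :
    dot (vtxG h k s a).qpow (vtxG h k t b).shift = (t : ℤ) * ((a : ℤ) - (k + 1)) := by
  rw [dot_eq, vtxG_qpow, vtxG_shift]
  simp only [Matrix.cons_val]
  field_simp
  ring

theorem dot_vtxT_qpow_shift {k : ℂ} (hk : k ≠ 0) (h : ℂ) (s a b c : ℤˣ) :
    dot (vtxT h k a b).qpow (vtxG h k s c).shift = (s : ℤ) * ((a : ℤ) + (b : ℤ)) := by
  rw [vtxT_eq]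
  change dot (((vtxG h k 1 a).dilate h (k + 1)).qpow + ((vtxG h k (-1) b).dilate h _).qpow) _ = _
  rw [dot_add_left, dot_qpow_dilate, dot_qpow_dilate, dot_vtxG_qpow_shift hk,
    dot_vtxG_qpow_shift hk, dot_vtxG_zpow_shift hk, dot_vtxG_zpow_shift hk]
  simp only [Units.val_mul, Units.val_one, Units.val_neg, Int.cast_mul, Int.cast_neg, Int.cast_one]
  ring

theorem dot_vtxK_qpow_vtxG_shift (h k : ℂ) (s t a : ℤˣ) :
    dot (vtxK h s).qpow (vtxG h k t a).shift = (t : ℤ) * (k + 2) := by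
  rw [dot_eq, vtxG_shift]
  simp [vtxK]

theorem vtxG_coef_zero (h k : ℂ) (s a : ℤˣ) (b : Fin 3) : (vtxG h k s a).coef b 0 = 0 := by
  rcases units_cases s with rfl | rfl
  · rw [vtxG, if_pos rfl]
    fin_cases b <;> simp [mul_coef, dilate, vtxE, vtxV, vtxY, vtxZ, vtxW, qn]
  · rw [vtxG, if_neg neg_one_ne_one_units]
    fin_cases b <;> simp [mul_coef, inv_coef, dilate, vtxF, vtxV, vtxY, vtxZ, vtxW, qn]

theorem vtxK_coef_zero (h : ℂ) (s : ℤˣ) (b : Fin 3) : (vtxK h s).coef b 0 = 0 := by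
  simp [vtxK]

/-- At the ratio q^(4k+4) of the points ᾱ and β cancel, and the α̃-part collapses to that of K^-K^+.
-/
theorem vtxG_one_one_mul {h k : ℂ} (hg : Generic h k) :
    (vtxG h k 1 1).dilate h (2 * k + 2) * (vtxG h k (-1) 1).dilate h (-(2 * k + 2)) =
      vtxK h (-1) * vtxK h 1 := by
  have hk := k_ne_zero hg
  refine ext_iff'.2 ⟨?_, ?_, ?_, ?_⟩
  · rw [mul_shift]
    change (vtxG h k 1 1).shift + (vtxG h k (-1) 1).shift = 0 + 0
    rw [vtxG_shift, vtxG_shift]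
    funext i
    fin_cases i <;> simp
  · change (vtxG h k 1 1).zpow + (vtxG h k (-1) 1).zpow = 0 + 0
    rw [vtxG_zpow, vtxG_zpow]
    funext i
    fin_cases i <;> simp [neg_div]
  · funext i
    rw [mul_qpow, mul_qpow]
    simp only [dilate, vtxG_qpow, vtxG_zpow, vtxK]
    fin_cases i <;> simp <;> field_simp <;> ring
  · funext i m
    rw [mul_coef, mul_coef]
    obtain ⟨n, hm⟩ := m.eq_nat_or_neg
    rcases Nat.eq_zero_or_pos n with rfl | hn
    · obtain rfl : m = 0 := by simpa using hm
      simp [dilate, vtxG_coef_zero, vtxK_coef_zero]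
    have hq := qq_ne_zero hg
    obtain ⟨h1, h2, h3⟩ := generic_natCast hg hn
    have hx := qp_ne_zero h n
    have hy := qp_ne_zero h (k * n)
    obtain ⟨q1, q2, q3, q4⟩ := qn_exponents h k n
    obtain ⟨e1, e2, e3, e4, e5, e6, e7, e8⟩ := qp_exponents' h k n
    rcases hm with rfl | rfl
    · simp only [dilate, vtxG_coef_pos h k _ _ hn, vtxK_coef_natCast h _ hn,
        if_neg neg_one_ne_one_units, if_true, Int.cast_natCast, neg_neg, neg_mul, qp_neg,
        Units.val_one, Units.val_neg, Int.cast_one, Int.cast_neg, one_mul, e1, e3, e4, q1, q2, q3]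
      fin_cases i <;> simp <;> field_simp <;> ring
    · simp only [dilate, vtxG_coef_neg h k _ _ hn, vtxK_coef_neg_natCast h _ hn,
        if_neg neg_one_ne_one_units, if_true, Int.cast_natCast, neg_neg, neg_mul, mul_neg, qp_neg,
        Units.val_one, Units.val_neg, Int.cast_one, Int.cast_neg, one_mul, e1, e3, q3]
      fin_cases i <;> simp <;> field_simp <;> ring

/-- At the ratio q^(2k+4) all three bosons cancel. This is the source of the constant term in the
G^+G^- relation. -/
theorem vtxG_neg_neg_mul {h k : ℂ} (hg : Generic h k) :
    (vtxG h k 1 (-1)).dilate h (k + 2) * (vtxG h k (-1) (-1)).dilate h (-(k + 2)) = 1 := by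
  have hk := k_ne_zero hg
  refine ext_iff'.2 ⟨?_, ?_, ?_, ?_⟩
  · change (vtxG h k 1 (-1)).shift + (vtxG h k (-1) (-1)).shift = 0
    rw [vtxG_shift, vtxG_shift]
    funext i
    fin_cases i <;> simp
  · change (vtxG h k 1 (-1)).zpow + (vtxG h k (-1) (-1)).zpow = 0
    rw [vtxG_zpow, vtxG_zpow]
    funext i
    fin_cases i <;> simp [neg_div]
  · funext i
    rw [mul_qpow]
    change _ = 0
    simp only [dilate, vtxG_qpow, vtxG_zpow]
    fin_cases i <;> simp <;> field_simp <;> ring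
  · funext i m
    rw [mul_coef]
    change _ = 0
    obtain ⟨n, hm⟩ := m.eq_nat_or_neg
    rcases Nat.eq_zero_or_pos n with rfl | hn
    · obtain rfl : m = 0 := by simpa using hm
      simp [dilate, vtxG_coef_zero]
    have hq := qq_ne_zero hg
    obtain ⟨h1, h2, h3⟩ := generic_natCast hg hn
    have hx := qp_ne_zero h n
    have hy := qp_ne_zero h (k * n)
    obtain ⟨q1, q2, q3, q4⟩ := qn_exponents h k n
    obtain ⟨e1, e2, e3, e4, e5, e6, e7, e8⟩ := qp_exponents' h k n
    rcases hm with rfl | rfl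
    · simp only [dilate, vtxG_coef_pos h k _ _ hn,
        if_neg neg_one_ne_one_units, Int.cast_natCast, neg_neg, neg_mul, qp_neg,
        Units.val_one, Units.val_neg, Int.cast_one, Int.cast_neg, one_mul, e1, q3]
      fin_cases i <;> simp <;> field_simp <;> ring
    · simp only [dilate, vtxG_coef_neg h k _ _ hn,
        if_neg neg_one_ne_one_units, Int.cast_natCast, neg_neg, neg_mul, mul_neg, qp_neg,
        Units.val_one, Units.val_neg, Int.cast_one, Int.cast_neg, one_mul, e1, e2, e3, q1, q2, q3]
      fin_cases i <;> simp <;> field_simp <;> ring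

/-! ### Delta functions as differences of two expansions of a rational function. -/

section Pole

/-- The elementary bilateral series `∑_l (q ^ u) ^ l x ^ l`. -/
def qpSeq (h u : ℂ) : ℤ → ℂ := fun l => qp h (u * l)

theorem coeffZ_add (f g : PowerSeries ℂ) (i : ℤ) : coeffZ (f + g) i = coeffZ f i + coeffZ g i := by
  rcases lt_or_ge i 0 with hi | hi
  · simp only [coeffZ_of_neg _ hi, add_zero]
  · lift i to ℕ using hi
    simp only [coeffZ_natCast, map_add]

theorem coeffZ_C (a : ℂ) (i : ℤ) : coeffZ (C a) i = if i = 0 then a else 0 := by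
  rcases lt_or_ge i 0 with hi | hi
  · rw [coeffZ_of_neg _ hi, if_neg (by omega)]
  · lift i to ℕ using hi
    rw [coeffZ_natCast, coeff_C]
    simp

theorem coeffZ_C_mul_geom (h a u : ℂ) (i : ℤ) :
    coeffZ (C a * geom (qp h u)) i = if 0 ≤ i then a * qpSeq h u i else 0 := by
  rcases lt_or_ge i 0 with hi | hi
  · rw [coeffZ_of_neg _ hi, if_neg (by omega)]
  · rw [if_pos hi]
    lift i to ℕ using hi
    rw [coeffZ_natCast, coeff_C_mul, geom, coeff_mk, qpSeq, Int.cast_natCast, qp_mul_natCast]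

theorem qpSeq_neg_neg (h u : ℂ) (i : ℤ) : qpSeq h (-u) (-i) = qpSeq h u i := by
  rw [qpSeq, qpSeq, Int.cast_neg, neg_mul_neg]

theorem qpSeq_add (h u : ℂ) (i j : ℤ) : qpSeq h u (i + j) = qpSeq h u i * qpSeq h u j := by
  rw [qpSeq, qpSeq, qpSeq, ← qp_add, Int.cast_add, mul_add]

theorem qpSeq_zero_right (h u : ℂ) : qpSeq h u 0 = 1 := by
  rw [qpSeq, Int.cast_zero, mul_zero, qp_zero]

/-- The difference of the two expansions of a rational function with simple poles. -/
theorem coeffZ_sub_coeffZ_neg {h κ κ' c r₁ r₂ u₁ u₂ : ℂ} (hc : c ≠ 0)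
    (h0 : κ + r₁ + r₂ = c * κ') {f f' : PowerSeries ℂ}
    (hf : f = C κ + C r₁ * geom (qp h u₁) + C r₂ * geom (qp h u₂))
    (hf' : f' = C κ' + C (-r₁ / c) * geom (qp h (-u₁)) + C (-r₂ / c) * geom (qp h (-u₂))) :
    (fun l => coeffZ f l - c * coeffZ f' (-l)) = r₁ • qpSeq h u₁ + r₂ • qpSeq h u₂ := by
  funext l
  simp only [Pi.add_apply, Pi.smul_apply, smul_eq_mul, hf, hf', coeffZ_add, coeffZ_C,
    coeffZ_C_mul_geom, qpSeq_neg_neg]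
  -- For negative l only f' contributes, for positive l only f. At l = 0 both do, and `h0`, the
  -- agreement of the two constant terms, gives the right value.
  rcases lt_trichotomy l 0 with hl | rfl | hl
  · rw [if_neg (by omega), if_neg (by omega), if_neg (by omega), if_neg (by omega),
      if_pos (by omega), if_pos (by omega)]
    field_simp
    ring
  · simp only [neg_zero, le_refl, if_true, qpSeq_zero_right]
    field_simp
    linear_combination h0
  · rw [if_neg (by omega), if_pos (by omega), if_pos (by omega), if_neg (by omega),
      if_neg (by omega), if_neg (by omega)]
    ring

/-- Partial fractions with one pole. -/
theorem lin_mul_geom_eq {α β κ r : ℂ} (h0 : κ + r = 1) (h1 : α = κ * β) :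
    lin α * geom β = C κ + C r * geom β := by
  have hlin : lin α = C κ * lin β + C r := by
    have e0 := congrArg (C (R := ℂ)) h0
    have e1 := congrArg (C (R := ℂ)) h1
    simp only [map_add, map_mul, map_one] at e0 e1
    simp only [lin]
    linear_combination -e0 - X * e1
  rw [hlin, add_mul, mul_assoc, lin_mul_geom, mul_one]

/-- Partial fractions with two poles. -/
theorem lin_mul_lin_mul_geom_mul_geom_eq {α₁ α₂ β₁ β₂ κ r₁ r₂ : ℂ} (h0 : κ + r₁ + r₂ = 1)
    (h1 : α₁ + α₂ = κ * (β₁ + β₂) + r₁ * β₂ + r₂ * β₁) (h2 : α₁ * α₂ = κ * (β₁ * β₂)) :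
    lin α₁ * lin α₂ * (geom β₁ * geom β₂) = C κ + C r₁ * geom β₁ + C r₂ * geom β₂ := by
  have hlin : lin α₁ * lin α₂ = C κ * (lin β₁ * lin β₂) + C r₁ * lin β₂ + C r₂ * lin β₁ := by
    have e0 := congrArg (C (R := ℂ)) h0
    have e1 := congrArg (C (R := ℂ)) h1
    have e2 := congrArg (C (R := ℂ)) h2
    simp only [map_add, map_mul, map_one] at e0 e1 e2
    simp only [lin]
    linear_combination -e0 - X * e1 + X ^ 2 * e2
  have e1 := lin_mul_geom β₁
  have e2 := lin_mul_geom β₂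
  rw [hlin]
  linear_combination (C κ * lin β₂ * geom β₂ + C r₂ * geom β₂) * e1 + (C κ + C r₁ * geom β₁) * e2

end Pole

/-! ### Exchange relations and commutators in terms of bilocal operators. -/

section Taylor

variable {M : Type*} [AddCommGroup M] [Module ℂ M]

theorem lfSum_add {ι : Type*} {f g : ι → Module.End ℂ M} (hf : PointwiseFinite f)
    (hg : PointwiseFinite g) : PointwiseFinite (f + g) ∧ lfSum (f + g) = lfSum f + lfSum g := by
  have hfg : PointwiseFinite (f + g) := fun v => ((hf v).union (hg v)).subset fun i hi => by
    by_contra h0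
    simp only [Set.mem_union, Set.mem_ofPred_eq, not_or, not_not] at h0
    exact hi (by rw [Pi.add_apply, LinearMap.add_apply, h0.1, h0.2, add_zero])
  refine ⟨hfg, LinearMap.ext fun v => ?_⟩
  rw [LinearMap.add_apply, lfSum_apply hfg, lfSum_apply hf, lfSum_apply hg,
    ← finsum_add_distrib (hf v) (hg v)]
  rfl

theorem lfSum_smul {ι : Type*} {f : ι → Module.End ℂ M} (hf : PointwiseFinite f) (a : ℂ) :
    PointwiseFinite (a • f) ∧ lfSum (a • f) = a • lfSum f := by
  have haf : PointwiseFinite (a • f) := fun v => (hf v).subset fun i hi h0 =>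
    hi (by rw [Pi.smul_apply, LinearMap.smul_apply, h0, smul_zero])
  refine ⟨haf, LinearMap.ext fun v => ?_⟩
  rw [LinearMap.smul_apply, lfSum_apply haf, lfSum_apply hf, smul_finsum]
  rfl

/-- The relation `X(z,w) = c f(z/w) Y(z,w)`, including the finiteness of the sums. -/
def TaylorRel (f : PowerSeries ℂ) (c : ℂ) (X Y : ℂ → ℂ → Module.End ℂ M) : Prop :=
  ∀ m n, PointwiseFinite (taylorTerm f Y m n) ∧ X m n = c • taylorMul f Y m n

variable {f : PowerSeries ℂ} {c : ℂ} {X X' Y Y' : ℂ → ℂ → Module.End ℂ M}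

theorem TaylorRel.add (hX : TaylorRel f c X Y) (hX' : TaylorRel f c X' Y') :
    TaylorRel f c (X + X') (Y + Y') := by
  intro m n
  have e : taylorTerm f (Y + Y') m n = taylorTerm f Y m n + taylorTerm f Y' m n := by
    funext l
    exact smul_add _ _ _
  obtain ⟨h1, h2⟩ := lfSum_add (hX m n).1 (hX' m n).1
  rw [← e] at h1 h2
  refine ⟨h1, ?_⟩
  change X m n + X' m n = c • lfSum _
  rw [h2, smul_add, (hX m n).2, (hX' m n).2]
  rfl

theorem TaylorRel.smul (hX : TaylorRel f c X Y) (a : ℂ) : TaylorRel f c (a • X) (a • Y) := by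
  intro m n
  have e : taylorTerm f (a • Y) m n = a • taylorTerm f Y m n := by
    funext l
    exact smul_comm (coeff l f) a (Y (m + l) (n - l))
  obtain ⟨h1, h2⟩ := lfSum_smul (hX m n).1 a
  rw [← e] at h1 h2
  refine ⟨h1, ?_⟩
  change a • X m n = c • lfSum _
  rw [h2, smul_comm, (hX m n).2]
  rfl

theorem TaylorRel.shift_right (hX : TaylorRel f c X Y) (a : ℂ) :
    TaylorRel f c (fun m n => X m (n + a)) (fun m n => Y m (n + a)) := by
  intro m n
  have e : taylorTerm f (fun m n => Y m (n + a)) m n = taylorTerm f Y m (n + a) := by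
    funext l
    simp only [taylorTerm]
    congr 2
    ring
  change PointwiseFinite (taylorTerm f (fun m n => Y m (n + a)) m n) ∧ X m (n + a) = c • lfSum _
  rw [e]
  exact hX m (n + a)

theorem TaylorRel.shift_left (hX : TaylorRel f c X Y) (a : ℂ) :
    TaylorRel f c (fun m n => X (m + a) n) (fun m n => Y (m + a) n) := by
  intro m n
  have e : taylorTerm f (fun m n => Y (m + a) n) m n = taylorTerm f Y (m + a) n := by
    funext l
    simp only [taylorTerm]
    congr 2
    ring
  change PointwiseFinite (taylorTerm f (fun m n => Y (m + a) n) m n) ∧ X (m + a) n = c • lfSum _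
  rw [e]
  exact hX (m + a) n

theorem TaylorRel.eqOnSpace (hX : TaylorRel f c X Y) (F : Submodule ℂ M) :
    EqOnSpace F X (c • taylorMul f Y) := fun m n v _ => by
  rw [(hX m n).2]
  rfl

end Taylor

namespace Vertex

variable (h k : ℂ) (A B : Vertex)

/-- An exchange relation of vertex operators without relative zero modes in `z`. -/
theorem taylorRel_field {f : PowerSeries ℂ} {c : ℂ} (hAB : contraction h k A B = 1)
    (hf : f * contraction h k B A = 1) (h1 : dot A.zpow B.shift = 0) (h2 : dot B.zpow A.shift = 0)
    (hc : qp h (dot A.qpow B.shift) = c * qp h (dot B.qpow A.shift)) :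
    TaylorRel f c (zw (A.field h k) (B.field h k)) (wz (B.field h k) (A.field h k)) := by
  intro m n
  obtain ⟨h3, h4⟩ := taylorMul_field h k A B f m n
  refine ⟨h3, ?_⟩
  -- The series f cancels the contraction of the reversed order, and both sides become multiples of
  -- the same normal ordered product.
  rw [h4, zw, field_mul_field, hAB, hf, h1, h2, add_zero, add_zero, smul_smul, hc,
    bilocal_swap h k A B]
  congr 2
  funext l
  rw [coeffZ_one, coeffZ_one]
  simp

theorem field_mul_field_comm (hAB : contraction h k A B = 1) (hBA : contraction h k B A = 1)
    (h1 : dot A.zpow B.shift = 0) (h2 : dot B.zpow A.shift = 0)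
    (hc : dot A.qpow B.shift = dot B.qpow A.shift) (m n : ℂ) :
    A.field h k m * B.field h k n = B.field h k n * A.field h k m := by
  rw [field_mul_field, field_mul_field, hAB, hBA, h1, h2, add_zero, add_zero, hc, bilocal_swap]
  congr 2
  funext l
  rw [coeffZ_one, coeffZ_one]
  simp

/-- The commutator of vertex operators without relative zero modes in `z`. -/
theorem field_mul_field_sub {c : ℂ} {D : ℤ → ℂ} (h1 : dot A.zpow B.shift = 0)
    (h2 : dot B.zpow A.shift = 0) (h3 : dot A.qpow B.shift = 0)
    (hc : qp h (dot B.qpow A.shift) = c)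
    (hD : (fun l => coeffZ (contraction h k A B) l - c * coeffZ (contraction h k B A) (-l)) = D)
    (m n : ℂ) : A.field h k m * B.field h k n - B.field h k n * A.field h k m =
      bilocal h k A B D m n := by
  rw [field_mul_field, field_mul_field, h1, h2, h3, hc, qp_zero, one_smul, add_zero, add_zero,
    bilocal_swap h k B A, ← bilocal_smul]
  refine (@sub_eq_iff_eq_add (Module.End ℂ Fock) _ _ _ _).2 ?_
  rw [← bilocal_add, ← hD]
  congr 1
  funext l
  simp

open Classical in
/-- The specialization of `:A(z) B(w):` at `z = q ^ u w` if `A` has no zero modes in `z`. -/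
theorem bilocal_qpSeq_of_zpow (hz : A.zpow = 0) (u m n : ℂ) :
    bilocal h k A B (qpSeq h u) m n =
      if m ∈ Sector.R.modes then qp h (u * m) • (A.dilate h u * B).field h k (m + n) else 0 := by
  refine end_ext fun μ P => ?_
  have hm : m ∈ Sector.R.modes ↔ ∃ i : ℤ, -m - dot A.zpow μ = i := by
    rw [hz, dot_zero_left]
    simp only [Sector.modes, Sector.offset, Set.mem_ofPred_eq, add_zero, sub_zero]
    exact ⟨fun ⟨n, hn⟩ => ⟨-n, by rw [hn, Int.cast_neg]⟩,
      fun ⟨n, hn⟩ => ⟨-n, by rw [Int.cast_neg, ← hn, neg_neg]⟩⟩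
  split_ifs with hmm
  · obtain ⟨i, hi⟩ := hm.1 hmm
    exact bilocal_qp h k A B u n hi P
  · rw [hm] at hmm
    push Not at hmm
    exact bilocal_single_of_ne_left h k A B _ n hmm P

theorem field_one : (1 : Vertex).field h k = oneSeries := by
  have h0 : (1 : Vertex).creation h k = 1 := creation_eq_one h k 1 fun _ _ => rfl
  have h1 : (1 : Vertex).annihilation h k = 1 := annihilation_eq_one h k 1 fun _ _ => rfl
  funext m
  rw [oneSeries]
  split_ifs with hm
  · refine end_ext fun μ P => ?_
    have hi : -m - dot (1 : Vertex).zpow μ = ((0 : ℤ) : ℂ) := by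
      rw [hm, show (1 : Vertex).zpow = 0 from rfl, dot_zero_left]
      simp
    rw [field_single_of_eq h k 1 hi, oscMode_of_creation_eq_one h k 1 h0, ann, h1, neg_zero,
      coeffZ_one, if_pos rfl, show (1 : Vertex).qpow = 0 from rfl,
      show (1 : Vertex).shift = 0 from rfl, dot_zero_left, qp_zero, one_smul, add_zero]
    rfl
  · by_cases hn : ∃ n : ℕ, m = n
    · refine suppNeg_field h k 1 h1 rfl m fun j hj => hm ?_
      obtain ⟨n, rfl⟩ := hn
      have : n + j = 0 := by exact_mod_cast (by rw [hj]; ring : (n : ℂ) + j = 0)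
      simp [show n = 0 by omega]
    · push Not at hn
      exact suppPos_field h k 1 h0 rfl m hn

end Vertex

/-- A product K^-K^+ is a triple product with the constant series in the middle, so `mul₃_field`
covers it as well. -/
theorem mul₃_oneSeries {M : Type*} [AddCommGroup M] [Module ℂ M] {A B : ℂ → Module.End ℂ M}
    (hA : SuppNeg A) (hB : SuppPos B) (ht : Truncated B) (m : ℂ) :
    mul₃ A oneSeries B m = mul₂ A B m := by
  refine LinearMap.ext fun v => ?_
  rw [mul₃, mul₂, lfSum_apply (pointwiseFinite_mulTerm₃ hA truncated_oneSeries hB ht m),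
    lfSum_apply (pointwiseFinite_mulTerm hB ht m)]
  refine (finsum_eq_of_bijOn (fun a => (a, m - a)) (s := Set.univ) (t := {p | p.1 + p.2 = m})
    ⟨fun a _ => ?_, fun a _ b _ hab => ?_, fun p hp => ?_⟩ (fun _ _ => Set.mem_univ _)
    (fun p hp => ?_) (fun a _ => ?_)).symm
  · exact add_sub_cancel a m
  · exact congrArg Prod.fst hab
  · refine ⟨p.1, Set.mem_univ _, ?_⟩
    exact Prod.ext rfl (sub_eq_of_eq_add' (Eq.symm hp))
  · by_contra h0
    refine hp ?_
    rw [mulTerm₃, oneSeries, if_neg, mul_zero, zero_mul, LinearMap.zero_apply]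
    intro h1
    exact h0 (show p.1 + p.2 = m by linear_combination -h1)
  · rw [mulTerm, mulTerm₃, oneSeries, if_pos (by ring), mul_one]

/-! ### Integrality of modes on the Fock space of a sector. -/

/-- The momenta which occur in `fockSpace`. -/
def fockMomentum (k : ℂ) (A : Sector) (ρ σ : ℂ) (n : ℤ) : Momentum :=
  ![A.shift k + ρ + (k + 2) * n, ρ + 2 * n, σ]

section FockSpace

variable {h k : ℂ} {A : Sector} {ρ σ : ℂ}

theorem eq_on_fockSpace {f g : Module.End ℂ Fock}
    (hfg : ∀ n P, f (Finsupp.single (fockMomentum k A ρ σ n) P) =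
      g (Finsupp.single (fockMomentum k A ρ σ n) P)) {v : Fock}
    (hv : v ∈ fockSpace k A ρ σ) : f v = g v := by
  rw [← Finsupp.sum_single v, map_finsuppSum, map_finsuppSum]
  refine Finsupp.sum_congr fun μ hμ => ?_
  obtain ⟨n, rfl⟩ := (Finsupp.mem_supported ℂ v).1 hv hμ
  exact hfg n _

theorem single_mem_fockSpace (n : ℤ) (P : Osc) :
    Finsupp.single (fockMomentum k A ρ σ n) P ∈ fockSpace k A ρ σ :=
  Finsupp.single_mem_supported ℂ _ ⟨n, rfl⟩

theorem field_mem_fockSpace {V : Vertex} {d : ℤ} (hV : V.shift = ![(k + 2) * d, 2 * d, 0])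
    (m : ℂ) {v : Fock} (hv : v ∈ fockSpace k A ρ σ) : V.field h k m v ∈ fockSpace k A ρ σ := by
  rw [← Finsupp.sum_single v, map_finsuppSum]
  refine Submodule.sum_mem _ fun μ hμ => ?_
  obtain ⟨n, rfl⟩ := (Finsupp.mem_supported ℂ v).1 hv hμ
  have : (![A.shift k + ρ + (k + 2) * n, ρ + 2 * n, σ] : Momentum) + V.shift =
      fockMomentum k A ρ σ (n + d) := by
    rw [hV, fockMomentum]
    funext i
    fin_cases i <;> simp <;> ring
  dsimp only
  rw [field_single, this]
  exact single_mem_fockSpace _ _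

/-- On the n-th summand the zero modes give the z-exponent s(θ_A/k + n), integral for NS and
half-integral for R. With the factor z^(1/2) in G this gives the label set ℤ^A, independently of n.
-/
theorem sub_half_mem_modes_iff (hk : k ≠ 0) (s a : ℤˣ) (x : ℂ) (n : ℤ) :
    x - 1 / 2 ∈ A.modes ↔
      ∃ i : ℤ, -x - dot (vtxG h k s a).zpow (fockMomentum k A ρ σ n) = i := by
  have h1 : dot (vtxG h k s a).zpow (fockMomentum k A ρ σ n) =
      (s : ℤ) * (A.shift k / k + n) := by
    rw [dot_eq, vtxG_zpow, fockMomentum]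
    simp only [Matrix.cons_val]
    field_simp
    ring
  rw [h1]
  cases A
  · simp only [Sector.modes, Sector.offset, Sector.shift, Set.mem_ofPred_eq, zero_div, zero_add]
    refine ⟨fun ⟨j, hj⟩ => ⟨-j - 1 - s * n, ?_⟩, fun ⟨i, hi⟩ => ⟨-i - 1 - s * n, ?_⟩⟩
    · push_cast
      linear_combination -hj
    · push_cast
      linear_combination -hi
  · have h2 : k / 2 / k = 1 / 2 := by field_simp
    simp only [Sector.modes, Sector.offset, Sector.shift, Set.mem_ofPred_eq, add_zero, h2]
    rcases units_cases s with rfl | rfl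
    · refine ⟨fun ⟨j, hj⟩ => ⟨-j - 1 - n, ?_⟩, fun ⟨i, hi⟩ => ⟨-i - 1 - n, ?_⟩⟩
      · push_cast [Units.val_one]
        linear_combination -hj
      · push_cast [Units.val_one] at hi ⊢
        linear_combination -hi
    · refine ⟨fun ⟨j, hj⟩ => ⟨-j + n, ?_⟩, fun ⟨i, hi⟩ => ⟨-i + n, ?_⟩⟩
      · push_cast [Units.val_neg, Units.val_one]
        linear_combination -hj
      · push_cast [Units.val_neg, Units.val_one] at hi ⊢
        linear_combination -hi

-- The support condition turns the delta function into δ^A, because on this space the labels of the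
-- G-operators lie in a single coset of ℤ.
open Classical in
theorem bilocal_qpSeq_vtxG (hk : k ≠ 0) (s a : ℤˣ) (B : Vertex) (u x y : ℂ) {v : Fock}
    (hv : v ∈ fockSpace k A ρ σ) : bilocal h k (vtxG h k s a) B (qpSeq h u) x y v =
      if x - 1 / 2 ∈ A.modes then
        qp h (u * x) • ((vtxG h k s a).dilate h u * B).field h k (x + y) v else 0 := by
  split_ifs with hx
  · rw [← LinearMap.smul_apply]
    refine eq_on_fockSpace (fun n P => ?_) hv
    obtain ⟨i, hi⟩ := (sub_half_mem_modes_iff hk s a x n).1 hx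
    exact bilocal_qp h k _ B u y hi P
  · rw [← LinearMap.zero_apply (M := Fock) (σ₁₂ := RingHom.id ℂ) v]
    refine eq_on_fockSpace (fun n P => ?_) hv
    rw [sub_half_mem_modes_iff (h := h) (ρ := ρ) (σ := σ) hk s a x n] at hx
    push Not at hx
    exact bilocal_single_of_ne_left h k _ B _ y hx P

theorem field_vtxG_eq_zero (hk : k ≠ 0) (s a : ℤˣ) {x : ℂ} (hx : x - 1 / 2 ∉ A.modes) {v : Fock}
    (hv : v ∈ fockSpace k A ρ σ) : (vtxG h k s a).field h k x v = 0 := by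
  rw [← LinearMap.zero_apply (M := Fock) (σ₁₂ := RingHom.id ℂ) v]
  refine eq_on_fockSpace (fun n P => ?_) hv
  rw [sub_half_mem_modes_iff (h := h) (ρ := ρ) (σ := σ) hk s a x n] at hx
  push Not at hx
  exact field_single_of_ne h k _ hx P

end FockSpace

theorem field_eq_zero_of_zpow (h k : ℂ) {V : Vertex} (hV : V.zpow = 0) {x : ℂ}
    (hx : ∀ n : ℤ, x ≠ n) : V.field h k x = 0 := by
  refine end_ext fun μ P => ?_
  rw [field_single_of_ne, LinearMap.zero_apply]
  intro i hi
  rw [hV, dot_zero_left, sub_zero] at hi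
  exact hx (-i) (by rw [Int.cast_neg, ← hi, neg_neg])

/-! ### The currents as combinations of vertex operators. -/

section Wakimoto

variable (h k : ℂ)

theorem wakimoto_G (s : ℤˣ) : (wakimoto h k).G s = fun m =>
    ((s : ℤ) / qq h) • (vtxG h k s 1).field h k (m + 1 / 2) +
      (-((s : ℤ) / qq h)) • (vtxG h k s (-1)).field h k (m + 1 / 2) := by
  funext m
  simp only [wakimoto]
  rcases units_cases s with rfl | rfl
  · rw [if_pos rfl, currentGp, currentGp, vtxG, vtxG, if_pos rfl, if_pos rfl, Units.val_one, Int.cast_one]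
    module
  · rw [if_neg neg_one_ne_one_units, currentGm, currentGm, vtxG, vtxG,
      if_neg neg_one_ne_one_units, if_neg neg_one_ne_one_units, Units.val_neg, Units.val_one,
      Int.cast_neg, Int.cast_one, neg_div]
    module

theorem wakimoto_T : (wakimoto h k).T = fun m =>
    qp h (-1) • (vtxT h k 1 (-1)).field h k m +
      (-(qn h (k + 2) / qn h (k + 1))) • (vtxT h k 1 1).field h k m +
      qp h 1 • (vtxT h k (-1) 1).field h k m := by
  funext m
  simp only [wakimoto, currentT]
  module

theorem vtxK_annihilation : (vtxK h (-1)).annihilation h k = 1 :=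
  annihilation_eq_one h k _ fun b m => by simp [vtxK]

theorem vtxK_creation : (vtxK h 1).creation h k = 1 :=
  creation_eq_one h k _ fun b m => by simp [vtxK]

theorem suppNeg_wakimoto : SuppNeg ((wakimoto h k).K (-1)) :=
  suppNeg_field h k _ (vtxK_annihilation h k) rfl

theorem suppPos_wakimoto : SuppPos ((wakimoto h k).K 1) :=
  suppPos_field h k _ (vtxK_creation h k) rfl

theorem truncated_wakimoto_K (s : ℤˣ) : Truncated ((wakimoto h k).K s) := truncated_field h k _

theorem truncated_wakimoto_G (s : ℤˣ) : Truncated ((wakimoto h k).G s) := by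
  rw [wakimoto_G]
  exact (((truncated_field h k _).comp_add _).smul _).add
    (((truncated_field h k _).comp_add _).smul _)

theorem truncated_wakimoto_T : Truncated (wakimoto h k).T := by
  rw [wakimoto_T]
  exact (((truncated_field h k _).smul _).add ((truncated_field h k _).smul _)).add
    ((truncated_field h k _).smul _)

theorem truncated_wakimoto_W (A : Sector) : Truncated ((wakimoto h k).W h k A) :=
  ((((truncated_mul₂ (suppNeg_wakimoto h k) (suppPos_wakimoto h k)
    (truncated_wakimoto_K h k 1)).smul _).sub (truncated_oneSeries.smul _)).add
      ((truncated_wakimoto_T h k).smul _)).sub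
      ((truncated_lfSum_normalTerm _ (truncated_wakimoto_G h k) A).smul _)

theorem wakimoto_KK (m : ℂ) :
    (wakimoto h k).KK m = (vtxK h (-1) * vtxK h 1).field h k m := by
  rw [Currents.KK, ← mul₃_oneSeries (suppNeg_wakimoto h k) (suppPos_wakimoto h k)
    (truncated_wakimoto_K h k 1), ← field_one h k]
  refine (mul₃_field h k (vtxK_annihilation h k) (vtxK_creation h k) rfl rfl rfl rfl m).trans ?_
  rw [show (1 : Vertex).shift = 0 from rfl, dot_zero_right, qp_zero, one_smul, mul_one]

theorem vtxK_field_zero (s : ℤˣ) (μ : Momentum) (P : Osc) :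
    (vtxK h s).field h k 0 (Finsupp.single μ P) = Finsupp.single μ (qp h (μ 0) • P) := by
  have hz : (vtxK h s).zpow = 0 := rfl
  have hi : -0 - dot (vtxK h s).zpow μ = ((0 : ℤ) : ℂ) := by
    rw [hz, dot_zero_left]
    simp
  have hq : dot (vtxK h s).qpow μ = μ 0 := by
    rw [dot_eq]
    simp [vtxK]
  rw [field_single_of_eq h k _ hi, show (vtxK h s).shift = 0 from rfl, add_zero, hq]
  congr 2
  rcases units_cases s with rfl | rfl
  · rw [oscMode_of_creation_eq_one h k _ (vtxK_creation h k), ann, neg_zero, ← Int.natCast_zero,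
      coeffZ_natCast]
    exact congrArg (fun f : Module.End ℂ Osc => f P) (coeff_zero_expSeries _)
  · rw [oscMode_of_annihilation_eq_one h k _ (vtxK_annihilation h k), cre, ← Int.natCast_zero,
      coeffZ_natCast]
    exact congrArg (fun f : Module.End ℂ Osc => f P) (coeff_zero_expSeries _)

theorem vtxK_field_zero_apply (s : ℤˣ) (v : Fock) (μ : Momentum) :
    (vtxK h s).field h k 0 v μ = qp h (μ 0) • v μ := by
  induction v using Finsupp.induction_linear with
  | zero => simp
  | add v w hv hw => rw [map_add, Finsupp.add_apply, hv, hw, Finsupp.add_apply, smul_add]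
  | single ν P =>
    rw [vtxK_field_zero]
    by_cases hν : ν = μ
    · subst hν
      simp
    · simp [hν]

/-- The zero mode is diagonal: on momentum μ it is multiplication by the nonzero number q^(μ 0), so
its inverse is written down on each component. -/
theorem bijOn_vtxK_field_zero (A : Sector) (ρ σ : ℂ) (s : ℤˣ) :
    Set.BijOn ((vtxK h s).field h k 0) (fockSpace k A ρ σ) (fockSpace k A ρ σ) := by
  have hmem : ∀ v, (∀ μ, v μ ≠ 0 → ∃ n : ℤ, μ = ![A.shift k + ρ + (k + 2) * n, ρ + 2 * n, σ]) ↔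
      v ∈ fockSpace k A ρ σ := fun v => by
    rw [fockSpace, Finsupp.mem_supported]
    exact ⟨fun h1 μ hμ => h1 μ (Finsupp.mem_support_iff.1 hμ),
      fun h1 μ hμ => h1 (Finsupp.mem_support_iff.2 hμ)⟩
  refine ⟨fun v hv => ?_, fun v _ w _ hvw => ?_, fun v hv => ?_⟩
  · refine (hmem _).1 fun μ hμ => (hmem v).2 hv μ fun h0 => hμ ?_
    rw [vtxK_field_zero_apply, h0, smul_zero]
  · ext1 μ
    have := DFunLike.congr_fun hvw μ
    rw [vtxK_field_zero_apply, vtxK_field_zero_apply] at this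
    exact smul_right_injective _ (qp_ne_zero h (μ 0)) this
  · refine ⟨Finsupp.ofSupportFinite (fun μ => qp h (-μ 0) • v μ)
      (v.hasFiniteSupport.subset fun μ hμ h0 => hμ ?_), (hmem _).1 fun μ hμ => (hmem v).2 hv μ
        fun h0 => hμ ?_, ?_⟩
    · change qp h (-μ 0) • v μ = 0
      rw [h0, smul_zero]
    · change qp h (-μ 0) • v μ = 0
      rw [h0, smul_zero]
    · ext1 μ
      rw [vtxK_field_zero_apply]
      change qp h (μ 0) • qp h (-μ 0) • v μ = v μ
      rw [smul_smul, ← qp_add, add_neg_cancel, qp_zero, one_smul]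

end Wakimoto

/-! ### Relations with K^±. -/

section CartanRelations

variable {h k : ℂ}

theorem ratio₁_eq (c : ℂ) : ratio₁ c = lin 1 * geom c := by
  rw [ratio₁, inv_lin, lin, map_one, one_mul]

theorem ratio₂_eq (a b c d : ℂ) : ratio₂ a b c d = lin a * lin b * (geom c * geom d) := by
  rw [ratio₂, PowerSeries.mul_inv_rev, inv_lin, inv_lin, mul_comm (geom d)]
  rfl

/-- The contractions of the two G-factors at q^(±(k+1)) are multiplied. The result does not depend
on `a`, `b`, so the exchange relation passes to the combination T. -/
theorem contraction_vtxT_vtxK (hg : Generic h k) (a b : ℤˣ) :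
    contraction h k (vtxT h k a b) (vtxK h (-1)) =
      geom (qp h (k + 1)) * lin (qp h (-(k + 3))) * (geom (qp h (-(k + 1))) * lin (qp h (k + 3))) := by
  rw [vtxT_eq, contraction_mul_left, contraction_dilate_left, contraction_dilate_left,
    contraction_vtxG_vtxK hg, contraction_vtxG_vtxK hg, map_mul, map_mul]
  simp only [rescale_lin, rescale_geom, ← qp_add, mul_one, Units.val_one, Units.val_neg,
    Int.cast_one, Int.cast_neg]
  rw [mul_comm]
  congr 3 <;> congr 1 <;> ring

theorem contraction_vtxK_vtxT (hg : Generic h k) (a b : ℤˣ) :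
    contraction h k (vtxK h 1) (vtxT h k a b) =
      geom (qp h (k + 1)) * lin (qp h (-(k + 3))) * (geom (qp h (-(k + 1))) * lin (qp h (k + 3))) := by
  rw [vtxT_eq, contraction_mul_right, contraction_dilate_right, contraction_dilate_right,
    contraction_vtxK_vtxG hg, contraction_vtxK_vtxG hg, map_mul, map_mul]
  simp only [rescale_lin, rescale_geom, ← qp_add, mul_one, Units.val_one, Units.val_neg,
    Int.cast_one, Int.cast_neg]
  congr 3 <;> congr 1 <;> ring

theorem ratio₁_mul (c : ℂ) : ratio₁ c * (geom 1 * lin c) = 1 := by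
  rw [ratio₁_eq]
  linear_combination (lin c * geom c) * lin_mul_geom 1 + lin_mul_geom c

theorem ratio₂_mul (a b c d : ℂ) : ratio₂ a b c d * (geom a * lin d * (geom b * lin c)) = 1 := by
  rw [ratio₂_eq]
  linear_combination (lin b * geom b * (lin c * geom c) * (lin d * geom d)) * lin_mul_geom a +
    (lin c * geom c * (lin d * geom d)) * lin_mul_geom b + (lin d * geom d) * lin_mul_geom c +
    lin_mul_geom d

theorem wakimoto_rel_KK (s : ℤˣ) (m n : ℂ) : (wakimoto h k).K s m * (wakimoto h k).K s n =
    (wakimoto h k).K s n * (wakimoto h k).K s m := by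
  have h1 : contraction h k (vtxK h s) (vtxK h s) = 1 := by
    rcases units_cases s with rfl | rfl
    · exact contraction_vtxK_one_right h k _
    · exact contraction_vtxK_neg_left h k _
  exact field_mul_field_comm h k _ _ h1 h1 (dot_zero_right _) (dot_zero_right _) rfl m n

theorem wakimoto_taylor_KmKp (hg : Generic h k) : TaylorRel
    (ratio₂ (qp h (2 * k + 2)) (qp h (-(2 * k + 2))) (qp h 2) (qp h (-2))) 1
    (zw ((wakimoto h k).K (-1)) ((wakimoto h k).K 1))
    (wz ((wakimoto h k).K 1) ((wakimoto h k).K (-1))) := by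
  refine taylorRel_field h k _ _ (contraction_vtxK_neg_left h k _) ?_ (dot_zero_right _)
    (dot_zero_right _) (one_mul _).symm
  rw [contraction_vtxK_vtxK hg, ← ratio₂_mul (qp h (2 * k + 2)) (qp h (-(2 * k + 2))) (qp h 2)
    (qp h (-2))]
  ring

theorem wakimoto_taylor_KmT (hg : Generic h k) : TaylorRel
    (ratio₂ (qp h (k + 1)) (qp h (-(k + 1))) (qp h (k + 3)) (qp h (-(k + 3)))) 1
    (zw ((wakimoto h k).K (-1)) (wakimoto h k).T) (wz (wakimoto h k).T ((wakimoto h k).K (-1))) := by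
  have key : ∀ a b, TaylorRel
      (ratio₂ (qp h (k + 1)) (qp h (-(k + 1))) (qp h (k + 3)) (qp h (-(k + 3)))) 1
      (zw ((vtxK h (-1)).field h k) ((vtxT h k a b).field h k))
      (wz ((vtxT h k a b).field h k) ((vtxK h (-1)).field h k)) := fun a b => by
    refine taylorRel_field h k _ _ (contraction_vtxK_neg_left h k _) ?_ ?_ (dot_zero_right _) ?_
    · rw [contraction_vtxT_vtxK hg, ratio₂_mul]
    · rw [vtxT_shift, dot_zero_right]
    · rw [vtxT_shift, dot_zero_right, one_mul]
      exact congrArg (qp h) (dot_zero_right _).symm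
  have := (((key 1 (-1)).smul (qp h (-1))).add
    ((key 1 1).smul (-(qn h (k + 2) / qn h (k + 1))))).add ((key (-1) 1).smul (qp h 1))
  rw [wakimoto_T]
  convert this using 1
  · funext m n
    simp only [zw, wakimoto, Pi.add_apply, Pi.smul_apply, mul_add, mul_smul_comm]
  · funext m n
    simp only [wz, wakimoto, Pi.add_apply, Pi.smul_apply, add_mul, smul_mul_assoc]

theorem wakimoto_taylor_TKp (hg : Generic h k) : TaylorRel
    (ratio₂ (qp h (k + 1)) (qp h (-(k + 1))) (qp h (k + 3)) (qp h (-(k + 3)))) 1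
    (zw (wakimoto h k).T ((wakimoto h k).K 1)) (wz ((wakimoto h k).K 1) (wakimoto h k).T) := by
  have key : ∀ a b, TaylorRel
      (ratio₂ (qp h (k + 1)) (qp h (-(k + 1))) (qp h (k + 3)) (qp h (-(k + 3)))) 1
      (zw ((vtxT h k a b).field h k) ((vtxK h 1).field h k))
      (wz ((vtxK h 1).field h k) ((vtxT h k a b).field h k)) := fun a b => by
    refine taylorRel_field h k _ _ (contraction_vtxK_one_right h k _) ?_ (dot_zero_right _) ?_ ?_
    · rw [contraction_vtxK_vtxT hg, ratio₂_mul]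
    · rw [vtxT_shift, dot_zero_right]
    · rw [vtxT_shift, dot_zero_right, one_mul]
      exact congrArg (qp h) (dot_zero_right _)
  have := (((key 1 (-1)).smul (qp h (-1))).add
    ((key 1 1).smul (-(qn h (k + 2) / qn h (k + 1))))).add ((key (-1) 1).smul (qp h 1))
  rw [wakimoto_T]
  convert this using 1
  · funext m n
    simp only [zw, wakimoto, Pi.add_apply, Pi.smul_apply, add_mul, smul_mul_assoc]
  · funext m n
    simp only [wz, wakimoto, Pi.add_apply, Pi.smul_apply, mul_add, mul_smul_comm]

theorem wakimoto_taylor_KmG (hg : Generic h k) (s : ℤˣ) : TaylorRel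
    (ratio₁ (qp h ((s : ℤ) * (2 * (k + 2))))) (qp h ((s : ℤ) * (k + 2)))
    (zw ((wakimoto h k).K (-1)) ((wakimoto h k).G s))
    (wz ((wakimoto h k).G s) ((wakimoto h k).K (-1))) := by
  have key : ∀ a, TaylorRel (ratio₁ (qp h ((s : ℤ) * (2 * (k + 2))))) (qp h ((s : ℤ) * (k + 2)))
      (zw ((vtxK h (-1)).field h k) ((vtxG h k s a).field h k))
      (wz ((vtxG h k s a).field h k) ((vtxK h (-1)).field h k)) := fun a => by
    refine taylorRel_field h k _ _ (contraction_vtxK_neg_left h k _) ?_ (dot_zero_left _)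
      (dot_zero_right _) ?_
    · rw [contraction_vtxG_vtxK hg, ratio₁_mul]
    · rw [dot_vtxK_qpow_vtxG_shift, show (vtxK h (-1)).shift = 0 from rfl, dot_zero_right, qp_zero,
        mul_one]
  have := (((key 1).shift_right (1 / 2)).smul ((s : ℤ) / qq h)).add
    (((key (-1)).shift_right (1 / 2)).smul (-((s : ℤ) / qq h)))
  rw [wakimoto_G]
  convert this using 1
  · funext m n
    simp only [zw, wakimoto, Pi.add_apply, Pi.smul_apply, mul_add, mul_smul_comm]
  · funext m n
    simp only [wz, wakimoto, Pi.add_apply, Pi.smul_apply, add_mul, smul_mul_assoc]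

theorem wakimoto_taylor_GKp (hg : Generic h k) (s : ℤˣ) : TaylorRel
    (ratio₁ (qp h (-((s : ℤ) * (2 * (k + 2)))))) (qp h (-((s : ℤ) * (k + 2))))
    (zw ((wakimoto h k).G s) ((wakimoto h k).K 1))
    (wz ((wakimoto h k).K 1) ((wakimoto h k).G s)) := by
  have key : ∀ a, TaylorRel (ratio₁ (qp h (-((s : ℤ) * (2 * (k + 2))))))
      (qp h (-((s : ℤ) * (k + 2))))
      (zw ((vtxG h k s a).field h k) ((vtxK h 1).field h k))
      (wz ((vtxK h 1).field h k) ((vtxG h k s a).field h k)) := fun a => by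
    refine taylorRel_field h k _ _ (contraction_vtxK_one_right h k _) ?_ (dot_zero_right _)
      (dot_zero_left _) ?_
    · rw [contraction_vtxK_vtxG hg, ratio₁_mul]
    · rw [dot_vtxK_qpow_vtxG_shift, show (vtxK h 1).shift = 0 from rfl, dot_zero_right, qp_zero,
        ← qp_add, neg_add_cancel, qp_zero]
  have := (((key 1).shift_left (1 / 2)).smul ((s : ℤ) / qq h)).add
    (((key (-1)).shift_left (1 / 2)).smul (-((s : ℤ) / qq h)))
  rw [wakimoto_G]
  convert this using 1
  · funext m n
    simp only [zw, wakimoto, Pi.add_apply, Pi.smul_apply, add_mul, smul_mul_assoc]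
  · funext m n
    simp only [wz, wakimoto, Pi.add_apply, Pi.smul_apply, mul_add, mul_smul_comm]

end CartanRelations

/-! ### Powers of q and q-numbers as rational functions of q and q^k. -/

section Numbers

theorem qp_values (h k : ℂ) :
    qp h 2 = qp h 1 ^ 2 ∧ qp h (k + 1) = qp h k * qp h 1 ∧ qp h (k + 2) = qp h k * qp h 1 ^ 2 ∧
    qp h (k + 3) = qp h k * qp h 1 ^ 3 ∧ qp h (k - 1) = qp h k / qp h 1 ∧
    qp h (2 * k + 2) = qp h k ^ 2 * qp h 1 ^ 2 ∧ qp h (2 * k + 3) = qp h k ^ 2 * qp h 1 ^ 3 ∧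
    qp h (2 * k + 4) = qp h k ^ 2 * qp h 1 ^ 4 ∧ qp h (3 * k + 3) = qp h k ^ 3 * qp h 1 ^ 3 ∧
    qp h (3 * k + 5) = qp h k ^ 3 * qp h 1 ^ 5 ∧ qp h (4 * k + 4) = qp h k ^ 4 * qp h 1 ^ 4 ∧
    qp h (4 * k + 6) = qp h k ^ 4 * qp h 1 ^ 6 := by
  rw [div_eq_mul_inv, ← qp_neg]
  refine ⟨?_, ?_, ?_, ?_, ?_, ?_, ?_, ?_, ?_, ?_, ?_, ?_⟩ <;>
    simp only [← qp_mul_natCast, ← qp_add] <;> congr 1 <;> push_cast <;> ring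

theorem qq_eq (h : ℂ) : qq h = (qp h 1 ^ 2 - 1) / qp h 1 := by
  have := qp_ne_zero h 1
  rw [qq, qp_neg]
  field_simp

/-- The condition [2k+2] ≠ 0 excludes both q^(2k+2) = 1 and q^(2k+2) = -1. In particular [k+1] ≠ 0
needs no separate hypothesis. -/
theorem generic_ne {h k : ℂ} (hg : Generic h k) :
    qp h 1 ^ 2 - 1 ≠ 0 ∧ qp h k ^ 2 * qp h 1 ^ 2 - 1 ≠ 0 ∧ qp h k ^ 2 * qp h 1 ^ 2 + 1 ≠ 0 ∧
      qp h k ^ 2 * qp h 1 ^ 4 - 1 ≠ 0 := by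
  have hx := qp_ne_zero h 1
  have hp := qp_ne_zero h k
  obtain ⟨-, -, e1, -, -, e2, -⟩ := qp_values h k
  obtain ⟨h1, -, h3, h4⟩ := hg
  have h2 := h1 2 two_pos
  rw [Nat.cast_ofNat, (qp_values h k).1] at h2
  rw [qn, qp_neg, e1] at h3
  rw [qn, qp_neg, e2] at h4
  refine ⟨sub_ne_zero.2 h2, fun h0 => h4 ?_, fun h0 => h4 ?_, fun h0 => h3 ?_⟩
  · rw [sub_eq_zero.1 h0]
    simp
  · rw [eq_neg_of_add_eq_zero_left h0]
    norm_num
  · have : qp h k * qp h 1 ^ 2 - (qp h k * qp h 1 ^ 2)⁻¹ = 0 := by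
      field_simp
      linear_combination h0
    rw [this, zero_div]

theorem qn_values {h k : ℂ} (hg : Generic h k) :
    qn h (k + 1) = (qp h k ^ 2 * qp h 1 ^ 2 - 1) / (qp h k * (qp h 1 ^ 2 - 1)) ∧
    qn h (k + 2) = (qp h k ^ 2 * qp h 1 ^ 4 - 1) / (qp h k * qp h 1 * (qp h 1 ^ 2 - 1)) ∧
    qn h (2 * k + 2) = (qp h k ^ 2 * qp h 1 ^ 2 - 1) * (qp h k ^ 2 * qp h 1 ^ 2 + 1) /
      (qp h k ^ 2 * qp h 1 * (qp h 1 ^ 2 - 1)) ∧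
    qn h (2 * k + 3) =
      (qp h k ^ 4 * qp h 1 ^ 6 - 1) / (qp h k ^ 2 * qp h 1 ^ 2 * (qp h 1 ^ 2 - 1)) := by
  have hx := qp_ne_zero h 1
  have hp := qp_ne_zero h k
  have h1 := (generic_ne hg).1
  obtain ⟨-, e1, e2, -, -, e3, e4, -⟩ := qp_values h k
  simp only [qn, qp_neg, qq_eq, e1, e2, e3, e4]
  refine ⟨?_, ?_, ?_, ?_⟩ <;> field_simp
  ring

end Numbers

theorem coeffZ_lin (a : ℂ) (i : ℤ) :
    coeffZ (lin a) i = if i = 0 then 1 else if i = 1 then -a else 0 := by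
  rcases lt_or_ge i 0 with hi | hi
  · rw [coeffZ_of_neg _ hi, if_neg (by omega), if_neg (by omega)]
  · lift i to ℕ using hi
    rw [coeffZ_natCast, lin, map_sub, coeff_C_mul, coeff_one, coeff_X]
    rcases i with _ | _ | n
    · simp
    · simp
    · rw [if_neg (by omega), if_neg (by omega), if_neg (by omega), if_neg (by omega)]
      simp

/-- Equality of two bilocal operators whose arguments differ by one unit. -/
theorem Vertex.bilocal_congr_shift (h k : ℂ) (A B : Vertex) {c d : ℤ → ℂ}
    (hcd : ∀ l, c (l + 1) = d l) (m n : ℂ) :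
    bilocal h k A B c (m + 1) n = bilocal h k A B d m (n + 1) := by
  have := bilocal_shift h k A B c m n 1
  rw [Int.cast_one] at this
  rw [this]
  congr 1
  exact funext hcd

/-! ### Anticommutators of the building blocks of G^±. -/

section Fermions

variable {h k : ℂ}

/-- The product is q^(-s(k+1)) (q^(sa) z - q^(sb) w) times a symmetric normal ordered product, hence
changes sign when the factors are interchanged. -/
theorem vtxG_anticommute (hg : Generic h k) (s a b : ℤˣ) (x y : ℂ) :
    (vtxG h k s a).field h k x * (vtxG h k s b).field h k y +
      (vtxG h k s b).field h k y * (vtxG h k s a).field h k x = 0 := by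
  have hk := k_ne_zero hg
  rw [field_mul_field, field_mul_field, dot_vtxG_zpow_shift hk, dot_vtxG_zpow_shift hk,
    dot_vtxG_qpow_shift hk, dot_vtxG_qpow_shift hk, contraction_vtxG_same hg,
    contraction_vtxG_same hg, ← bilocal_smul, ← bilocal_smul, bilocal_swap h k (vtxG h k s b),
    Int.units_mul_self, Units.val_one, Int.cast_one,
    ← bilocal_congr_shift h k _ _ (c := fun l => -(qp h ((s : ℤ) * ((a : ℤ) - (k + 1))) •
      coeffZ (lin (qp h ((s : ℤ) * (((b : ℤ) - (a : ℤ) : ℤ) : ℂ))))) l) ?_, ← bilocal_add,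
    ← bilocal_zero h k (vtxG h k s a) (vtxG h k s b) (x + 1) y]
  · congr 1
    funext l
    simp
  · intro l
    simp only [Pi.smul_apply, smul_eq_mul, coeffZ_lin]
    have e1 : qp h ((s : ℤ) * ((a : ℤ) - (k + 1))) * qp h ((s : ℤ) * (((b : ℤ) - (a : ℤ) : ℤ) : ℂ)) =
        qp h ((s : ℤ) * ((b : ℤ) - (k + 1))) := by
      rw [← qp_add]
      congr 1
      push_cast
      ring
    have e2 : qp h ((s : ℤ) * ((b : ℤ) - (k + 1))) * qp h ((s : ℤ) * (((a : ℤ) - (b : ℤ) : ℤ) : ℂ)) =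
        qp h ((s : ℤ) * ((a : ℤ) - (k + 1))) := by
      rw [← qp_add]
      congr 1
      push_cast
      ring
    by_cases h0 : l = 0
    · subst h0
      simpa using e1
    by_cases h1 : l = -1
    · subst h1
      simpa using e2.symm
    · rw [if_neg (by omega), if_neg (by omega), if_neg (by omega), if_neg (by omega)]
      simp

theorem anticommutator_eq {R : Type*} [Ring R] [Algebra ℂ R] (c d : ℂ) (a₁ a₂ b₁ b₂ : R) :
    (c • a₁ + (-c) • a₂) * (d • b₁ + (-d) • b₂) + (d • b₁ + (-d) • b₂) * (c • a₁ + (-c) • a₂) =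
      (c * d) • ((a₁ * b₁ + b₁ * a₁) - (a₁ * b₂ + b₂ * a₁) - (a₂ * b₁ + b₁ * a₂) +
        (a₂ * b₂ + b₂ * a₂)) := by
  simp only [add_mul, mul_add, smul_mul_smul_comm]
  module

theorem anticommutator_end_eq (c d : ℂ) (a₁ a₂ b₁ b₂ : Module.End ℂ Fock) :
    (c • a₁ + (-c) • a₂) * (d • b₁ + (-d) • b₂) + (d • b₁ + (-d) • b₂) * (c • a₁ + (-c) • a₂) =
      (c * d) • ((a₁ * b₁ + b₁ * a₁) - (a₁ * b₂ + b₂ * a₁) - (a₂ * b₁ + b₁ * a₂) +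
        (a₂ * b₂ + b₂ * a₂)) :=
  anticommutator_eq c d a₁ a₂ b₁ b₂

theorem wakimoto_rel_GG (hg : Generic h k) (s : ℤˣ) (m n : ℂ) :
    (wakimoto h k).G s m * (wakimoto h k).G s n + (wakimoto h k).G s n * (wakimoto h k).G s m =
      0 := by
  have key := fun a b => vtxG_anticommute hg s a b (m + 1 / 2) (n + 1 / 2)
  rw [wakimoto_G]
  dsimp only
  rw [anticommutator_end_eq, key, key, key, key]
  module

/-- The coefficients of the product of the vertex operators of `G^+(z)` and `G^-(w)`, continued to
all integers. -/
def ggCoef (h k : ℂ) (a b : ℤˣ) : ℤ → ℂ :=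
  if a = 1 then
    if b = 1 then
      (qp h k * ((1 - qp h (2 * k + 4)) / (1 - qp h (2 * k + 2)))) • qpSeq h (2 * k + 2) +
        (qp h k * ((1 - qp h 2) / (1 - qp h (-(2 * k + 2))))) • qpSeq h (4 * k + 4)
    else qp h k • qpSeq h (2 * k + 2)
  else
    if b = 1 then qp h (k + 2) • qpSeq h (2 * k + 2) else qp h (k + 2) • qpSeq h (2 * k + 4)

theorem coeffZ_geom (h u : ℂ) {i : ℤ} (hi : 0 ≤ i) :
    coeffZ (geom (qp h u)) i = qpSeq h u i := by
  have := coeffZ_C_mul_geom h 1 u i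
  rwa [map_one, one_mul, if_pos hi, one_mul] at this

theorem oppSeries_one_one (hg : Generic h k) :
    oppSeries h k 1 1 1 =
      C ((1 - qp h (2 * k + 4)) / (1 - qp h (2 * k + 2))) * geom (qp h (2 * k + 2)) +
        C ((1 - qp h 2) / (1 - qp h (-(2 * k + 2)))) * geom (qp h (4 * k + 4)) := by
  have hx := qp_ne_zero h 1
  have hp := qp_ne_zero h k
  obtain ⟨h1, h2, h3, h4⟩ := generic_ne hg
  have h2' : 1 - qp h k ^ 2 * qp h 1 ^ 2 ≠ 0 := fun h0 => h2 (by linear_combination -h0)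
  obtain ⟨e1, -, -, -, -, e2, -, e3, -, -, e4, e5⟩ := qp_values h k
  -- The numerator has degree one only; it is written with a second factor `lin 0 = 1`, and the
  -- value κ at infinity is zero.
  have := lin_mul_lin_mul_geom_mul_geom_eq (α₁ := qp h (4 * k + 6)) (α₂ := 0) (κ := 0)
    (β₁ := qp h (2 * k + 2)) (β₂ := qp h (4 * k + 4))
    (r₁ := (1 - qp h (2 * k + 4)) / (1 - qp h (2 * k + 2)))
    (r₂ := (1 - qp h 2) / (1 - qp h (-(2 * k + 2)))) ?_ ?_ (by ring)
  · rw [map_zero, zero_add] at this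
    rw [← this, oppSeries, if_pos rfl, if_pos rfl]
    simp only [Units.val_one, Int.cast_one, one_mul, lin, map_zero, zero_mul, sub_zero, mul_one,
      mul_assoc]
  · rw [qp_neg, e1, e2, e3]
    field_simp
    ring
  · rw [qp_neg, e1, e2, e3, e4, e5]
    field_simp
    ring

theorem oppSeries_neg_one_one (hg : Generic h k) :
    oppSeries h k (-1) 1 1 =
      C ((1 - qp h (-(2 * k + 4))) / (1 - qp h (-(2 * k + 2)))) * geom (qp h (-(2 * k + 2))) +
        C ((1 - qp h (-2)) / (1 - qp h (2 * k + 2))) * geom (qp h (-(4 * k + 4))) := by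
  have hx := qp_ne_zero h 1
  have hp := qp_ne_zero h k
  obtain ⟨h1, h2, h3, h4⟩ := generic_ne hg
  have h2' : 1 - qp h k ^ 2 * qp h 1 ^ 2 ≠ 0 := fun h0 => h2 (by linear_combination -h0)
  obtain ⟨e1, -, -, -, -, e2, -, e3, -, -, e4, e5⟩ := qp_values h k
  have := lin_mul_lin_mul_geom_mul_geom_eq (α₁ := qp h (-(4 * k + 6))) (α₂ := 0) (κ := 0)
    (β₁ := qp h (-(2 * k + 2))) (β₂ := qp h (-(4 * k + 4)))
    (r₁ := (1 - qp h (-(2 * k + 4))) / (1 - qp h (-(2 * k + 2))))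
    (r₂ := (1 - qp h (-2)) / (1 - qp h (2 * k + 2))) ?_ ?_ (by ring)
  · rw [map_zero, zero_add] at this
    rw [← this, oppSeries, if_pos rfl, if_pos rfl]
    simp only [Units.val_one, Units.val_neg, Int.cast_neg, Int.cast_one, neg_one_mul, lin, map_zero,
      zero_mul, sub_zero, mul_one, mul_assoc]
  · simp only [qp_neg, e1, e2, e3]
    field_simp
    ring
  · simp only [qp_neg, e1, e2, e3, e4, e5]
    field_simp
    ring

theorem ggCoef_of_nonneg (hg : Generic h k) (a b : ℤˣ) {l : ℤ} (hl : 0 ≤ l) :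
    qp h (k + 1 - (a : ℤ)) * coeffZ (oppSeries h k 1 a b) l = ggCoef h k a b l := by
  have e1 : k + 1 - 1 = k := by ring
  have e2 : k + 1 - -1 = k + 2 := by ring
  rcases units_cases a with rfl | rfl <;> rcases units_cases b with rfl | rfl
  · rw [oppSeries_one_one hg, coeffZ_add, coeffZ_C_mul_geom, coeffZ_C_mul_geom, if_pos hl,
      if_pos hl, ggCoef, if_pos rfl, if_pos rfl, Units.val_one, Int.cast_one, e1]
    simp only [Pi.add_apply, Pi.smul_apply, smul_eq_mul]
    ring
  all_goals simp only [oppSeries, ggCoef, if_true, if_neg neg_one_ne_one_units, Units.val_one,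
    Units.val_neg, Int.cast_one, Int.cast_neg, one_mul, coeffZ_geom _ _ hl, Pi.smul_apply, smul_eq_mul, e1, e2]

/-- In the reversed order the exponents change sign and the zero modes give w⁻¹ in place of z⁻¹. The
latter accounts for the index l + 1. -/
theorem ggCoef_of_neg (hg : Generic h k) (a b : ℤˣ) {l : ℤ} (hl : l < 0) :
    qp h ((b : ℤ) - (k + 1)) * coeffZ (oppSeries h k (-1) b a) (-(l + 1)) = ggCoef h k a b l := by
  have hx := qp_ne_zero h 1
  have hp := qp_ne_zero h k
  obtain ⟨h1, h2, h3, h4⟩ := generic_ne hg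
  have h2' : 1 - qp h k ^ 2 * qp h 1 ^ 2 ≠ 0 := fun h0 => h2 (by linear_combination -h0)
  have hl0 : 0 ≤ -(l + 1) := by omega
  obtain ⟨v1, -, v4, -, -, v2, -, v3, -, -, v5, -⟩ := qp_values h k
  have e1 : qp h ((1 : ℤ) - (k + 1)) = (qp h k)⁻¹ := by
    rw [← qp_neg]
    congr 1
    push_cast
    ring
  have e2 : qp h ((-1 : ℤ) - (k + 1)) = (qp h k * qp h 1 ^ 2)⁻¹ := by
    rw [← v4, ← qp_neg]
    congr 1
    push_cast
    ring
  have e3 : ∀ u, qpSeq h u (l + 1) = qpSeq h u l * qp h u := fun u => by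
    rw [qpSeq_add]
    congr 1
    rw [qpSeq, Int.cast_one, mul_one]
  rcases units_cases a with rfl | rfl <;> rcases units_cases b with rfl | rfl
  · rw [oppSeries_neg_one_one hg, coeffZ_add, coeffZ_C_mul_geom, coeffZ_C_mul_geom, if_pos hl0,
      if_pos hl0, ggCoef, if_pos rfl, if_pos rfl, Units.val_one, e1, qpSeq_neg_neg,
      qpSeq_neg_neg, e3, e3]
    simp only [Pi.add_apply, Pi.smul_apply, smul_eq_mul, qp_neg, v1, v2, v3, v5]
    field_simp
    ring
  all_goals
    simp only [oppSeries, ggCoef, if_true, if_neg neg_one_ne_one_units, Units.val_one,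
      Units.val_neg, Int.cast_one, Int.cast_neg, neg_one_mul, coeffZ_geom _ _ hl0, qpSeq_neg_neg,
      e3, Pi.smul_apply, smul_eq_mul] at e1 e2 ⊢
    simp only [e1, e2, v2, v3, v4]
    field_simp

theorem vtxG_pos_mul_neg (hg : Generic h k) (a b : ℤˣ) (x y : ℂ) :
    (vtxG h k 1 a).field h k x * (vtxG h k (-1) b).field h k y =
      bilocal h k (vtxG h k 1 a) (vtxG h k (-1) b) (fun l => if 0 ≤ l then ggCoef h k a b l else 0)
        (x - 1) y := by
  have hk := k_ne_zero hg
  rw [field_mul_field, dot_vtxG_zpow_shift hk, dot_vtxG_qpow_shift hk, contraction_vtxG_opp hg,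
    ← bilocal_smul, show x + ((1 * -1 : ℤˣ) : ℤ) = x - 1 by simp [sub_eq_add_neg]]
  congr 1
  funext l
  rw [Pi.smul_apply, smul_eq_mul]
  split_ifs with hl
  · rw [← ggCoef_of_nonneg hg a b hl]
    congr 2
    simp
  · rw [coeffZ_of_neg _ (by omega), mul_zero]

theorem vtxG_neg_mul_pos (hg : Generic h k) (a b : ℤˣ) (x y : ℂ) :
    (vtxG h k (-1) b).field h k y * (vtxG h k 1 a).field h k x =
      bilocal h k (vtxG h k 1 a) (vtxG h k (-1) b) (fun l => if 0 ≤ l then 0 else ggCoef h k a b l)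
        (x - 1) y := by
  have hk := k_ne_zero hg
  have hopp := contraction_vtxG_opp hg (-1) b a
  rw [neg_neg] at hopp
  rw [field_mul_field, dot_vtxG_zpow_shift hk, dot_vtxG_qpow_shift hk, hopp,
    ← bilocal_smul, show y + ((-1 * 1 : ℤˣ) : ℤ) = y - 1 by simp [sub_eq_add_neg], bilocal_swap]
  have := bilocal_congr_shift h k (vtxG h k 1 a) (vtxG h k (-1) b)
    (c := fun l => (qp h (((1 : ℤˣ) : ℤ) * ((b : ℤ) - (k + 1))) •
      coeffZ (oppSeries h k (-1) b a)) (-l)) (fun _ => rfl) (x - 1) (y - 1)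
  rw [sub_add_cancel, sub_add_cancel] at this
  rw [this]
  congr 1
  funext l
  rw [Pi.smul_apply, smul_eq_mul]
  split_ifs with hl
  · rw [coeffZ_of_neg _ (by omega), mul_zero]
  · rw [← ggCoef_of_neg hg a b (by omega), Units.val_one, Int.cast_one, one_mul]

/-- The two orders fill the complementary ranges l ≥ 0 and l < 0 of the same geometric sequences, so
their sum is a bilateral series, that is, a combination of delta functions. -/
theorem vtxG_pos_neg_anticommutator (hg : Generic h k) (a b : ℤˣ) (x y : ℂ) :
    (vtxG h k 1 a).field h k x * (vtxG h k (-1) b).field h k y +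
      (vtxG h k (-1) b).field h k y * (vtxG h k 1 a).field h k x =
      bilocal h k (vtxG h k 1 a) (vtxG h k (-1) b) (ggCoef h k a b) (x - 1) y := by
  rw [vtxG_pos_mul_neg hg, vtxG_neg_mul_pos hg, ← bilocal_add]
  congr 1
  funext l
  rw [Pi.add_apply]
  split_ifs <;> simp

end Fermions

/-! ### The anticommutator of G^+ and G^-. -/

section GpGm

variable {h k : ℂ}

theorem vtxG_dilate_mul_vtxG (h k : ℂ) (a b : ℤˣ) :
    (vtxG h k 1 a).dilate h (2 * k + 2) * vtxG h k (-1) b = (vtxT h k a b).dilate h (k + 1) := by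
  rw [vtxT_eq, dilate_mul, dilate_dilate, dilate_dilate, neg_add_cancel, dilate_zero,
    show k + 1 + (k + 1) = 2 * k + 2 by ring]

theorem vtxG_dilate_mul_vtxG_one_one (hg : Generic h k) :
    (vtxG h k 1 1).dilate h (4 * k + 4) * vtxG h k (-1) 1 =
      (vtxK h (-1) * vtxK h 1).dilate h (2 * k + 2) := by
  rw [← vtxG_one_one_mul hg, dilate_mul, dilate_dilate, dilate_dilate, neg_add_cancel, dilate_zero,
    show 2 * k + 2 + (2 * k + 2) = 4 * k + 4 by ring]

theorem vtxG_dilate_mul_vtxG_neg_neg (hg : Generic h k) :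
    (vtxG h k 1 (-1)).dilate h (2 * k + 4) * vtxG h k (-1) (-1) = 1 := by
  have h1 : (1 : Vertex).dilate h (k + 2) = 1 := by
    refine ext_iff'.2 ⟨rfl, rfl, ?_, ?_⟩
    · funext b
      change (0 : ℂ) + (k + 2) * 0 = 0
      ring
    · funext b m
      exact mul_zero _
  rw [← h1, ← vtxG_neg_neg_mul hg, dilate_mul, dilate_dilate, dilate_dilate, neg_add_cancel,
    dilate_zero, show k + 2 + (k + 2) = 2 * k + 4 by ring]

theorem sub_one_mem_modes {A : Sector} {m : ℂ} : m - 1 ∈ A.modes ↔ m ∈ A.modes := by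
  simp only [Sector.modes, Set.mem_ofPred_eq]
  exact ⟨fun ⟨j, hj⟩ => ⟨j + 1, by push_cast; linear_combination hj⟩,
    fun ⟨j, hj⟩ => ⟨j - 1, by push_cast; linear_combination hj⟩⟩

open Classical in
theorem bilocal_vtxG_vtxG {A : Sector} {ρ σ : ℂ} (hk : k ≠ 0) (a b : ℤˣ) (u m n : ℂ) {v : Fock}
    (hv : v ∈ fockSpace k A ρ σ) :
    bilocal h k (vtxG h k 1 a) (vtxG h k (-1) b) (qpSeq h u) (m + 1 / 2 - 1) (n + 1 / 2) v =
      if m ∈ A.modes then qp h (u * (m - 1 / 2)) •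
        ((vtxG h k 1 a).dilate h u * vtxG h k (-1) b).field h k (m + n) v else 0 := by
  rw [bilocal_qpSeq_vtxG hk 1 a _ u _ _ hv, show m + 1 / 2 - 1 - 1 / 2 = m - 1 by ring,
    show m + 1 / 2 - 1 = m - 1 / 2 by ring, show m - 1 / 2 + (n + 1 / 2) = m + n by ring]
  simp only [sub_one_mem_modes]

theorem wakimoto_anticommutator (hg : Generic h k) (m n : ℂ) :
    (wakimoto h k).G 1 m * (wakimoto h k).G (-1) n +
        (wakimoto h k).G (-1) n * (wakimoto h k).G 1 m =
      (1 / qq h * (-1 / qq h)) •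
        (bilocal h k (vtxG h k 1 1) (vtxG h k (-1) 1) (ggCoef h k 1 1) (m + 1 / 2 - 1) (n + 1 / 2) -
        bilocal h k (vtxG h k 1 1) (vtxG h k (-1) (-1)) (ggCoef h k 1 (-1)) (m + 1 / 2 - 1)
          (n + 1 / 2) -
        bilocal h k (vtxG h k 1 (-1)) (vtxG h k (-1) 1) (ggCoef h k (-1) 1) (m + 1 / 2 - 1)
          (n + 1 / 2) +
        bilocal h k (vtxG h k 1 (-1)) (vtxG h k (-1) (-1)) (ggCoef h k (-1) (-1)) (m + 1 / 2 - 1)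
          (n + 1 / 2)) := by
  have key := fun a b => vtxG_pos_neg_anticommutator hg a b (m + 1 / 2) (n + 1 / 2)
  rw [wakimoto_G, wakimoto_G]
  dsimp only
  rw [anticommutator_end_eq, key, key, key, key]
  simp only [Units.val_one, Units.val_neg, Int.cast_one, Int.cast_neg]

/-- The poles at q^(4k+4) and q^(2k+4) each occur for a single pair of labels and give K and 1. The
pole at q^(2k+2) occurs for the other two pairs and for labels 1, 1, and its three residues are the
coefficients of T. -/
theorem wakimoto_rel_GpGm (hg : Generic h k) (A : Sector) (ρ σ : ℂ) :
    EqOnSpace (fockSpace k A ρ σ)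
      (zw ((wakimoto h k).G 1) ((wakimoto h k).G (-1)) +
        wz ((wakimoto h k).G (-1)) ((wakimoto h k).G 1))
      ((1 / qq h ^ 2) •
        ((1 / qn h (k + 1)) •
            deltaMul h A (4 * (k + 1)) (rescale h (2 * (k + 1)) (wakimoto h k).KK)
          - deltaMul h A (2 * (k + 2)) oneSeries
          + deltaMul h A (2 * (k + 1)) (rescale h (k + 1) (wakimoto h k).T))) := by
  intro m n v hv
  have hk := k_ne_zero hg
  have hx := qp_ne_zero h 1
  have hp := qp_ne_zero h k
  obtain ⟨h1, h2, h3, h4⟩ := generic_ne hg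
  obtain ⟨v1, v2, v4, -, -, v3, -, v5, -⟩ := qp_values h k
  obtain ⟨n1, n2, -⟩ := qn_values hg
  change ((wakimoto h k).G 1 m * (wakimoto h k).G (-1) n +
        (wakimoto h k).G (-1) n * (wakimoto h k).G 1 m) v = _
  rw [wakimoto_anticommutator hg]
  simp only [ggCoef, if_true, if_neg neg_one_ne_one_units, bilocal_add, bilocal_smul,
    LinearMap.add_apply, LinearMap.sub_apply, LinearMap.smul_apply, bilocal_vtxG_vtxG hk _ _ _ _ _ hv,
    vtxG_dilate_mul_vtxG, vtxG_dilate_mul_vtxG_one_one hg, vtxG_dilate_mul_vtxG_neg_neg hg,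
    field_one, field_dilate, Pi.smul_apply, Pi.add_apply, Pi.sub_apply, deltaMul, rescale,
    wakimoto_KK, wakimoto_T]
  split_ifs with hm
  · have e1 : qp h ((2 * k + 2) * (m - 1 / 2)) = qp h (2 * (k + 1) * m) * (qp h k * qp h 1)⁻¹ := by
      rw [← v2, ← qp_neg, ← qp_add]
      congr 1
      ring
    have e2 : qp h ((2 * k + 4) * (m - 1 / 2)) =
        qp h (2 * (k + 2) * m) * (qp h k * qp h 1 ^ 2)⁻¹ := by
      rw [← v4, ← qp_neg, ← qp_add]
      congr 1
      ring
    have e3 : qp h ((4 * k + 4) * (m - 1 / 2)) =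
        qp h (4 * (k + 1) * m) * (qp h k ^ 2 * qp h 1 ^ 2)⁻¹ := by
      rw [← v3, ← qp_neg, ← qp_add]
      congr 1
      ring
    have e4 : qp h (-(2 * k + 2) * (m + n)) = qp h (-(2 * (k + 1)) * (m + n)) := by
      congr 1
      ring
    have e5 : 1 - qp h k ^ 2 * qp h 1 ^ 2 = -(qp h k ^ 2 * qp h 1 ^ 2 - 1) := by ring
    simp only [LinearMap.add_apply, LinearMap.smul_apply, e1, e2, e3, e4]
    simp only [qp_neg, v1, v3, v4, v5, n1, n2, qq_eq, e5]
    match_scalars <;> field_simp <;> ring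
  · simp

end GpGm

/-! ### Bilateral coefficients of functions with one or two poles. -/

section TwoPoles

/-- The two expansions of `(1 - q ^ u x) / (1 - q ^ v x)`. -/
theorem coeffZ_one_pole (h u v : ℂ) :
    (fun l => coeffZ (lin (qp h u) * geom (qp h v)) l -
      qp h (u - v) * coeffZ (lin (qp h (-u)) * geom (qp h (-v))) (-l)) =
        (1 - qp h (u - v)) • qpSeq h v := by
  have hu := qp_ne_zero h u
  have hv := qp_ne_zero h v
  have e : qp h (u - v) = qp h u / qp h v := by
    rw [sub_eq_add_neg, qp_add, qp_neg, div_eq_mul_inv]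
  rw [coeffZ_sub_coeffZ_neg (κ := qp h u / qp h v) (κ' := qp h v / qp h u)
    (r₁ := 1 - qp h (u - v)) (r₂ := 0) (u₁ := v) (u₂ := 0) (qp_ne_zero _ _), zero_smul, add_zero]
  · rw [e]
    field_simp
    ring
  · rw [lin_mul_geom_eq (κ := qp h u / qp h v) (r := 1 - qp h (u - v)) (by rw [e]; ring)
      (by field_simp), map_zero, zero_mul, add_zero]
  · rw [neg_zero, zero_div, map_zero, zero_mul, add_zero]
    refine lin_mul_geom_eq ?_ ?_
    · rw [e]
      field_simp
      ring
    · rw [qp_neg, qp_neg]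
      field_simp

/-- The residues of `(1 - q ^ u₁ x) (1 - q ^ u₂ x) / ((1 - q ^ v₁ x) (1 - q ^ v₂ x))`. -/
def residue (h u₁ u₂ v₁ v₂ : ℂ) : ℂ :=
  (1 - qp h (u₁ - v₁)) * (1 - qp h (u₂ - v₁)) / (1 - qp h (v₂ - v₁))

theorem coeffZ_two_poles (h : ℂ) {u₁ u₂ v₁ v₂ : ℂ} (hv : qp h v₁ ≠ qp h v₂)
    (hc : u₁ + u₂ = v₁ + v₂) :
    (fun l => coeffZ (lin (qp h u₁) * lin (qp h u₂) * (geom (qp h v₁) * geom (qp h v₂))) l -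
      1 * coeffZ
        (lin (qp h (-u₁)) * lin (qp h (-u₂)) * (geom (qp h (-v₁)) * geom (qp h (-v₂)))) (-l)) =
      residue h u₁ u₂ v₁ v₂ • qpSeq h v₁ + residue h u₁ u₂ v₂ v₁ • qpSeq h v₂ := by
  have h1 := qp_ne_zero h u₁
  have h3 := qp_ne_zero h v₁
  have h4 := qp_ne_zero h v₂
  have e : ∀ a b : ℂ, qp h (a - b) = qp h a / qp h b := fun a b => by
    rw [sub_eq_add_neg, qp_add, qp_neg, div_eq_mul_inv]
  -- By `hc` the rational function takes the same value 1 at zero and at infinity, so κ = κ' = 1,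
  -- and u₂ can be eliminated.
  have e2 : qp h u₂ = qp h v₁ * qp h v₂ / qp h u₁ := by
    rw [← qp_add, ← e, ← hc, add_sub_cancel_left]
  have h5 : qp h v₁ - qp h v₂ ≠ 0 := sub_ne_zero.2 hv
  have h6 : qp h v₂ - qp h v₁ = -(qp h v₁ - qp h v₂) := by ring
  refine coeffZ_sub_coeffZ_neg (κ := 1) (κ' := 1) one_ne_zero ?_ ?_ ?_
  · simp only [residue, e, e2, one_sub_div h3, one_sub_div h4, h6]
    field_simp
    ring
  · refine lin_mul_lin_mul_geom_mul_geom_eq ?_ ?_ ?_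
    · simp only [residue, e, e2, one_sub_div h3, one_sub_div h4, h6]
      field_simp
      ring
    · simp only [residue, e, e2, one_sub_div h3, one_sub_div h4, h6]
      field_simp
      ring
    · rw [e2]
      field_simp
  · refine lin_mul_lin_mul_geom_mul_geom_eq ?_ ?_ ?_
    · simp only [residue, e, e2, one_sub_div h3, one_sub_div h4, h6]
      field_simp
      ring
    · simp only [residue, e, qp_neg, e2, one_sub_div h3, one_sub_div h4, h6]
      field_simp
      ring
    · simp only [qp_neg, e2]
      field_simp

end TwoPoles

/-! ### Linearity and locality of triple products. -/

section MulThree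

variable {M : Type*} [AddCommGroup M] [Module ℂ M] {A B B' C : ℂ → Module.End ℂ M}

theorem mul₃_smul_add_smul (hA : SuppNeg A) (hB : Truncated B) (hB' : Truncated B')
    (hC : SuppPos C) (ht : Truncated C) (x y m : ℂ) :
    mul₃ A (fun m => x • B m + y • B' m) C m = x • mul₃ A B C m + y • mul₃ A B' C m := by
  have e : mulTerm₃ A (fun m => x • B m + y • B' m) C m =
      x • mulTerm₃ A B C m + y • mulTerm₃ A B' C m := by
    funext p
    simp only [mulTerm₃, Pi.add_apply, Pi.smul_apply, mul_add, add_mul, mul_smul_comm,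
      smul_mul_assoc]
  obtain ⟨h1, h2⟩ := lfSum_smul (pointwiseFinite_mulTerm₃ hA hB hC ht m) x
  obtain ⟨h3, h4⟩ := lfSum_smul (pointwiseFinite_mulTerm₃ hA hB' hC ht m) y
  rw [mul₃, e, (lfSum_add h1 h3).2, h2, h4]
  rfl

theorem mul₃_comp_add (A B C : ℂ → Module.End ℂ M) (c m : ℂ) :
    mul₃ A (fun m => B (m + c)) C m = mul₃ A B C (m + c) := by
  rw [mul₃, mul₃]
  congr 1
  funext p
  simp only [mulTerm₃]
  congr 3
  ring

/-- C preserves F, so the middle factor acts only on vectors of F. This allows W to be replaced by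
an operator that agrees with it on the Fock space alone. -/
theorem mul₃_congr {F : Submodule ℂ M} (hA : SuppNeg A) (hB : Truncated B) (hB' : Truncated B')
    (hC : SuppPos C) (ht : Truncated C) (hCF : ∀ m, ∀ v ∈ F, C m v ∈ F)
    (hBB : ∀ m, ∀ v ∈ F, B m v = B' m v) (m : ℂ) {v : M} (hv : v ∈ F) :
    mul₃ A B C m v = mul₃ A B' C m v := by
  rw [mul₃, mul₃, lfSum_apply (pointwiseFinite_mulTerm₃ hA hB hC ht m),
    lfSum_apply (pointwiseFinite_mulTerm₃ hA hB' hC ht m)]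
  refine finsum_congr fun p => ?_
  simp only [mulTerm₃, Module.End.mul_apply]
  rw [hBB _ _ (hCF _ v hv)]

end MulThree

/-! ### The commutator of G^± and T. -/

section GT

variable {h k : ℂ}

/-- The vertex operators of `T(z)`, labelled in a way adapted to `G^±(z)`. -/
def vtxTs (h k : ℂ) (s a b : ℤˣ) : Vertex := if s = 1 then vtxT h k a b else vtxT h k b a

theorem vtxTs_eq (h k : ℂ) (s a b : ℤˣ) : vtxTs h k s a b =
    (vtxG h k s a).dilate h ((s : ℤ) * (k + 1)) *
      (vtxG h k (-s) b).dilate h (-((s : ℤ) * (k + 1))) := by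
  rcases units_cases s with rfl | rfl
  · rw [vtxTs, if_pos rfl, vtxT_eq]
    simp
  · rw [vtxTs, if_neg neg_one_ne_one_units, vtxT_eq, mul_comm]
    simp

theorem vtxTs_shift (h k : ℂ) (s a b : ℤˣ) : (vtxTs h k s a b).shift = 0 := by
  rw [vtxTs]
  split_ifs <;> rw [vtxT_shift]

theorem vtxTs_zpow (h k : ℂ) (s a b : ℤˣ) : (vtxTs h k s a b).zpow = 0 := by
  rw [vtxTs]
  split_ifs <;> rw [vtxT_zpow]

theorem dot_vtxTs_qpow_shift (hk : k ≠ 0) (s a b c : ℤˣ) :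
    dot (vtxTs h k s a b).qpow (vtxG h k s c).shift = (s : ℤ) * ((a : ℤ) + (b : ℤ)) := by
  rw [vtxTs]
  split_ifs
  · rw [dot_vtxT_qpow_shift hk]
  · rw [dot_vtxT_qpow_shift hk, add_comm ((b : ℤ) : ℂ)]

/-- The coefficients of the commutators of `vtxG` and `vtxTs`. -/
def gtCoef (h k : ℂ) (s c a b : ℤˣ) : ℤ → ℂ :=
  if b = 1 then
    if c = 1 then
      if a = 1 then (1 - qp h ((s : ℤ) * 2)) • qpSeq h ((s : ℤ) * (3 * k + 3))
      else
        residue h ((s : ℤ) * (k - 1)) ((s : ℤ) * (3 * k + 5)) ((s : ℤ) * (k + 1))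
            ((s : ℤ) * (3 * k + 3)) • qpSeq h ((s : ℤ) * (k + 1)) +
          residue h ((s : ℤ) * (k - 1)) ((s : ℤ) * (3 * k + 5)) ((s : ℤ) * (3 * k + 3))
            ((s : ℤ) * (k + 1)) • qpSeq h ((s : ℤ) * (3 * k + 3))
    else if a = 1 then (1 - qp h ((s : ℤ) * 2)) • qpSeq h ((s : ℤ) * (k + 1)) else 0
  else 0

theorem qp_units_ne (hg : Generic h k) (s : ℤˣ) :
    qp h ((s : ℤ) * (k + 1)) ≠ qp h ((s : ℤ) * (3 * k + 3)) := by
  intro h0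
  have h1 : qp h ((s : ℤ) * (2 * k + 2)) = 1 := by
    rw [show ((s : ℤ) * (2 * k + 2) : ℂ) = (s : ℤ) * (3 * k + 3) + -((s : ℤ) * (k + 1)) by ring,
      qp_add, ← h0, ← qp_add, add_neg_cancel, qp_zero]
  obtain ⟨-, h2, -⟩ := generic_ne hg
  have e := (qp_values h k).2.2.2.2.2.1
  rcases units_cases s with rfl | rfl
  · rw [Units.val_one, Int.cast_one, one_mul, e] at h1
    exact h2 (by rw [h1, sub_self])
  · rw [Units.val_neg, Units.val_one, Int.cast_neg, Int.cast_one, neg_one_mul, qp_neg, e,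
      inv_eq_one] at h1
    exact h2 (by rw [h1, sub_self])

/-- The contraction functions of `vtxG` and `vtxTs`. -/
def gtSeries (h k t : ℂ) (c a b : ℤˣ) : PowerSeries ℂ :=
  if b = 1 then
    if c = 1 then
      if a = 1 then lin (qp h (t * (3 * k + 5))) * geom (qp h (t * (3 * k + 3)))
      else lin (qp h (t * (k - 1))) * lin (qp h (t * (3 * k + 5))) *
        (geom (qp h (t * (k + 1))) * geom (qp h (t * (3 * k + 3))))
    else if a = 1 then lin (qp h (t * (k + 3))) * geom (qp h (t * (k + 1))) else 1
  else 1

/-- The G-factor of equal charge in T contributes a zero, the one of opposite charge the poles, and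
in most cases the zero cancels a pole. Labels a = b = -1 are excluded because T has no such summand.
-/
theorem lin_mul_rescale_oppSeries (h k : ℂ) (s c a b : ℤˣ) (hab : a = 1 ∨ b = 1) :
    lin (qp h ((s : ℤ) * (k + 1 + (((a : ℤ) - (c : ℤ) : ℤ) : ℂ)))) *
        PowerSeries.rescale (qp h (-((s : ℤ) * (k + 1)))) (oppSeries h k s c b) =
      gtSeries h k (s : ℤ) c a b := by
  have key := lin_mul_geom (qp h ((s : ℤ) * (k + 1)))
  have key' := lin_mul_geom (qp h ((s : ℤ) * (k + 3)))
  have e1 : -((s : ℤ) * (k + 1)) + (s : ℤ) * (4 * k + 6) = (s : ℤ) * (3 * k + 5) := by ring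
  have e2 : -((s : ℤ) * (k + 1)) + (s : ℤ) * (2 * k + 2) = (s : ℤ) * (k + 1) := by ring
  have e3 : -((s : ℤ) * (k + 1)) + (s : ℤ) * (4 * k + 4) = (s : ℤ) * (3 * k + 3) := by ring
  have e4 : -((s : ℤ) * (k + 1)) + (s : ℤ) * (2 * k + 4) = (s : ℤ) * (k + 3) := by ring
  have f1 : k + 1 + 2 = k + 3 := by ring
  have f2 : k + 1 + -2 = k - 1 := by ring
  rcases units_cases c with rfl | rfl <;> rcases units_cases a with rfl | rfl <;>
    rcases units_cases b with rfl | rfl <;>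
  simp only [oppSeries, gtSeries, if_true, if_neg neg_one_ne_one_units, Units.val_one,
    Units.val_neg, sub_self, sub_neg_eq_add, Int.cast_zero, Int.reduceAdd, Int.reduceNeg,
    Int.reduceSub, Int.cast_ofNat, Int.cast_neg, add_zero, map_mul, rescale_lin, rescale_geom,
    ← qp_add, e1, e2, e3, e4, f1, f2, key, key', mul_assoc]
  · linear_combination (lin (qp h ((s : ℤ) * (3 * k + 5))) * geom (qp h ((s : ℤ) * (3 * k + 3)))) *
      key
  · simp at hab
  · simp at hab

theorem oppSeries_comm (h k : ℂ) (s a b : ℤˣ) : oppSeries h k s a b = oppSeries h k s b a := by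
  rw [oppSeries, oppSeries]
  split_ifs <;> rfl

theorem contraction_vtxG_vtxTs (hg : Generic h k) (s c a b : ℤˣ) (hab : a = 1 ∨ b = 1) :
    contraction h k (vtxG h k s c) (vtxTs h k s a b) = gtSeries h k (s : ℤ) c a b := by
  rw [vtxTs_eq, contraction_mul_right, contraction_dilate_right, contraction_dilate_right,
    contraction_vtxG_same hg, contraction_vtxG_opp hg, rescale_lin, ← qp_add, ← mul_add,
    lin_mul_rescale_oppSeries h k s c a b hab]

theorem contraction_vtxTs_vtxG (hg : Generic h k) (s c a b : ℤˣ) (hab : a = 1 ∨ b = 1) :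
    contraction h k (vtxTs h k s a b) (vtxG h k s c) = gtSeries h k (-(s : ℤ)) c a b := by
  have h1 := contraction_vtxG_opp hg (-s) b c
  have h2 := lin_mul_rescale_oppSeries h k (-s) c a b hab
  rw [neg_neg] at h1
  rw [vtxTs_eq, contraction_mul_left, contraction_dilate_left, contraction_dilate_left,
    contraction_vtxG_same hg, h1, rescale_lin, ← qp_add, neg_neg, oppSeries_comm]
  rw [Units.val_neg, Int.cast_neg, neg_mul (((s : ℤ) : ℂ)) (k + 1), neg_neg] at h2
  rw [← h2]
  congr 3
  push_cast
  ring

theorem coeffZ_one_sub (c : ℂ) (hc : c = 1) :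
    (fun l => coeffZ (1 : PowerSeries ℂ) l - c * coeffZ (1 : PowerSeries ℂ) (-l)) = 0 := by
  funext l
  rw [coeffZ_one, coeffZ_one, hc]
  simp

/-- The two orders are expansions of the same rational function in opposite directions, up to the
zero mode factor q^(s(a+b)), so the difference is the sum over residues recorded in `gtCoef`. -/
theorem vtxG_vtxTs_commutator (hg : Generic h k) (s c a b : ℤˣ) (hab : a = 1 ∨ b = 1) (x y : ℂ) :
    (vtxG h k s c).field h k x * (vtxTs h k s a b).field h k y -
        (vtxTs h k s a b).field h k y * (vtxG h k s c).field h k x =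
      bilocal h k (vtxG h k s c) (vtxTs h k s a b) (gtCoef h k s c a b) x y := by
  refine field_mul_field_sub h k _ _ (c := qp h ((s : ℤ) * ((a : ℤ) + (b : ℤ)))) ?_ ?_ ?_ ?_ ?_ x y
  · rw [vtxTs_shift, dot_zero_right]
  · rw [vtxTs_zpow, dot_zero_left]
  · rw [vtxTs_shift, dot_zero_right]
  · rw [dot_vtxTs_qpow_shift (k_ne_zero hg)]
  rw [contraction_vtxG_vtxTs hg s c a b hab, contraction_vtxTs_vtxG hg s c a b hab, gtSeries,
    gtSeries, gtCoef]
  have e0 : qp h ((s : ℤ) * (1 + -1)) = 1 := by rw [add_neg_cancel, mul_zero, qp_zero]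
  have e0' : qp h ((s : ℤ) * (-1 + 1)) = 1 := by rw [neg_add_cancel, mul_zero, qp_zero]
  have e1 : (s : ℤ) * (1 + 1) = (s : ℤ) * (3 * k + 5) - (s : ℤ) * (3 * k + 3) := by ring
  have e2 : (s : ℤ) * (1 + 1) = (s : ℤ) * (k + 3) - (s : ℤ) * (k + 1) := by ring
  rcases units_cases b with rfl | rfl
  · rcases units_cases c with rfl | rfl <;> rcases units_cases a with rfl | rfl <;>
    simp only [if_true, if_neg neg_one_ne_one_units, Units.val_one, Units.val_neg, Int.cast_neg,
      Int.cast_one, neg_mul]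
    · rw [e1, coeffZ_one_pole, ← e1, one_add_one_eq_two]
    · rw [e0', coeffZ_two_poles h (qp_units_ne hg s) (by ring)]
    · rw [e2, coeffZ_one_pole, ← e2, one_add_one_eq_two]
    · exact coeffZ_one_sub _ e0'
  · obtain rfl : a = 1 := hab.resolve_right neg_one_ne_one_units
    simp only [if_neg neg_one_ne_one_units, Units.val_one, Units.val_neg, Int.cast_neg,
      Int.cast_one]
    exact coeffZ_one_sub _ e0

theorem vtxG_one_mul (hg : Generic h k) (s : ℤˣ) :
    (vtxG h k s 1).dilate h ((s : ℤ) * (2 * k + 2)) *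
      (vtxG h k (-s) 1).dilate h (-((s : ℤ) * (2 * k + 2))) = vtxK h (-1) * vtxK h 1 := by
  rw [← vtxG_one_one_mul hg]
  rcases units_cases s with rfl | rfl
  · simp
  · rw [mul_comm]
    simp

/-- At z = q^(s(3k+3)) w the operator G^s and the G^(-s)-factor of T stand at the ratio q^(s(4k+4)),
where they fuse to K^-K^+. The G^s-factor of T is left over. -/
theorem vtxG_dilate_mul_vtxTs (hg : Generic h k) (s a : ℤˣ) :
    (vtxG h k s 1).dilate h ((s : ℤ) * (3 * k + 3)) * vtxTs h k s a 1 =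
      (vtxK h (-1) * vtxG h k s a * vtxK h 1).dilate h ((s : ℤ) * (k + 1)) := by
  rw [mul_right_comm, ← vtxG_one_mul hg s, dilate_mul, dilate_mul, dilate_dilate, dilate_dilate,
    vtxTs_eq, mul_left_comm, mul_comm _ ((vtxG h k s a).dilate h _)]
  congr 3 <;> ring

/-- At z = q^(s(k+1)) w the two operators of charge s sit at the same point, so their labels may be
interchanged. Hence the contributions of this unwanted pole are proportional to each other. -/
theorem vtxG_dilate_mul_vtxTs_comm (h k : ℂ) (s : ℤˣ) :
    (vtxG h k s 1).dilate h ((s : ℤ) * (k + 1)) * vtxTs h k s (-1) 1 =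
      (vtxG h k s (-1)).dilate h ((s : ℤ) * (k + 1)) * vtxTs h k s 1 1 := by
  rw [vtxTs_eq, vtxTs_eq, mul_left_comm]

theorem wakimoto_Ts (h k : ℂ) (s : ℤˣ) : (wakimoto h k).T = fun m =>
    qp h (-(s : ℤ)) • (vtxTs h k s 1 (-1)).field h k m +
      (-(qn h (k + 2) / qn h (k + 1))) • (vtxTs h k s 1 1).field h k m +
      qp h (s : ℤ) • (vtxTs h k s (-1) 1).field h k m := by
  funext m
  rw [wakimoto_T, vtxTs, vtxTs, vtxTs]
  rcases units_cases s with rfl | rfl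
  · simp
  · simp only [if_neg neg_one_ne_one_units, Units.val_neg, Units.val_one, Int.cast_neg,
      Int.cast_one, neg_neg]
    module

theorem commutator_eq {R : Type*} [Ring R] [Algebra ℂ R] (c x₁ x₂ x₃ : ℂ) (a₁ a₂ t₁ t₂ t₃ : R) :
    (c • a₁ + (-c) • a₂) * (x₁ • t₁ + x₂ • t₂ + x₃ • t₃) -
        (x₁ • t₁ + x₂ • t₂ + x₃ • t₃) * (c • a₁ + (-c) • a₂) =
      (c * x₁) • (a₁ * t₁ - t₁ * a₁) + (c * x₂) • (a₁ * t₂ - t₂ * a₁) +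
        (c * x₃) • (a₁ * t₃ - t₃ * a₁) + (-(c * x₁)) • (a₂ * t₁ - t₁ * a₂) +
        (-(c * x₂)) • (a₂ * t₂ - t₂ * a₂) + (-(c * x₃)) • (a₂ * t₃ - t₃ * a₂) := by
  simp only [add_mul, mul_add, smul_mul_smul_comm]
  module

theorem commutator_end_eq (c x₁ x₂ x₃ : ℂ) (a₁ a₂ t₁ t₂ t₃ : Module.End ℂ Fock) :
    (c • a₁ + (-c) • a₂) * (x₁ • t₁ + x₂ • t₂ + x₃ • t₃) -
        (x₁ • t₁ + x₂ • t₂ + x₃ • t₃) * (c • a₁ + (-c) • a₂) =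
      (c * x₁) • (a₁ * t₁ - t₁ * a₁) + (c * x₂) • (a₁ * t₂ - t₂ * a₁) +
        (c * x₃) • (a₁ * t₃ - t₃ * a₁) + (-(c * x₁)) • (a₂ * t₁ - t₁ * a₂) +
        (-(c * x₂)) • (a₂ * t₂ - t₂ * a₂) + (-(c * x₃)) • (a₂ * t₃ - t₃ * a₂) :=
  commutator_eq c x₁ x₂ x₃ a₁ a₂ t₁ t₂ t₃

theorem wakimoto_KGK (h k : ℂ) (s : ℤˣ) (m : ℂ) :
    mul₃ ((wakimoto h k).K (-1)) ((wakimoto h k).G s) ((wakimoto h k).K 1) m =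
      ((s : ℤ) / qq h) • qp h ((s : ℤ) * (k + 2)) •
          (vtxK h (-1) * vtxG h k s 1 * vtxK h 1).field h k (m + 1 / 2) +
        (-((s : ℤ) / qq h)) • qp h ((s : ℤ) * (k + 2)) •
          (vtxK h (-1) * vtxG h k s (-1) * vtxK h 1).field h k (m + 1 / 2) := by
  have key : ∀ a, mul₃ ((wakimoto h k).K (-1)) (fun m => (vtxG h k s a).field h k (m + 1 / 2))
      ((wakimoto h k).K 1) m = qp h ((s : ℤ) * (k + 2)) •
          (vtxK h (-1) * vtxG h k s a * vtxK h 1).field h k (m + 1 / 2) := fun a => by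
    rw [mul₃_comp_add]
    refine (mul₃_field h k (vtxK_annihilation h k) (vtxK_creation h k) rfl rfl rfl rfl _).trans ?_
    rw [dot_vtxK_qpow_vtxG_shift]
  rw [wakimoto_G, mul₃_smul_add_smul (suppNeg_wakimoto h k)
    ((truncated_field h k _).comp_add _) ((truncated_field h k _).comp_add _)
    (suppPos_wakimoto h k) (truncated_wakimoto_K h k 1), key, key]

theorem wakimoto_commutator_GT (hg : Generic h k) (s : ℤˣ) (m n : ℂ) :
    (wakimoto h k).G s m * (wakimoto h k).T n - (wakimoto h k).T n * (wakimoto h k).G s m =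
      ((s : ℤ) / qq h * -(qn h (k + 2) / qn h (k + 1))) •
          bilocal h k (vtxG h k s 1) (vtxTs h k s 1 1) (gtCoef h k s 1 1 1) (m + 1 / 2) n +
        ((s : ℤ) / qq h * qp h (s : ℤ)) •
          bilocal h k (vtxG h k s 1) (vtxTs h k s (-1) 1) (gtCoef h k s 1 (-1) 1) (m + 1 / 2) n +
        (-((s : ℤ) / qq h * -(qn h (k + 2) / qn h (k + 1)))) •
          bilocal h k (vtxG h k s (-1)) (vtxTs h k s 1 1) (gtCoef h k s (-1) 1 1)
            (m + 1 / 2) n := by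
  have key := fun c a b hab => vtxG_vtxTs_commutator hg s c a b hab (m + 1 / 2) n
  rw [wakimoto_G, wakimoto_Ts h k s]
  dsimp only
  rw [commutator_end_eq, key _ _ _ (.inl rfl), key _ _ _ (.inl rfl), key _ _ _ (.inr rfl),
    key _ _ _ (.inl rfl), key _ _ _ (.inl rfl), key _ _ _ (.inr rfl)]
  have z1 : ∀ c, gtCoef h k s c 1 (-1) = 0 := fun c => by
    rw [gtCoef, if_neg neg_one_ne_one_units]
  have z2 : gtCoef h k s (-1) (-1) 1 = 0 := by
    rw [gtCoef, if_pos rfl, if_neg neg_one_ne_one_units, if_neg neg_one_ne_one_units]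
  rw [z1, z1, z2, bilocal_zero, bilocal_zero, bilocal_zero]
  module

open Classical in
theorem bilocal_qpSeq_vtxG_add_half {A : Sector} {ρ σ : ℂ} (hk : k ≠ 0) (s a : ℤˣ) (B : Vertex)
    (u m n : ℂ) {v : Fock} (hv : v ∈ fockSpace k A ρ σ) :
    bilocal h k (vtxG h k s a) B (qpSeq h u) (m + 1 / 2) n v =
      if m ∈ A.modes then qp h (u * (m + 1 / 2)) •
        ((vtxG h k s a).dilate h u * B).field h k (m + n + 1 / 2) v else 0 := by
  rw [bilocal_qpSeq_vtxG hk s a _ u _ _ hv, show m + 1 / 2 - 1 / 2 = m by ring,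
    show m + 1 / 2 + n = m + n + 1 / 2 by ring]

theorem one_sub_qp_two (hg : Generic h k) (s : ℤˣ) :
    ((s : ℤ) / qq h) * (1 - qp h ((s : ℤ) * 2)) = -qp h (s : ℤ) := by
  have hx := qp_ne_zero h 1
  have h1 := (generic_ne hg).1
  rcases units_cases s with rfl | rfl <;>
    simp only [Units.val_one, Units.val_neg, Int.cast_one, Int.cast_neg, one_mul, neg_one_mul,
      qp_neg, (qp_values h k).1, qq_eq] <;> field_simp
  ring

/-- The first identity expresses that the pole at q^(s(k+1)) cancels, the second matches the pole at
q^(s(3k+3)) with the right-hand side. Both depend on the coefficient -[k+2]/[k+1] in T. -/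
theorem residue_gt (hg : Generic h k) (s : ℤˣ) :
    qp h (s : ℤ) * residue h ((s : ℤ) * (k - 1)) ((s : ℤ) * (3 * k + 5)) ((s : ℤ) * (k + 1))
        ((s : ℤ) * (3 * k + 3)) = -((1 - qp h ((s : ℤ) * 2)) * (qn h (k + 2) / qn h (k + 1))) ∧
      qp h (s : ℤ) * residue h ((s : ℤ) * (k - 1)) ((s : ℤ) * (3 * k + 5))
        ((s : ℤ) * (3 * k + 3)) ((s : ℤ) * (k + 1)) =
          (1 - qp h ((s : ℤ) * 2)) * (qn h (k + 2) / qn h (k + 1)) := by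
  have hx := qp_ne_zero h 1
  have hp := qp_ne_zero h k
  obtain ⟨h1, h2, h3, h4⟩ := generic_ne hg
  obtain ⟨v1, -, -, -, -, v3, -, v5, -⟩ := qp_values h k
  obtain ⟨n1, n2, -⟩ := qn_values hg
  have e : 1 - qp h k ^ 2 * qp h 1 ^ 2 = -(qp h k ^ 2 * qp h 1 ^ 2 - 1) := by ring
  have d1 : (s : ℤ) * (k - 1) - (s : ℤ) * (k + 1) = -((s : ℤ) * 2) := by ring
  have d2 : (s : ℤ) * (3 * k + 5) - (s : ℤ) * (k + 1) = (s : ℤ) * (2 * k + 4) := by ring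
  have d3 : (s : ℤ) * (3 * k + 3) - (s : ℤ) * (k + 1) = (s : ℤ) * (2 * k + 2) := by ring
  have d4 : (s : ℤ) * (k - 1) - (s : ℤ) * (3 * k + 3) = -((s : ℤ) * (2 * k + 4)) := by ring
  have d5 : (s : ℤ) * (3 * k + 5) - (s : ℤ) * (3 * k + 3) = (s : ℤ) * 2 := by ring
  have d6 : (s : ℤ) * (k + 1) - (s : ℤ) * (3 * k + 3) = -((s : ℤ) * (2 * k + 2)) := by ring
  simp only [residue, d1, d2, d3, d4, d5, d6, n1, n2]
  rcases units_cases s with rfl | rfl <;>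
    simp only [Units.val_one, Units.val_neg, Int.cast_one, Int.cast_neg, one_mul, neg_one_mul,
      neg_neg, qp_neg, v1, v3, v5, e] <;> constructor <;> field_simp <;> ring

theorem wakimoto_rel_GT (hg : Generic h k) (A : Sector) (ρ σ : ℂ) (s : ℤˣ) :
    EqOnSpace (fockSpace k A ρ σ)
      (zw ((wakimoto h k).G s) (wakimoto h k).T - wz (wakimoto h k).T ((wakimoto h k).G s))
      (((s : ℤ) * (qq h * (qn h (k + 2) / qn h (k + 1)))) •
        deltaMul h A ((s : ℤ) * (3 * (k + 1)))
          (rescale h ((s : ℤ) * (k + 1))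
            (mul₃ ((wakimoto h k).K (-1)) ((wakimoto h k).G s) ((wakimoto h k).K 1)))) := by
  intro m n v hv
  have hk := k_ne_zero hg
  change ((wakimoto h k).G s m * (wakimoto h k).T n -
    (wakimoto h k).T n * (wakimoto h k).G s m) v = _
  rw [wakimoto_commutator_GT hg]
  simp only [gtCoef, if_true, if_neg neg_one_ne_one_units, bilocal_add, bilocal_smul,
    LinearMap.add_apply, LinearMap.smul_apply, bilocal_qpSeq_vtxG_add_half hk _ _ _ _ _ _ hv,
    vtxG_dilate_mul_vtxTs hg, vtxG_dilate_mul_vtxTs_comm,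
    field_dilate, Pi.smul_apply, deltaMul, rescale, wakimoto_KGK]
  split_ifs with hm
  · have e1 := one_sub_qp_two hg s
    obtain ⟨e2, e3⟩ := residue_gt hg s
    have e4 : qp h ((s : ℤ) * (3 * k + 3) * (m + 1 / 2)) *
        qp h (-((s : ℤ) * (k + 1)) * (m + n + 1 / 2)) =
        qp h ((s : ℤ) * (3 * (k + 1)) * m) * qp h (-((s : ℤ) * (k + 1)) * (m + n)) *
          qp h ((s : ℤ) * (k + 1)) := by
      rw [← qp_add, ← qp_add, ← qp_add]
      congr 1
      ring
    have e5 : qp h (s : ℤ) * qp h ((s : ℤ) * (k + 1)) = qp h ((s : ℤ) * (k + 2)) := by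
      rw [← qp_add]
      congr 1
      ring
    have e6 : ((s : ℤ) * qq h : ℂ) * ((s : ℤ) / qq h) = 1 := by
      have := qq_ne_zero hg
      field_simp
      rcases units_cases s with rfl | rfl <;> simp
    simp only [LinearMap.add_apply, LinearMap.smul_apply]
    -- The vertex operators on both sides now agree, and only `e1`–`e6` are needed about the
    -- scalars, which become variables.
    generalize residue h ((s : ℤ) * (k - 1)) ((s : ℤ) * (3 * k + 5)) ((s : ℤ) * (k + 1))
      ((s : ℤ) * (3 * k + 3)) = r₁ at *
    generalize residue h ((s : ℤ) * (k - 1)) ((s : ℤ) * (3 * k + 5)) ((s : ℤ) * (3 * k + 3))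
      ((s : ℤ) * (k + 1)) = r₂ at *
    generalize qn h (k + 2) / qn h (k + 1) = r at *
    generalize qp h ((s : ℤ) * (3 * k + 3) * (m + 1 / 2)) = p₁ at *
    generalize qp h (-((s : ℤ) * (k + 1)) * (m + n + 1 / 2)) = p₂ at *
    generalize qp h ((s : ℤ) * (3 * (k + 1)) * m) = p₃ at *
    generalize qp h (-((s : ℤ) * (k + 1)) * (m + n)) = p₄ at *
    generalize qp h ((s : ℤ) * (k + 1) * (m + 1 / 2)) = p₉ at *
    generalize qp h ((s : ℤ) * (k + 1)) = p₅ at *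
    generalize qp h ((s : ℤ) * (k + 2)) = p₆ at *
    generalize qp h ((s : ℤ) * 2) = p₇ at *
    generalize qp h (s : ℤ) = p₈ at *
    generalize ((s : ℤ) / qq h : ℂ) = t at *
    match_scalars
    · linear_combination -r * p₁ * p₂ * e1 + r * p₈ * e4 + r * p₃ * p₄ * e5 - r * p₃ * p₄ * p₆ * e6
    · linear_combination (t * p₉) * e2
    · linear_combination t * p₁ * p₂ * e3 + r * p₁ * p₂ * e1 - r * p₈ * e4 - r * p₃ * p₄ * e5 +
        r * p₃ * p₄ * p₆ * e6
  · simp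

end GT

/-! ### The commutator of T with itself. -/

section TT

variable {h k : ℂ}

/-- The first T is split into its G^+ and G^- factors, and each is contracted with the second T by
the table for [G,T]. -/
theorem contraction_vtxT_vtxT (hg : Generic h k) (a b c d : ℤˣ) (hcd : c = 1 ∨ d = 1) :
    contraction h k (vtxT h k a b) (vtxT h k c d) =
      PowerSeries.rescale (qp h (-(k + 1))) (gtSeries h k 1 a c d) *
        PowerSeries.rescale (qp h (k + 1)) (gtSeries h k (-1) b d c) := by
  have h1 := contraction_vtxG_vtxTs hg 1 a c d hcd
  have h2 := contraction_vtxG_vtxTs hg (-1) b d c hcd.symm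
  rw [vtxTs, if_pos rfl, Units.val_one, Int.cast_one] at h1
  rw [vtxTs, if_neg neg_one_ne_one_units, Units.val_neg, Units.val_one, Int.cast_neg,
    Int.cast_one] at h2
  rw [vtxT_eq h k a b, contraction_mul_left, contraction_dilate_left, contraction_dilate_left, h1,
    h2, neg_neg]

/-- The contraction functions of the vertex operators of `T(z)`, in one of the two orders. -/
def ttSeries (h k : ℂ) : PowerSeries ℂ :=
  lin (qp h (-2)) * lin (qp h (2 * k + 4)) * (geom (qp h 0) * geom (qp h (2 * k + 2)))

/-- The contraction functions of the vertex operators of `T(z)`, in the other order. -/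
def ttSeries' (h k : ℂ) : PowerSeries ℂ :=
  lin (qp h (- -2)) * lin (qp h (-(2 * k + 4))) * (geom (qp h (-0)) * geom (qp h (-(2 * k + 2))))

theorem contraction_vtxT_table (hg : Generic h k) :
    contraction h k (vtxT h k 1 (-1)) (vtxT h k 1 (-1)) = 1 ∧
    contraction h k (vtxT h k 1 (-1)) (vtxT h k 1 1) = ttSeries h k ∧
    contraction h k (vtxT h k 1 (-1)) (vtxT h k (-1) 1) = ttSeries h k ∧
    contraction h k (vtxT h k 1 1) (vtxT h k 1 (-1)) = ttSeries' h k ∧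
    contraction h k (vtxT h k 1 1) (vtxT h k 1 1) =
      lin (qp h (2 * k + 4)) * lin (qp h (-(2 * k + 4))) *
        (geom (qp h (2 * k + 2)) * geom (qp h (-(2 * k + 2)))) ∧
    contraction h k (vtxT h k 1 1) (vtxT h k (-1) 1) = ttSeries h k ∧
    contraction h k (vtxT h k (-1) 1) (vtxT h k 1 (-1)) = ttSeries' h k ∧
    contraction h k (vtxT h k (-1) 1) (vtxT h k 1 1) = ttSeries' h k ∧
    contraction h k (vtxT h k (-1) 1) (vtxT h k (-1) 1) = 1 := by
  have e1 : -(k + 1) + (3 * k + 5) = 2 * k + 4 := by ring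
  have e2 : -(k + 1) + (3 * k + 3) = 2 * k + 2 := by ring
  have e3 : -(k + 1) + (k - 1) = -2 := by ring
  have e4 : -(k + 1) + (k + 3) = 2 := by ring
  have e5 : -(k + 1) + (k + 1) = 0 := by ring
  have f1 : k + 1 + -(3 * k + 5) = -(2 * k + 4) := by ring
  have f2 : k + 1 + -(3 * k + 3) = -(2 * k + 2) := by ring
  have f3 : k + 1 + -(k - 1) = 2 := by ring
  have f4 : k + 1 + -(k + 3) = -2 := by ring
  have f5 : k + 1 + -(k + 1) = 0 := by ring
  refine ⟨?_, ?_, ?_, ?_, ?_, ?_, ?_, ?_, ?_⟩ <;>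
    rw [contraction_vtxT_vtxT hg _ _ _ _ (by simp)] <;>
    simp only [gtSeries, if_true, if_neg neg_one_ne_one_units, map_mul, map_one, rescale_lin,
      rescale_geom, ← qp_add, one_mul, neg_one_mul, mul_one, e1, e2, e3, e4, e5, f1, f2, f3, f4, f5,
      ttSeries, ttSeries', neg_neg, neg_zero] <;> ring

/-- The coefficients of the commutators of the vertex operators of `T(z)`. -/
def ttCoef (h k : ℂ) : ℤ → ℂ :=
  residue h (-2) (2 * k + 4) 0 (2 * k + 2) • qpSeq h 0 +
    residue h (-2) (2 * k + 4) (2 * k + 2) 0 • qpSeq h (2 * k + 2)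

/-- The coefficients of the commutators of the vertex operators of `T(z)` in the other order. -/
def ttCoef' (h k : ℂ) : ℤ → ℂ :=
  residue h (- -2) (-(2 * k + 4)) (-0) (-(2 * k + 2)) • qpSeq h (-0) +
    residue h (- -2) (-(2 * k + 4)) (-(2 * k + 2)) (-0) • qpSeq h (-(2 * k + 2))

/-- The coefficients of the commutator of the vertex operator of `T(z)` with signs `+, +`. -/
def ttCoefDiag (h k : ℂ) : ℤ → ℂ :=
  residue h (2 * k + 4) (-(2 * k + 4)) (2 * k + 2) (-(2 * k + 2)) • qpSeq h (2 * k + 2) +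
    residue h (2 * k + 4) (-(2 * k + 4)) (-(2 * k + 2)) (2 * k + 2) • qpSeq h (-(2 * k + 2))

theorem vtxT_commutator {a b c d : ℤˣ} {D : ℤ → ℂ}
    (hD : (fun l => coeffZ (contraction h k (vtxT h k a b) (vtxT h k c d)) l -
      1 * coeffZ (contraction h k (vtxT h k c d) (vtxT h k a b)) (-l)) = D) (x y : ℂ) :
    (vtxT h k a b).field h k x * (vtxT h k c d).field h k y -
      (vtxT h k c d).field h k y * (vtxT h k a b).field h k x =
        bilocal h k (vtxT h k a b) (vtxT h k c d) D x y := by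
  refine field_mul_field_sub h k _ _ ?_ ?_ ?_ ?_ hD x y <;>
    simp only [vtxT_shift, dot_zero_right, qp_zero]

theorem qp_two_mul_add_two_ne (hg : Generic h k) :
    qp h 0 ≠ qp h (2 * k + 2) ∧ qp h (-0) ≠ qp h (-(2 * k + 2)) ∧
      qp h (2 * k + 2) ≠ qp h (-(2 * k + 2)) := by
  have hx := qp_ne_zero h 1
  have hp := qp_ne_zero h k
  obtain ⟨-, h2, h3, -⟩ := generic_ne hg
  have v := (qp_values h k).2.2.2.2.2.1
  refine ⟨fun h0 => h2 ?_, fun h0 => h2 ?_, fun h0 => ?_⟩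
  · rw [← v, ← h0, qp_zero, sub_self]
  · rw [neg_zero, qp_zero, qp_neg, v] at h0
    rw [inv_eq_one.1 h0.symm, sub_self]
  · rw [qp_neg, v] at h0
    field_simp at h0
    exact mul_ne_zero h2 h3 (by linear_combination h0)

theorem ttCoef_eq (hg : Generic h k) :
    (fun l => coeffZ (ttSeries h k) l - 1 * coeffZ (ttSeries' h k) (-l)) = ttCoef h k :=
  coeffZ_two_poles h (qp_two_mul_add_two_ne hg).1 (by ring)

theorem ttCoef'_eq (hg : Generic h k) :
    (fun l => coeffZ (ttSeries' h k) l - 1 * coeffZ (ttSeries h k) (-l)) = ttCoef' h k := by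
  have := coeffZ_two_poles h (u₁ := - -2) (u₂ := -(2 * k + 4)) (qp_two_mul_add_two_ne hg).2.1
    (by ring)
  rw [neg_neg (-2 : ℂ), neg_neg (2 * k + 4), neg_neg (2 * k + 2), neg_neg (0 : ℂ)] at this
  exact this

theorem ttCoefDiag_eq (hg : Generic h k) :
    (fun l => coeffZ (lin (qp h (2 * k + 4)) * lin (qp h (-(2 * k + 4))) *
        (geom (qp h (2 * k + 2)) * geom (qp h (-(2 * k + 2))))) l -
      1 * coeffZ (lin (qp h (2 * k + 4)) * lin (qp h (-(2 * k + 4))) *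
        (geom (qp h (2 * k + 2)) * geom (qp h (-(2 * k + 2))))) (-l)) = ttCoefDiag h k := by
  have := coeffZ_two_poles h (u₁ := 2 * k + 4) (u₂ := -(2 * k + 4))
    (qp_two_mul_add_two_ne hg).2.2 (by ring)
  rw [neg_neg, neg_neg, mul_comm (lin (qp h (-(2 * k + 4)))),
    mul_comm (geom (qp h (-(2 * k + 2))))] at this
  exact this

theorem residue_tt (hg : Generic h k) :
    residue h (-2) (2 * k + 4) 0 (2 * k + 2) = qq h * (qn h (k + 2) / qn h (k + 1)) ∧
    residue h (-2) (2 * k + 4) (2 * k + 2) 0 = -(qq h * (qn h (k + 2) / qn h (k + 1))) ∧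
    residue h (- -2) (-(2 * k + 4)) (-0) (-(2 * k + 2)) =
      -(qq h * (qn h (k + 2) / qn h (k + 1))) ∧
    residue h (- -2) (-(2 * k + 4)) (-(2 * k + 2)) (-0) = qq h * (qn h (k + 2) / qn h (k + 1)) ∧
    residue h (2 * k + 4) (-(2 * k + 4)) (2 * k + 2) (-(2 * k + 2)) =
      -(qq h * (qn h (2 * k + 3) / qn h (2 * k + 2))) ∧
    residue h (2 * k + 4) (-(2 * k + 4)) (-(2 * k + 2)) (2 * k + 2) =
      qq h * (qn h (2 * k + 3) / qn h (2 * k + 2)) := by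
  have hx := qp_ne_zero h 1
  have hp := qp_ne_zero h k
  obtain ⟨h1, h2, h3, h4⟩ := generic_ne hg
  obtain ⟨v1, -, -, -, -, v3, -, v5, -, -, v6, v7⟩ := qp_values h k
  obtain ⟨n1, n2, n3, n4⟩ := qn_values hg
  have e1 : 1 - qp h k ^ 2 * qp h 1 ^ 2 = -(qp h k ^ 2 * qp h 1 ^ 2 - 1) := by ring
  have e2 : 1 - qp h k ^ 4 * qp h 1 ^ 4 =
    -((qp h k ^ 2 * qp h 1 ^ 2 - 1) * (qp h k ^ 2 * qp h 1 ^ 2 + 1)) := by ring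
  have e3 : 1 - (qp h k ^ 4 * qp h 1 ^ 4)⁻¹ =
    (qp h k ^ 2 * qp h 1 ^ 2 - 1) * (qp h k ^ 2 * qp h 1 ^ 2 + 1) / (qp h k ^ 4 * qp h 1 ^ 4) := by
    field_simp
    ring
  have e4 : 1 - (qp h k ^ 2 * qp h 1 ^ 2)⁻¹ =
    (qp h k ^ 2 * qp h 1 ^ 2 - 1) / (qp h k ^ 2 * qp h 1 ^ 2) := by field_simp
  have d1 : -2 - (2 * k + 2) = -(2 * k + 4) := by ring
  have d2 : 2 * k + 4 - (2 * k + 2) = 2 := by ring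
  have d3 : 2 - -(2 * k + 2) = 2 * k + 4 := by ring
  have d4 : -(2 * k + 4) - -(2 * k + 2) = -2 := by ring
  have d5 : -(2 * k + 4) - (2 * k + 2) = -(4 * k + 6) := by ring
  have d6 : -(2 * k + 2) - (2 * k + 2) = -(4 * k + 4) := by ring
  have d7 : 2 * k + 4 - -(2 * k + 2) = 4 * k + 6 := by ring
  have d8 : 2 * k + 2 - -(2 * k + 2) = 4 * k + 4 := by ring
  simp only [residue, neg_neg, neg_zero, sub_zero, zero_sub, d1, d2, d3, d4, d5, d6, d7, d8, qp_neg,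
    v1, v3, v5, v6, v7, n1, n2, n3, n4, qq_eq, e1, e2, e3, e4]
  refine ⟨?_, ?_, ?_, ?_, ?_, ?_⟩ <;> field_simp <;> ring

/-- At z = q^(2k+2) w the outer factors G^+ of the first T and G^- of the second are at the ratio
q^(4k+4) and fuse to K^-K^+. The inner factors meet at the common point q^(k+1) w. -/
theorem vtxT_dilate_mul_vtxT (hg : Generic h k) (b c : ℤˣ) :
    (vtxT h k 1 b).dilate h (2 * k + 2) * vtxT h k c 1 =
      (vtxK h (-1) * (vtxG h k 1 c * vtxG h k (-1) b) * vtxK h 1).dilate h (k + 1) := by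
  have key := vtxG_dilate_mul_vtxTs hg 1 c
  rw [vtxTs, if_pos rfl, Units.val_one, Int.cast_one, one_mul, one_mul] at key
  rw [vtxT_eq h k 1 b, dilate_mul, dilate_dilate, dilate_dilate, mul_right_comm,
    show k + 1 + (2 * k + 2) = 3 * k + 3 by ring, show -(k + 1) + (2 * k + 2) = k + 1 by ring, key,
    ← dilate_mul, ← mul_assoc, mul_right_comm]

theorem vtxT_dilate_neg_mul_vtxT (hg : Generic h k) (a d : ℤˣ) :
    (vtxT h k a 1).dilate h (-(2 * k + 2)) * vtxT h k 1 d =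
      (vtxK h (-1) * (vtxG h k 1 a * vtxG h k (-1) d) * vtxK h 1).dilate h (-(k + 1)) := by
  have key := vtxG_dilate_mul_vtxTs hg (-1) d
  rw [vtxTs, if_neg neg_one_ne_one_units, Units.val_neg, Units.val_one, Int.cast_neg, Int.cast_one,
    neg_one_mul, neg_one_mul] at key
  rw [vtxT_eq h k a 1, dilate_mul, dilate_dilate, dilate_dilate, mul_assoc,
    show -(k + 1) + -(2 * k + 2) = -(3 * k + 3) by ring,
    show k + 1 + -(2 * k + 2) = -(k + 1) by ring, key, ← dilate_mul]
  congr 1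
  ac_rfl

theorem commutator₃_eq {R : Type*} [Ring R] [Algebra ℂ R] (x₁ x₂ x₃ : ℂ)
    (a₁ a₂ a₃ t₁ t₂ t₃ : R) :
    (x₁ • a₁ + x₂ • a₂ + x₃ • a₃) * (x₁ • t₁ + x₂ • t₂ + x₃ • t₃) -
        (x₁ • t₁ + x₂ • t₂ + x₃ • t₃) * (x₁ • a₁ + x₂ • a₂ + x₃ • a₃) =
      (x₁ * x₁) • (a₁ * t₁ - t₁ * a₁) + (x₁ * x₂) • (a₁ * t₂ - t₂ * a₁) +
        (x₁ * x₃) • (a₁ * t₃ - t₃ * a₁) + (x₂ * x₁) • (a₂ * t₁ - t₁ * a₂) +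
        (x₂ * x₂) • (a₂ * t₂ - t₂ * a₂) + (x₂ * x₃) • (a₂ * t₃ - t₃ * a₂) +
        (x₃ * x₁) • (a₃ * t₁ - t₁ * a₃) + (x₃ * x₂) • (a₃ * t₂ - t₂ * a₃) +
        (x₃ * x₃) • (a₃ * t₃ - t₃ * a₃) := by
  simp only [add_mul, mul_add, smul_mul_smul_comm]
  module

theorem commutator₃_end_eq (x₁ x₂ x₃ : ℂ) (a₁ a₂ a₃ t₁ t₂ t₃ : Module.End ℂ Fock) :
    (x₁ • a₁ + x₂ • a₂ + x₃ • a₃) * (x₁ • t₁ + x₂ • t₂ + x₃ • t₃) -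
        (x₁ • t₁ + x₂ • t₂ + x₃ • t₃) * (x₁ • a₁ + x₂ • a₂ + x₃ • a₃) =
      (x₁ * x₁) • (a₁ * t₁ - t₁ * a₁) + (x₁ * x₂) • (a₁ * t₂ - t₂ * a₁) +
        (x₁ * x₃) • (a₁ * t₃ - t₃ * a₁) + (x₂ * x₁) • (a₂ * t₁ - t₁ * a₂) +
        (x₂ * x₂) • (a₂ * t₂ - t₂ * a₂) + (x₂ * x₃) • (a₂ * t₃ - t₃ * a₂) +
        (x₃ * x₁) • (a₃ * t₁ - t₁ * a₃) + (x₃ * x₂) • (a₃ * t₂ - t₂ * a₃) +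
        (x₃ * x₃) • (a₃ * t₃ - t₃ * a₃) :=
  commutator₃_eq x₁ x₂ x₃ a₁ a₂ a₃ t₁ t₂ t₃

/-- The coefficients of the vertex operators of `W(z)`. -/
def wCoef (h k : ℂ) (a b : ℤˣ) : ℂ :=
  if a = 1 then
    if b = 1 then -(qn h (2 * k + 3) / (qn h (k + 1) * qn h (2 * k + 2)))
    else qp h (-1) / qn h (k + 1)
  else if b = 1 then qp h 1 / qn h (k + 1) else -(1 / qn h (k + 2))

/-- The vertex operators of `K^-(z) W(z) K^+(z)`. -/
def vtxKW (h k : ℂ) (a b : ℤˣ) : Vertex :=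
  vtxK h (-1) * (vtxG h k 1 a * vtxG h k (-1) b) * vtxK h 1

/-- `K^-(z) W(z) K^+(z)`. -/
def currentKW (h k m : ℂ) : Module.End ℂ Fock :=
  wCoef h k 1 1 • (vtxKW h k 1 1).field h k m + wCoef h k 1 (-1) • (vtxKW h k 1 (-1)).field h k m +
    wCoef h k (-1) 1 • (vtxKW h k (-1) 1).field h k m +
    wCoef h k (-1) (-1) • (vtxKW h k (-1) (-1)).field h k m

-- The possible poles are z = w and z = q^(±2(k+1)) w. The first kind cancels in pairs of summands,
-- and the other two both yield K^-WK^+.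
open Classical in
theorem wakimoto_commutator_TT (hg : Generic h k) (m n : ℂ) :
    (wakimoto h k).T m * (wakimoto h k).T n - (wakimoto h k).T n * (wakimoto h k).T m =
      if m ∈ Sector.R.modes then
        (qq h * (qn h (k + 2) ^ 2 / qn h (k + 1))) •
          (qp h ((2 * k + 2) * m) • qp h (-(k + 1) * (m + n)) • currentKW h k (m + n) +
            (-(qp h (-(2 * k + 2) * m) * qp h (- -(k + 1) * (m + n)))) • currentKW h k (m + n))
      else 0 := by
  obtain ⟨c11, c12, c13, c21, c22, c23, c31, c32, c33⟩ := contraction_vtxT_table hg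
  have k11 := vtxT_commutator (h := h) (k := k) (a := 1) (b := -1) (c := 1) (d := -1) (D := 0)
    (by rw [c11, coeffZ_one_sub 1 rfl]) m n
  have k33 := vtxT_commutator (h := h) (k := k) (a := -1) (b := 1) (c := -1) (d := 1) (D := 0)
    (by rw [c33, coeffZ_one_sub 1 rfl]) m n
  have k12 := vtxT_commutator (h := h) (k := k) (a := 1) (b := -1) (c := 1) (d := 1)
    (D := ttCoef h k) (by rw [c12, c21]; exact ttCoef_eq hg) m n
  have k13 := vtxT_commutator (h := h) (k := k) (a := 1) (b := -1) (c := -1) (d := 1)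
    (D := ttCoef h k) (by rw [c13, c31]; exact ttCoef_eq hg) m n
  have k23 := vtxT_commutator (h := h) (k := k) (a := 1) (b := 1) (c := -1) (d := 1)
    (D := ttCoef h k) (by rw [c23, c32]; exact ttCoef_eq hg) m n
  have k21 := vtxT_commutator (h := h) (k := k) (a := 1) (b := 1) (c := 1) (d := -1)
    (D := ttCoef' h k) (by rw [c12, c21]; exact ttCoef'_eq hg) m n
  have k31 := vtxT_commutator (h := h) (k := k) (a := -1) (b := 1) (c := 1) (d := -1)
    (D := ttCoef' h k) (by rw [c13, c31]; exact ttCoef'_eq hg) m n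
  have k32 := vtxT_commutator (h := h) (k := k) (a := -1) (b := 1) (c := 1) (d := 1)
    (D := ttCoef' h k) (by rw [c23, c32]; exact ttCoef'_eq hg) m n
  have k22 := vtxT_commutator (h := h) (k := k) (a := 1) (b := 1) (c := 1) (d := 1)
    (D := ttCoefDiag h k) (by rw [c22]; exact ttCoefDiag_eq hg) m n
  rw [wakimoto_T]
  dsimp only
  rw [commutator₃_end_eq, k11, k12, k13, k21, k22, k23, k31, k32, k33]
  have hz := fun a b B u => bilocal_qpSeq_of_zpow h k (vtxT h k a b) B (vtxT_zpow h k a b) u m n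
  obtain ⟨r1, r2, r3, r4, r5, r6⟩ := residue_tt hg
  have hne := generic_ne hg
  simp only [ttCoef, ttCoef', ttCoefDiag, bilocal_zero, bilocal_add, bilocal_smul, hz, r1, r2, r3,
    r4, r5, r6]
  simp only [vtxT_dilate_mul_vtxT hg, vtxT_dilate_neg_mul_vtxT hg, field_dilate, neg_zero,
    dilate_zero]
  -- At z = w the order of the factors is immaterial, so the residues for two summands taken in the
  -- two orders are opposite multiples of one operator.
  rw [mul_comm (vtxT h k 1 1) (vtxT h k 1 (-1)), mul_comm (vtxT h k (-1) 1) (vtxT h k 1 (-1)),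
    mul_comm (vtxT h k (-1) 1) (vtxT h k 1 1)]
  split_ifs
  · simp only [currentKW, vtxKW]
    have hx := qp_ne_zero h 1
    have hp := qp_ne_zero h k
    obtain ⟨h1, h2, h3, h4⟩ := hne
    obtain ⟨n1, n2, n3, n4⟩ := qn_values hg
    simp only [wCoef, if_true, if_neg neg_one_ne_one_units, n1, n2, n3, n4, qq_eq, qp_neg h 1]
    match_scalars <;> field_simp <;> ring
  · module

end TT

/-! ### From ordering by powers of w/z to ordering by modes. -/

section NormalSums

/-- The weight of the normal ordering in the modes labelled by `j`, where `2 * j + e` is the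
difference of the two modes. -/
def step (e j : ℤ) : ℂ := if 2 * j + e = 0 then 1 / 2 else if 0 < 2 * j + e then 0 else 1

/-- The difference of the orderings by modes and by powers of `w / z`. -/
def stepDiff (e l j : ℤ) : ℂ := (if j ≤ l then 1 else 0) - step e j

theorem finite_stepDiff (e l : ℤ) (c : ℤ → ℂ) :
    {j | stepDiff e l j * c (l - j) ≠ 0}.Finite := by
  refine (Set.finite_Icc (min l (-|e|)) (max l |e|)).subset fun j hj => ?_
  have h0 : stepDiff e l j ≠ 0 := left_ne_zero_of_mul hj
  have h1 := neg_abs_le e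
  have h2 := le_abs_self e
  rw [stepDiff, step] at h0
  by_contra h3
  rw [Set.mem_Icc] at h3
  split_ifs at h0 <;> first | omega | exact h0 (by norm_num)

/-- The sums over modes which occur in the normal ordered product. -/
def stepSum (e : ℤ) (c : ℤ → ℂ) : ℤ → ℂ := fun l => ∑ᶠ j, stepDiff e l j * c (l - j)

theorem stepSum_add (e : ℤ) (c d : ℤ → ℂ) : stepSum e (c + d) = stepSum e c + stepSum e d := by
  funext l
  rw [Pi.add_apply, stepSum, stepSum, stepSum,
    ← finsum_add_distrib (finite_stepDiff e l c) (finite_stepDiff e l d)]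
  simp only [Pi.add_apply, mul_add]

theorem stepSum_smul (e : ℤ) (a : ℂ) (c : ℤ → ℂ) : stepSum e (a • c) = a • stepSum e c := by
  funext l
  rw [Pi.smul_apply, stepSum, stepSum, smul_finsum]
  simp only [Pi.smul_apply, smul_eq_mul, mul_left_comm]

/-- Passing from l to l + 1 multiplies every geometric term by q^u and moves the indicator over the
one new index j = l + 1, whose term is 1. -/
theorem stepSum_qpSeq_add_one (h u : ℂ) (e l : ℤ) :
    stepSum e (qpSeq h u) (l + 1) = qp h u * stepSum e (qpSeq h u) l + 1 := by
  have h1 : (1 : ℂ) = ∑ᶠ j : ℤ, if j = l + 1 then (1 : ℂ) else 0 := by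
    rw [finsum_eq_single _ (l + 1) fun j hj => if_neg hj, if_pos rfl]
  conv_rhs => rw [h1]
  rw [stepSum, stepSum, ← smul_eq_mul, smul_finsum, ← finsum_add_distrib]
  · refine finsum_congr fun j => ?_
    have h2 : qpSeq h u (l + 1 - j) = qp h u * qpSeq h u (l - j) := by
      rw [qpSeq, qpSeq, ← qp_add]
      congr 1
      push_cast
      ring
    rw [h2, stepDiff, stepDiff]
    by_cases hj : j = l + 1
    · have h3 : qp h u * qpSeq h u (l - j) = 1 := by
        rw [← h2, hj, sub_self, qpSeq, Int.cast_zero, mul_zero, qp_zero]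
      rw [if_pos hj, if_pos hj.le, if_neg (by omega), smul_eq_mul]
      linear_combination h3
    · rw [if_neg hj, smul_eq_mul]
      by_cases hj' : j ≤ l
      · rw [if_pos hj', if_pos (by omega)]
        ring
      · rw [if_neg hj', if_neg (by omega)]
        ring
  · refine (finite_stepDiff e l (qpSeq h u)).subset fun j hj => ?_
    exact right_ne_zero_of_mul (a := qp h u) (by simpa using hj)
  · exact (Set.finite_singleton (l + 1)).subset fun j hj => by
      by_contra h0
      exact hj (if_neg h0)

theorem eq_of_recursion {a : ℂ} (ha : a ≠ 0) {f g : ℤ → ℂ} (hf : ∀ l, f (l + 1) = a * f l + 1)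
    (hg : ∀ l, g (l + 1) = a * g l + 1) {i : ℤ} (hi : f i = g i) : f = g := by
  funext l
  induction l using Int.inductionOn' (b := i) with
  | zero => exact hi
  | succ l _ ih => rw [hf, hg, ih]
  | pred l _ ih =>
    have h1 := hf (l - 1)
    have h2 := hg (l - 1)
    rw [sub_add_cancel] at h1 h2
    rw [h1, h2] at ih
    exact mul_left_cancel₀ ha (add_right_cancel ih)

-- The recursion has the constant solution 1/(1 - q^(2w)) and the homogeneous solution q^(2wl),
-- whose coefficient is fixed by one value. That value depends on the parity of e, because equal
-- modes can occur only for even e; this is the origin of c^A_m.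
open Classical in
theorem stepSum_qpSeq {h w : ℂ} (hq : qq h ≠ 0) (hw : qp h (2 * w) ≠ 1) (e : ℤ) :
    stepSum e (qpSeq h (2 * w)) = (1 / (1 - qp h (2 * w))) • qpSeq h 0 +
      (qp h (w * e) * (if Even e then 1 / qn h w * ((qp h w + qp h (-w)) / 2) else 1 / qn h w) /
        qq h) • qpSeq h (2 * w) := by
  have hx := qp_ne_zero h w
  have e1 : qp h (2 * w) = qp h w ^ 2 := by rw [two_mul, qp_add, sq]
  have h1 : 1 - qp h w ^ 2 ≠ 0 := fun h0 => hw (by rw [e1]; linear_combination -h0)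
  have h2 : qp h w ^ 2 - 1 ≠ 0 := fun h0 => hw (by rw [e1]; linear_combination h0)
  have hn : qn h w = (qp h w ^ 2 - 1) / (qp h w * qq h) := by
    rw [qn, qp_neg]
    field_simp
  have h0 : ∀ l, qpSeq h 0 l = 1 := fun l => by rw [qpSeq, zero_mul, qp_zero]
  -- The chosen index is where the two orderings agree best: for even e only the term of equal modes
  -- remains, with value 1/2, and for odd e the sum is empty.
  refine eq_of_recursion (qp_ne_zero h (2 * w)) (stepSum_qpSeq_add_one h (2 * w) e) (fun l => ?_)
    (i := -((e + 1) / 2)) ?_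
  · have h3 : qpSeq h (2 * w) (l + 1) = qp h (2 * w) * qpSeq h (2 * w) l := by
      rw [qpSeq, qpSeq, ← qp_add]
      congr 1
      push_cast
      ring
    simp only [Pi.add_apply, Pi.smul_apply, smul_eq_mul, h3, h0, e1]
    field_simp
    ring
  · simp only [Pi.add_apply, Pi.smul_apply, smul_eq_mul, h0, e1, hn]
    rcases Int.even_or_odd' e with ⟨r, rfl | rfl⟩
    · have hr : (2 * r + 1) / 2 = r := by omega
      have h4 : qp h (w * (2 * r : ℤ)) * qpSeq h (2 * w) (-r) = 1 := by
        rw [qpSeq, ← qp_add, ← qp_zero h]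
        congr 1
        push_cast
        ring
      rw [hr, if_pos (even_two_mul r), stepSum, finsum_eq_single _ (-r)]
      · rw [stepDiff, step, if_pos le_rfl, if_pos (by ring), sub_self, qpSeq, Int.cast_zero,
          mul_zero, qp_zero, qp_neg]
        have h5 : qpSeq h (2 * w) (-r) = (qp h (w * (2 * r : ℤ)))⁻¹ := eq_inv_of_mul_eq_one_right h4
        have h6 := qp_ne_zero h (w * (2 * r : ℤ))
        rw [h5]
        field_simp
        ring
      · intro j hj
        have : stepDiff (2 * r) (-r) j = 0 := by
          rw [stepDiff, step]
          split_ifs <;> first | omega | norm_num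
        rw [this, zero_mul]
    · have hr : (2 * r + 1 + 1) / 2 = r + 1 := by omega
      have h4 : qp h (w * (2 * r + 1 : ℤ)) * qpSeq h (2 * w) (-(r + 1)) = (qp h w)⁻¹ := by
        rw [qpSeq, ← qp_add, ← qp_neg]
        congr 1
        push_cast
        ring
      have h7 : ¬ Even (2 * r + 1) := by simp
      rw [hr, if_neg h7, stepSum]
      have : ∀ j, stepDiff (2 * r + 1) (-(r + 1)) j = 0 := fun j => by
        rw [stepDiff, step]
        split_ifs <;> first | omega | norm_num
      simp only [this, zero_mul, finsum_zero]
      have h5 : qpSeq h (2 * w) (-(r + 1)) = (qp h w)⁻¹ * (qp h (w * (2 * r + 1 : ℤ)))⁻¹ := by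
        rw [eq_mul_inv_iff_mul_eq₀ (qp_ne_zero h _), mul_comm, h4]
      have h6 := qp_ne_zero h (w * (2 * r + 1 : ℤ))
      rw [h5]
      field_simp
      ring

-- The integer e is m + 1 in the NS sector and m in the R sector, so the opposite parity conventions
-- in the definition of c^A_m become one condition on e.
open Classical in
theorem cCoeff_eq (h w : ℂ) {A : Sector} {m : ℂ} {e : ℤ} (he : (e : ℂ) = m + 2 * A.offset) :
    cCoeff h A w m =
      if Even e then 1 / qn h w * ((qp h w + qp h (-w)) / 2) else 1 / qn h w := by
  cases A
  · simp only [Sector.offset] at he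
    have : (∃ j : ℤ, m = 2 * j) ↔ ¬ Even e := by
      rw [Int.not_even_iff_odd]
      refine ⟨fun ⟨j, hj⟩ => ⟨j, ?_⟩, fun ⟨j, hj⟩ => ⟨j, ?_⟩⟩
      · exact_mod_cast (show (e : ℂ) = 2 * j + 1 by rw [he, hj]; ring)
      · rw [hj] at he
        push_cast at he
        linear_combination -he
    rw [cCoeff]
    by_cases h1 : Even e <;> simp only [this, h1, not_true, not_false_eq_true, if_true, if_false]
  · simp only [Sector.offset, mul_zero, add_zero] at he
    have : (∃ j : ℤ, m = 2 * j) ↔ Even e := by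
      rw [even_iff_exists_two_mul]
      refine ⟨fun ⟨j, hj⟩ => ⟨j, ?_⟩, fun ⟨j, hj⟩ => ⟨j, ?_⟩⟩
      · exact_mod_cast (show (e : ℂ) = 2 * j by rw [he, hj])
      · rw [← he, hj]
        push_cast
        ring
    rw [cCoeff]
    by_cases h1 : Even e <;> simp only [this, h1, if_true, if_false]

end NormalSums

/-! ### The normal ordered product of G^+ and G^- in terms of bilocal operators. -/

section NormalTerms

variable {h k : ℂ}

/-- G^+G^- contributes in degrees l ≥ j with weight 1 - step, and G^-G^+ in degrees l < j with
weight -step. Both cases are the single weight `stepDiff`. -/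
theorem bilocal_stepDiff (hg : Generic h k) (a b : ℤˣ) (e j : ℤ) (o m : ℂ) :
    bilocal h k (vtxG h k 1 a) (vtxG h k (-1) b)
        (fun l => stepDiff e l j * ggCoef h k a b (l - j)) (-o - 1 / 2) (m + o + 1 / 2) =
      (1 - step e j) • ((vtxG h k 1 a).field h k (-(j + o) + 1 / 2) *
          (vtxG h k (-1) b).field h k (m + (j + o) + 1 / 2)) +
        (-step e j) • ((vtxG h k (-1) b).field h k (m + (j + o) + 1 / 2) *
          (vtxG h k 1 a).field h k (-(j + o) + 1 / 2)) := by
  rw [vtxG_pos_mul_neg hg, vtxG_neg_mul_pos hg, ← bilocal_smul, ← bilocal_smul, ← bilocal_add,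
    show -((j : ℂ) + o) + 1 / 2 - 1 = -o - 1 / 2 + ((-j : ℤ) : ℂ) by push_cast; ring, bilocal_shift,
    show m + ((j : ℂ) + o) + 1 / 2 + ((-j : ℤ) : ℂ) = m + o + 1 / 2 by push_cast; ring]
  congr 1
  funext l
  simp only [Pi.add_apply, Pi.smul_apply, smul_eq_mul, stepDiff, ← sub_eq_add_neg, sub_nonneg]
  split_ifs <;> ring

theorem product_eq {R : Type*} [Ring R] [Algebra ℂ R] (c d s : ℂ) (a₁ a₂ b₁ b₂ : R) :
    (1 - s) • ((c • a₁ + (-c) • a₂) * (d • b₁ + (-d) • b₂)) +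
        (-s) • ((d • b₁ + (-d) • b₂) * (c • a₁ + (-c) • a₂)) =
      (c * d) • (((1 - s) • (a₁ * b₁) + (-s) • (b₁ * a₁)) - ((1 - s) • (a₁ * b₂) + (-s) • (b₂ * a₁)) -
        ((1 - s) • (a₂ * b₁) + (-s) • (b₁ * a₂)) + ((1 - s) • (a₂ * b₂) + (-s) • (b₂ * a₂))) := by
  simp only [add_mul, mul_add, smul_mul_smul_comm]
  module

theorem product_end_eq (c d s : ℂ) (a₁ a₂ b₁ b₂ : Module.End ℂ Fock) :
    (1 - s) • ((c • a₁ + (-c) • a₂) * (d • b₁ + (-d) • b₂)) +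
        (-s) • ((d • b₁ + (-d) • b₂) * (c • a₁ + (-c) • a₂)) =
      (c * d) • (((1 - s) • (a₁ * b₁) + (-s) • (b₁ * a₁)) - ((1 - s) • (a₁ * b₂) + (-s) • (b₂ * a₁)) -
        ((1 - s) • (a₂ * b₁) + (-s) • (b₁ * a₂)) + ((1 - s) • (a₂ * b₂) + (-s) • (b₂ * a₂))) :=
  product_eq c d s a₁ a₂ b₁ b₂

/-- The difference of the labels of G^- and G^+ is 2j + e, so its sign decides the order and the
value zero gives the weights one half. -/
theorem normalTerm_eq_step {M : Type*} [AddCommGroup M] [Module ℂ M] (C : Currents M) {A : Sector}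
    {m : ℂ} {e : ℤ} (he : (e : ℂ) = m + 2 * A.offset) (j : ℤ) :
    C.normalTerm A m j =
      (1 - step e j) • (C.G 1 (-(j + A.offset)) * C.G (-1) (m + (j + A.offset))) +
        (-step e j) • (C.G (-1) (m + (j + A.offset)) * C.G 1 (-(j + A.offset))) := by
  obtain rfl : m = e - 2 * A.offset := by rw [he]; ring
  have h1 : -((j : ℂ) + A.offset) = e - 2 * A.offset + (j + A.offset) ↔ 2 * j + e = 0 := by
    rw [← Int.cast_eq_zero (α := ℂ)]
    push_cast
    exact ⟨fun h0 => by linear_combination -h0, fun h0 => by linear_combination -h0⟩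
  have h2 : (-((j : ℂ) + A.offset)).re < ((e : ℂ) - 2 * A.offset + (j + A.offset)).re ↔
      0 < 2 * j + e := by
    rw [← Int.cast_pos (R := ℝ)]
    have : ((2 : ℂ) * A.offset).re = 2 * A.offset.re := by simp
    simp only [Complex.neg_re, Complex.add_re, Complex.sub_re, Complex.intCast_re, this]
    push_cast
    constructor <;> intro h0 <;> linarith
  simp only [Currents.normalTerm, Currents.normalGG, h1, h2, step]
  split_ifs with h3
  · rw [← h1.2 h3]
    module
  · module
  · module

theorem wakimoto_normalTerm (hg : Generic h k) {A : Sector} {m : ℂ} {e : ℤ}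
    (he : (e : ℂ) = m + 2 * A.offset) (j : ℤ) :
    (wakimoto h k).normalTerm A m j = (1 / qq h * (-1 / qq h)) •
      (bilocal h k (vtxG h k 1 1) (vtxG h k (-1) 1)
          (fun l => stepDiff e l j * ggCoef h k 1 1 (l - j))
          (-A.offset - 1 / 2) (m + A.offset + 1 / 2) -
        bilocal h k (vtxG h k 1 1) (vtxG h k (-1) (-1))
          (fun l => stepDiff e l j * ggCoef h k 1 (-1) (l - j))
          (-A.offset - 1 / 2) (m + A.offset + 1 / 2) -
        bilocal h k (vtxG h k 1 (-1)) (vtxG h k (-1) 1)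
          (fun l => stepDiff e l j * ggCoef h k (-1) 1 (l - j))
          (-A.offset - 1 / 2) (m + A.offset + 1 / 2) +
        bilocal h k (vtxG h k 1 (-1)) (vtxG h k (-1) (-1))
          (fun l => stepDiff e l j * ggCoef h k (-1) (-1) (l - j))
          (-A.offset - 1 / 2) (m + A.offset + 1 / 2)) := by
  rw [normalTerm_eq_step _ he, wakimoto_G, wakimoto_G]
  dsimp only
  rw [product_end_eq]
  rw [bilocal_stepDiff hg 1 1, bilocal_stepDiff hg 1 (-1), bilocal_stepDiff hg (-1) 1,
    bilocal_stepDiff hg (-1) (-1)]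
  simp only [Units.val_one, Units.val_neg, Int.cast_one, Int.cast_neg]

theorem lfSum_wakimoto_normalTerm (hg : Generic h k) {A : Sector} {m : ℂ} {e : ℤ}
    (he : (e : ℂ) = m + 2 * A.offset) (v : Fock) :
    lfSum ((wakimoto h k).normalTerm A m) v = (1 / qq h * (-1 / qq h)) •
      (bilocal h k (vtxG h k 1 1) (vtxG h k (-1) 1) (stepSum e (ggCoef h k 1 1))
          (-A.offset - 1 / 2) (m + A.offset + 1 / 2) v -
        bilocal h k (vtxG h k 1 1) (vtxG h k (-1) (-1)) (stepSum e (ggCoef h k 1 (-1)))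
          (-A.offset - 1 / 2) (m + A.offset + 1 / 2) v -
        bilocal h k (vtxG h k 1 (-1)) (vtxG h k (-1) 1) (stepSum e (ggCoef h k (-1) 1))
          (-A.offset - 1 / 2) (m + A.offset + 1 / 2) v +
        bilocal h k (vtxG h k 1 (-1)) (vtxG h k (-1) (-1)) (stepSum e (ggCoef h k (-1) (-1)))
          (-A.offset - 1 / 2) (m + A.offset + 1 / 2) v) := by
  have key := fun a b => finsum_bilocal h k (vtxG h k 1 a) (vtxG h k (-1) b)
    (fun j l => stepDiff e l j * ggCoef h k a b (l - j))
    (fun l => finite_stepDiff e l (ggCoef h k a b)) (-A.offset - 1 / 2) (m + A.offset + 1 / 2) v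
  obtain ⟨f1, s1⟩ := key 1 1
  obtain ⟨f2, s2⟩ := key 1 (-1)
  obtain ⟨f3, s3⟩ := key (-1) 1
  obtain ⟨f4, s4⟩ := key (-1) (-1)
  have hs : ∀ c, stepSum e c = fun l => ∑ᶠ j, stepDiff e l j * c (l - j) := fun _ => rfl
  rw [hs, hs, hs, hs, ← s1, ← s2, ← s3, ← s4]
  have f12 := (f1.union f2).subset (Function.support_sub _ _)
  have f123 := (f12.union f3).subset (Function.support_sub _ _)
  rw [← finsum_sub_distrib f1 f2, ← finsum_sub_distrib f12 f3, ← finsum_add_distrib f123 f4,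
    smul_finsum, lfSum_apply (pointwiseFinite_normalTerm _ (truncated_wakimoto_G h k) A m)]
  refine finsum_congr fun j => ?_
  rw [wakimoto_normalTerm hg he]
  rfl

end NormalTerms

/-! ### Identification of the current W. -/

section CurrentW

variable {h k : ℂ} {A : Sector} {ρ σ : ℂ}

theorem vtxG_shift_eq (h k : ℂ) (s a : ℤˣ) :
    (vtxG h k s a).shift = ![(k + 2) * ((s : ℤ) : ℂ), 2 * ((s : ℤ) : ℂ), 0] := by
  rw [vtxG_shift]
  funext i
  fin_cases i <;> simp [mul_comm]

theorem shift_eq_of_zero {V : Vertex} (hV : V.shift = 0) (k : ℂ) :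
    V.shift = ![(k + 2) * ((0 : ℤ) : ℂ), 2 * ((0 : ℤ) : ℂ), 0] := by
  rw [hV]
  funext i
  fin_cases i <;> simp

theorem wakimoto_K_mem (s : ℤˣ) (m : ℂ) {v : Fock} (hv : v ∈ fockSpace k A ρ σ) :
    (wakimoto h k).K s m v ∈ fockSpace k A ρ σ :=
  field_mem_fockSpace (shift_eq_of_zero rfl k) m hv

theorem wakimoto_T_mem (m : ℂ) {v : Fock} (hv : v ∈ fockSpace k A ρ σ) :
    (wakimoto h k).T m v ∈ fockSpace k A ρ σ := by
  have key := fun a b => field_mem_fockSpace (h := h) (shift_eq_of_zero (vtxT_shift h k a b) k) m hv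
  rw [wakimoto_T]
  exact add_mem (add_mem (Submodule.smul_mem _ _ (key 1 (-1))) (Submodule.smul_mem _ _ (key 1 1)))
    (Submodule.smul_mem _ _ (key (-1) 1))

theorem wakimoto_G_mem (s : ℤˣ) (m : ℂ) {v : Fock} (hv : v ∈ fockSpace k A ρ σ) :
    (wakimoto h k).G s m v ∈ fockSpace k A ρ σ := by
  have key := fun a => field_mem_fockSpace (h := h) (vtxG_shift_eq h k s a) (m + 1 / 2) hv
  rw [wakimoto_G]
  exact add_mem (Submodule.smul_mem _ _ (key 1)) (Submodule.smul_mem _ _ (key (-1)))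

theorem wakimoto_G_eq_zero (hk : k ≠ 0) (s : ℤˣ) {m : ℂ} (hm : m ∉ A.modes) {v : Fock}
    (hv : v ∈ fockSpace k A ρ σ) : (wakimoto h k).G s m v = 0 := by
  have hm' : m + 1 / 2 - 1 / 2 ∉ A.modes := by rwa [add_sub_cancel_right]
  rw [wakimoto_G]
  simp only [LinearMap.add_apply, LinearMap.smul_apply, field_vtxG_eq_zero hk s _ hm' hv, smul_zero,
    add_zero]

theorem wakimoto_T_eq_zero (h k : ℂ) {m : ℂ} (hm : ∀ n : ℤ, m ≠ n) : (wakimoto h k).T m = 0 := by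
  rw [wakimoto_T]
  simp only [field_eq_zero_of_zpow h k (vtxT_zpow h k _ _) hm, smul_zero, add_zero]

/-- The current `W(z)` in terms of vertex operators. -/
def currentW (h k m : ℂ) : Module.End ℂ Fock :=
  wCoef h k 1 1 • (vtxG h k 1 1 * vtxG h k (-1) 1).field h k m +
    wCoef h k 1 (-1) • (vtxG h k 1 1 * vtxG h k (-1) (-1)).field h k m +
    wCoef h k (-1) 1 • (vtxG h k 1 (-1) * vtxG h k (-1) 1).field h k m +
    wCoef h k (-1) (-1) • (vtxG h k 1 (-1) * vtxG h k (-1) (-1)).field h k m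

theorem vtxG_mul_zpow (h k : ℂ) (a b : ℤˣ) : (vtxG h k 1 a * vtxG h k (-1) b).zpow = 0 := by
  have := vtxT_zpow h k a b
  rw [vtxT_eq] at this
  exact this

theorem add_offset_notMem_modes {m : ℂ} (hm : ∀ n : ℤ, m ≠ n) (j : ℤ) :
    m + (j + A.offset) ∉ A.modes := fun ⟨i, hi⟩ =>
  hm (i - j) (by push_cast; linear_combination hi)

theorem wakimoto_normalTerm_eq_zero (hk : k ≠ 0) {m : ℂ} (hm : ∀ n : ℤ, m ≠ n) (j : ℤ) {v : Fock}
    (hv : v ∈ fockSpace k A ρ σ) : (wakimoto h k).normalTerm A m j v = 0 := by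
  have hq := add_offset_notMem_modes (A := A) hm j
  have h0 : ∀ w ∈ fockSpace k A ρ σ, (wakimoto h k).G (-1) (m + (j + A.offset)) w = 0 :=
    fun w hw => wakimoto_G_eq_zero hk _ hq hw
  have h1 : (wakimoto h k).G 1 (-(j + A.offset)) v ∈ fockSpace k A ρ σ := wakimoto_G_mem _ _ hv
  rw [Currents.normalTerm, Currents.normalGG]
  split_ifs with h2
  · rw [← h2] at h0
    simp only [LinearMap.smul_apply, LinearMap.sub_apply, Module.End.mul_apply, h0 v hv, h0 _ h1,
      map_zero, sub_zero, smul_zero]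
  · rw [Module.End.mul_apply, h0 v hv, map_zero]
  · rw [LinearMap.neg_apply, Module.End.mul_apply, h0 _ h1, neg_zero]

theorem wakimoto_W_eq_zero (hk : k ≠ 0) {m : ℂ} (hm : ∀ n : ℤ, m ≠ n) {v : Fock}
    (hv : v ∈ fockSpace k A ρ σ) : (wakimoto h k).W h k A m v = 0 := by
  have h1 : lfSum ((wakimoto h k).normalTerm A m) v = 0 := by
    rw [lfSum_apply (pointwiseFinite_normalTerm _ (truncated_wakimoto_G h k) A m)]
    simp only [wakimoto_normalTerm_eq_zero hk hm _ hv, finsum_zero]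
  have h2 : m ≠ 0 := by simpa using hm 0
  have h3 : (vtxK h (-1) * vtxK h 1).zpow = 0 := by
    change (0 : Fin 3 → ℂ) + 0 = 0
    rw [add_zero]
  simp only [Currents.W, LinearMap.sub_apply, LinearMap.smul_apply, h1,
    wakimoto_T_eq_zero h k hm, wakimoto_KK, field_eq_zero_of_zpow h k h3 hm, oneSeries, if_neg h2,
    LinearMap.zero_apply, smul_zero, add_zero, sub_zero]

theorem offset_modes (A : Sector) : -A.offset - 1 / 2 - 1 / 2 ∈ A.modes := by
  cases A
  · exact ⟨-2, by simp only [Sector.offset]; push_cast; ring⟩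
  · exact ⟨-1, by simp only [Sector.offset]; push_cast; ring⟩

/-- The constant parts of the mode sums add up to the contraction functions at z = w and give the
coefficients `wCoef`. The geometric parts reproduce K, 1 and T with the factors c^A_m, and the first
three terms in the definition of W remove them. -/
theorem wakimoto_W_of_int (hg : Generic h k) {m : ℂ} {e : ℤ} (he : (e : ℂ) = m + 2 * A.offset)
    {v : Fock} (hv : v ∈ fockSpace k A ρ σ) :
    (wakimoto h k).W h k A m v = currentW h k m v := by
  have hk := k_ne_zero hg
  have hx := qp_ne_zero h 1
  have hp := qp_ne_zero h k
  obtain ⟨h1, h2, h3, h4⟩ := generic_ne hg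
  obtain ⟨v1, v2, v4, -, -, v3, -, v5, -, -, v6, -⟩ := qp_values h k
  obtain ⟨n1, n2, n3, n4⟩ := qn_values hg
  have hqq := qq_ne_zero hg
  have h23 : qp h k ^ 4 * qp h 1 ^ 4 - 1 ≠ 0 := by
    rw [show qp h k ^ 4 * qp h 1 ^ 4 - 1 =
      (qp h k ^ 2 * qp h 1 ^ 2 - 1) * (qp h k ^ 2 * qp h 1 ^ 2 + 1) by ring]
    exact mul_ne_zero h2 h3
  have key : ∀ w u : ℂ, u = 2 * w → qp h u - 1 ≠ 0 → stepSum e (qpSeq h u) =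
      (1 / (1 - qp h u)) • qpSeq h 0 +
        (qp h (w * e) * cCoeff h A w m / qq h) • qpSeq h u := by
    rintro w u rfl hu
    rw [stepSum_qpSeq hqq (sub_ne_zero.1 hu), cCoeff_eq h w he]
  have s1 := key (k + 1) (2 * k + 2) (by ring) (by rwa [v3])
  have s2 := key (k + 2) (2 * k + 4) (by ring) (by rwa [v5])
  have s3 := key (2 * k + 2) (4 * k + 4) (by ring) (by rwa [v6])
  have b1 : ∀ a b u, bilocal h k (vtxG h k 1 a) (vtxG h k (-1) b) (qpSeq h u)
      (-A.offset - 1 / 2) (m + A.offset + 1 / 2) v = qp h (u * (-A.offset - 1 / 2)) •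
        ((vtxG h k 1 a).dilate h u * vtxG h k (-1) b).field h k m v := fun a b u => by
    rw [bilocal_qpSeq_vtxG hk 1 a _ u _ _ hv, if_pos (offset_modes A)]
    congr 3
    ring
  simp only [Currents.W, currentW, LinearMap.add_apply, LinearMap.sub_apply, LinearMap.smul_apply,
    lfSum_wakimoto_normalTerm hg he, ggCoef, if_true, if_neg neg_one_ne_one_units, stepSum_add,
    stepSum_smul, s1, s2, s3, bilocal_add, bilocal_smul, b1, dilate_zero, zero_mul, qp_zero,
    vtxG_dilate_mul_vtxG, vtxG_dilate_mul_vtxG_one_one hg, vtxG_dilate_mul_vtxG_neg_neg hg,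
    field_one, field_dilate, wakimoto_KK, wakimoto_T]
  have e1 : qp h ((2 * k + 2) * (-A.offset - 1 / 2)) =
      (qp h k * qp h 1)⁻¹ * (qp h ((k + 1) * e))⁻¹ * (qp h (-(k + 1) * m))⁻¹ := by
    rw [← v2, ← qp_neg, ← qp_neg, ← qp_neg, ← qp_add, ← qp_add, he]
    congr 1
    ring
  have e3 : qp h ((4 * k + 4) * (-A.offset - 1 / 2)) =
      (qp h k ^ 2 * qp h 1 ^ 2)⁻¹ * (qp h ((2 * k + 2) * e))⁻¹ *
        (qp h (-(2 * k + 2) * m))⁻¹ := by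
    rw [← v3, ← qp_neg, ← qp_neg, ← qp_neg, ← qp_add, ← qp_add, he]
    congr 1
    ring
  have e2 : qp h ((2 * k + 4) * (-A.offset - 1 / 2)) =
      (qp h k * qp h 1 ^ 2)⁻¹ * (qp h ((k + 2) * e))⁻¹ * qp h ((k + 2) * m) := by
    rw [← v4, ← qp_neg, ← qp_neg, ← qp_add, ← qp_add, he]
    congr 1
    ring
  -- The mode sum yields the factor at label m, the definition of W the one at label 0; the constant
  -- series is supported at m = 0, where they agree.
  have e4 : (cCoeff h A (k + 2) m * qp h ((k + 2) * m)) • (oneSeries m : Module.End ℂ Fock) v =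
      cCoeff h A (k + 2) 0 • (oneSeries m : Module.End ℂ Fock) v := by
    by_cases hm : m = 0
    · rw [hm, mul_zero, qp_zero, mul_one]
    · simp only [oneSeries, if_neg hm, LinearMap.zero_apply, smul_zero]
  rw [← e4]
  have x1 := qp_ne_zero h ((k + 1) * e)
  have x2 := qp_ne_zero h ((k + 2) * e)
  have x3 := qp_ne_zero h ((2 * k + 2) * e)
  have y1 := qp_ne_zero h (-(k + 1) * m)
  have y3 := qp_ne_zero h (-(2 * k + 2) * m)
  have e5 : 1 - qp h k ^ 2 * qp h 1 ^ 2 = -(qp h k ^ 2 * qp h 1 ^ 2 - 1) := by ring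
  have e6 : 1 - qp h k ^ 2 * qp h 1 ^ 4 = -(qp h k ^ 2 * qp h 1 ^ 4 - 1) := by ring
  have e7 : 1 - qp h k ^ 4 * qp h 1 ^ 4 =
    -((qp h k ^ 2 * qp h 1 ^ 2 - 1) * (qp h k ^ 2 * qp h 1 ^ 2 + 1)) := by ring
  have e8 : 1 - (qp h k ^ 2 * qp h 1 ^ 2)⁻¹ =
    (qp h k ^ 2 * qp h 1 ^ 2 - 1) / (qp h k ^ 2 * qp h 1 ^ 2) := by field_simp
  generalize hc1 : cCoeff h A (k + 1) m = c1
  generalize hc2 : cCoeff h A (k + 2) m = c2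
  generalize hc3 : cCoeff h A (2 * k + 2) m = c3
  simp only [e1, e2, e3, wCoef, if_true,
    if_neg neg_one_ne_one_units]
  generalize qp h ((k + 1) * e) = X1 at x1 ⊢
  generalize qp h ((k + 2) * e) = X2 at x2 ⊢
  generalize qp h ((2 * k + 2) * e) = X3 at x3 ⊢
  generalize qp h (-(k + 1) * m) = Y1 at y1 ⊢
  generalize qp h (-(2 * k + 2) * m) = Y3 at y3 ⊢
  simp only [qp_neg h 1, qp_neg h (2 * k + 2), v1, v3, v4, v5, v6, n1, n2, n3, n4, qq_eq, e5, e6, e7, e8]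
  have h3' : qp h 1 ^ 2 * qp h k ^ 2 + 1 ≠ 0 := by rwa [mul_comm]
  match_scalars <;> field_simp <;> ring

theorem wakimoto_W (hg : Generic h k) (m : ℂ) {v : Fock} (hv : v ∈ fockSpace k A ρ σ) :
    (wakimoto h k).W h k A m v = currentW h k m v := by
  by_cases hm : ∃ n : ℤ, m = n
  · obtain ⟨n, rfl⟩ := hm
    cases A
    · exact wakimoto_W_of_int hg (e := n + 1) (by simp [Sector.offset]) hv
    · exact wakimoto_W_of_int hg (e := n) (by simp [Sector.offset]) hv
  · push Not at hm
    rw [wakimoto_W_eq_zero (k_ne_zero hg) hm hv]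
    simp only [currentW, field_eq_zero_of_zpow h k (vtxG_mul_zpow h k _ _) hm, smul_zero, add_zero,
      LinearMap.zero_apply]

end CurrentW

/-! ### The relation for [T,T] with the current W. -/

section TTRelation

variable {h k : ℂ} {A : Sector} {ρ σ : ℂ}

/-- The momentum shifts of G^+ and G^- cancel, so the zero mode of K^- gives no factor and each
triple product is its own normal ordering. -/
theorem mul₃_currentW (h k m : ℂ) :
    mul₃ ((wakimoto h k).K (-1)) (currentW h k) ((wakimoto h k).K 1) m = currentKW h k m := by
  have key : ∀ a b, mul₃ ((wakimoto h k).K (-1)) ((vtxG h k 1 a * vtxG h k (-1) b).field h k)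
      ((wakimoto h k).K 1) m = (vtxKW h k a b).field h k m := fun a b => by
    refine (mul₃_field h k (vtxK_annihilation h k) (vtxK_creation h k) rfl rfl rfl rfl m).trans ?_
    rw [mul_shift, dot_add_right, dot_vtxK_qpow_vtxG_shift, dot_vtxK_qpow_vtxG_shift, ← add_mul]
    simp [vtxKW, qp_zero]
  have ht : ∀ a b, Truncated ((vtxG h k 1 a * vtxG h k (-1) b).field h k) :=
    fun a b => truncated_field h k _
  have hA := suppNeg_wakimoto h k
  have hC := suppPos_wakimoto h k
  have htC := truncated_wakimoto_K h k 1
  have hW : currentW h k = fun m =>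
      (1 : ℂ) • (wCoef h k 1 1 • (vtxG h k 1 1 * vtxG h k (-1) 1).field h k m +
        wCoef h k 1 (-1) • (vtxG h k 1 1 * vtxG h k (-1) (-1)).field h k m) +
      (1 : ℂ) • (wCoef h k (-1) 1 • (vtxG h k 1 (-1) * vtxG h k (-1) 1).field h k m +
        wCoef h k (-1) (-1) • (vtxG h k 1 (-1) * vtxG h k (-1) (-1)).field h k m) := by
    funext m
    rw [currentW]
    module
  rw [hW, mul₃_smul_add_smul hA (((ht _ _).smul _).add ((ht _ _).smul _))
    (((ht _ _).smul _).add ((ht _ _).smul _)) hC htC, mul₃_smul_add_smul hA (ht _ _) (ht _ _) hC htC,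
    mul₃_smul_add_smul hA (ht _ _) (ht _ _) hC htC, key, key, key, key, currentKW]
  module

theorem truncated_currentW (h k : ℂ) : Truncated (currentW h k) :=
  ((((truncated_field h k _).smul _).add ((truncated_field h k _).smul _)).add
    ((truncated_field h k _).smul _)).add ((truncated_field h k _).smul _)

theorem wakimoto_KWK (hg : Generic h k) (m : ℂ) {v : Fock} (hv : v ∈ fockSpace k A ρ σ) :
    mul₃ ((wakimoto h k).K (-1)) ((wakimoto h k).W h k A) ((wakimoto h k).K 1) m v =
      currentKW h k m v := by
  rw [← mul₃_currentW]
  exact mul₃_congr (suppNeg_wakimoto h k) (truncated_wakimoto_W h k A) (truncated_currentW h k)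
    (suppPos_wakimoto h k) (truncated_wakimoto_K h k 1) (fun m _ hv => wakimoto_K_mem 1 m hv)
    (fun m _ hv => wakimoto_W hg m hv) m hv

theorem wakimoto_rel_TT (hg : Generic h k) (A : Sector) (ρ σ : ℂ) :
    EqOnSpace (fockSpace k A ρ σ)
      (zw (wakimoto h k).T (wakimoto h k).T - wz (wakimoto h k).T (wakimoto h k).T)
      ((qq h * (qn h (k + 2) ^ 2 / qn h (k + 1))) •
        (deltaMul h .R (2 * (k + 1)) (rescale h (k + 1)
            (mul₃ ((wakimoto h k).K (-1)) ((wakimoto h k).W h k A) ((wakimoto h k).K 1)))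
          - deltaMul h .R (-(2 * (k + 1))) (rescale h (-(k + 1))
            (mul₃ ((wakimoto h k).K (-1)) ((wakimoto h k).W h k A) ((wakimoto h k).K 1))))) := by
  intro m n v hv
  change ((wakimoto h k).T m * (wakimoto h k).T n - (wakimoto h k).T n * (wakimoto h k).T m) v = _
  rw [wakimoto_commutator_TT hg]
  simp only [Pi.smul_apply, Pi.sub_apply, deltaMul, rescale]
  split_ifs with hm
  · simp only [LinearMap.smul_apply, LinearMap.sub_apply, LinearMap.add_apply, wakimoto_KWK hg _ hv,
      show 2 * k + 2 = 2 * (k + 1) by ring]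
    module
  · simp

end TTRelation

/-! ### Collection of all relations. -/

theorem wakimoto_isRepresentation {h k : ℂ} (hg : Generic h k) (A : Sector) (ρ σ : ℂ) :
    IsRepresentation h k A (fockSpace k A ρ σ) (wakimoto h k) where
  K_mem s m _ hv := wakimoto_K_mem s m hv
  T_mem m _ hv := wakimoto_T_mem m hv
  G_mem s m _ hv := wakimoto_G_mem s m hv
  K_modes s m v _ h0 := by
    by_contra hm
    push Not at hm
    refine h0 ?_
    rcases units_cases s with rfl | rfl
    · rw [suppPos_wakimoto h k m fun n hn => hm n (by simpa using hn), LinearMap.zero_apply]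
    · rw [suppNeg_wakimoto h k m fun n hn => hm n (by simpa using hn), LinearMap.zero_apply]
  T_modes m v _ h0 := by
    by_contra hm
    push Not at hm
    exact h0 (by rw [wakimoto_T_eq_zero h k hm, LinearMap.zero_apply])
  G_modes s m v hv h0 := by
    by_contra hm
    exact h0 (wakimoto_G_eq_zero (k_ne_zero hg) s hm hv)
  finite_KK := pointwiseFinite_mulTerm (suppPos_wakimoto h k) (truncated_wakimoto_K h k 1)
  finite_GG := pointwiseFinite_normalTerm _ (truncated_wakimoto_G h k) A
  finite_KGK s := pointwiseFinite_mulTerm₃ (suppNeg_wakimoto h k) (truncated_wakimoto_G h k s)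
    (suppPos_wakimoto h k) (truncated_wakimoto_K h k 1)
  finite_KWK := pointwiseFinite_mulTerm₃ (suppNeg_wakimoto h k) (truncated_wakimoto_W h k A)
    (suppPos_wakimoto h k) (truncated_wakimoto_K h k 1)
  finite_KpKm := pointwiseFinite_taylorTerm (truncated_wakimoto_K h k (-1))
  finite_TKm := pointwiseFinite_taylorTerm (truncated_wakimoto_K h k (-1))
  finite_KpT := pointwiseFinite_taylorTerm (truncated_wakimoto_T h k)
  finite_GKm _ := pointwiseFinite_taylorTerm (truncated_wakimoto_K h k (-1))
  finite_KpG s := pointwiseFinite_taylorTerm (truncated_wakimoto_G h k s)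
  K_zero v _ := by
    ext1 μ
    exact (vtxK_field_zero_apply h k 1 v μ).trans (vtxK_field_zero_apply h k (-1) v μ).symm
  K_zero_bij := bijOn_vtxK_field_zero h k A ρ σ 1
  rel_KK s m n v _ := DFunLike.congr_fun (wakimoto_rel_KK s m n) v
  rel_KmKp := by simpa only [one_smul] using (wakimoto_taylor_KmKp hg).eqOnSpace _
  rel_KmT := by simpa only [one_smul] using (wakimoto_taylor_KmT hg).eqOnSpace _
  rel_TKp := by simpa only [one_smul] using (wakimoto_taylor_TKp hg).eqOnSpace _
  rel_KmG s := (wakimoto_taylor_KmG hg s).eqOnSpace _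
  rel_GKp s := (wakimoto_taylor_GKp hg s).eqOnSpace _
  rel_GG s m n v _ := DFunLike.congr_fun (wakimoto_rel_GG hg s m n) v
  rel_GpGm := wakimoto_rel_GpGm hg A ρ σ
  rel_GT := wakimoto_rel_GT hg A ρ σ
  rel_TT := wakimoto_rel_TT hg A ρ σ

end

end SVir

theorem mainTheorem1 (h k : ℂ) (hgen : SVir.Generic h k) (A : SVir.Sector) (ρ σ : ℂ) :
    SVir.IsRepresentation h k A (SVir.fockSpace k A ρ σ) (SVir.wakimoto h k) :=
  SVir.wakimoto_isRepresentation hgen A ρ σ
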